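/- Let $k$ be a field and $(H,\mathcal R)$ a quasitriangular Hopf algebra over $k$: $\mathcal R=\mathcal R^{(1)}\otimes\mathcal R^{(2)}\in H\otimes H$ is invertible with $(\Delta\otimes\mathrm{id})\mathcal R=\mathcal R_{13}\mathcal R_{23}$, $(\mathrm{id}\otimes\Delta)\mathcal R=\mathcal R_{13}\mathcal R_{12}$ and $\tau\circ\Delta=\mathcal R(\Delta\,\cdot\,)\mathcal R^{-1}$. Write $\mathcal R^{-1}=\mathcal R^{-(1)}\otimes\mathcal R^{-(2)}$. The category $\mathcal M_H$ of right $H$-modules is braided by $\Psi(v\otimes w)=w\triangleleft\mathcal R^{(1)}\otimes v\triangleleft\mathcal R^{(2)}$. Let $B$ be a bialgebra in $\mathcal M_H$ (for example a Hopf algebra in $\mathcal M_H$), let $C$ be a Hopf algebra in $\mathcal M_H$ with invertible braided antipode $S$, and let $\mathrm{ev}:C\otimes B\to k$ be a categorical duality pairing, i.e. a morphism in $\mathcal M_H$ with $$\mathrm{ev}(cd,b)=\mathrm{ev}(d,b_{(1)})\,\mathrm{ev}(c,b_{(2)}),\quad \mathrm{ev}(c,ab)=\mathrm{ev}(c_{(2)},a)\,\mathrm{ev}(c_{(1)},b),\quad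 \mathrm{ev}(1,b)=\epsilon(b),\quad \mathrm{ev}(c,1)=\epsilon(c).$$ Let $\bar C$ be the vector space $C$ with the opposite product, the unit and counit of $C$, the left $H$-action $h\triangleright c=c\triangleleft S_Hh$ (where $S_H$ is the antipode of $H$), the coproduct $c_{\overline{(1)}}\otimes c_{\overline{(2)}}=c_{(1)}\triangleleft\mathcal R^{-(1)}\otimes c_{(2)}\triangleleft\mathcal R^{-(2)}$ and the antipode $\bar S=S^{-1}$, and write $\langle c,b\rangle=\mathrm{ev}(c,b)$. Let $U=U(\bar C,H,B)$ be the double bosonisation: the vector space $\bar C\otimes H\otimes B$ with unit $1\otimes1\otimes1$, counit $\epsilon\otimes\epsilon\otimes\epsilon$, product $$(c\otimes h\otimes b)(d\otimes g\otimes a)=c\,(h_{(1)}\mathcal R_1^{(2)}\triangleright d_{\overline{(2)}})\otimes h_{(2)}\mathcal R_2^{(2)}\mathcal R_1^{-(1)}g_{(1)}\otimes(b_{(2)}\triangleleft\mathcal R_2^{-(1)}g_{(2)})\,a\;\langle\mathcal R_1^{(1)}\triangleright d_{\overline{(1)}},b_{(1)}\triangleleft\mathcal R_2^{(1)}\rangle\langle\mathcal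 R_1^{-(2)}\triangleright\bar S d_{\overline{(3)}},b_{(3)}\triangleleft\mathcal R_2^{-(2)}\rangle,$$ where $\mathcal R_1,\mathcal R_2$ are copies of $\mathcal R$ and $\mathcal R_1^{-1},\mathcal R_2^{-1}$ copies of $\mathcal R^{-1}$, and coproduct $$\Delta(c\otimes h\otimes b)=\big(c_{\overline{(1)}}\otimes\mathcal R^{-(1)}h_{(1)}\otimes b_{(1)}\triangleleft\mathcal R^{(1)}\big)\otimes\big(\mathcal R^{-(2)}\triangleright c_{\overline{(2)}}\otimes h_{(2)}\mathcal R^{(2)}\otimes b_{(2)}\big).$$ **Lemma 3.11.** (a) Let $V$ be a $k$-vector space. Restricting a right $U$-action on $V$ to $H$, $B$ and $C\subseteq U$, and writing $c\triangleright v=v\triangleleft c$ for $c\in C$, gives a bijection from the right $U$-module structures on $V$ to the triples consisting of a right $H$-module structure on $V$, a right action $\triangleleft:V\otimes B\to V$ of the algebra $B$ that is a morphism in $\mathcal M_H$, and a left action $\triangleright:C\otimes V\to V$ of the algebra $C$ that is a morphism in $\mathcal M_H$, such that for all $v\in V$, $b\in B$, $c\in C$ $$c_{(1)}\triangleright\big((v\triangleleft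 b_{(1)})\triangleleft\mathcal R^{(1)}\big)\,\mathrm{ev}(c_{(2)}\triangleleft\mathcal R^{(2)},b_{(2)})=\mathrm{ev}(c_{(1)},b_{(1)}\triangleleft\mathcal R^{(1)})\,\big((c_{(2)}\triangleright v)\triangleleft\mathcal R^{(2)}\big)\triangleleft b_{(2)}.$$ (b) A linear map between right $U$-modules is a $U$-module map if and only if it commutes with the corresponding actions of $H$, $B$ and $C$. (c) Let $V$ be a unital associative $k$-algebra. The same restriction gives a bijection from the right $U$-module algebra structures on $V$ to the triples as in (a) for which in addition $V$ is a right $H$-module algebra, a right braided $B$-module algebra and a left braided $C$-module algebra in $\mathcal M_H$, that is, for all $v,w\in V$, $b\in B$, $c\in C$, $$(vw)\triangleleft b=\big(v\triangleleft(b_{(1)}\triangleleft\mathcal R^{(1)})\big)\big((w\triangleleft\mathcal R^{(2)})\triangleleft b_{(2)}\big),\qquad 1\triangleleft b=\epsilon(b)1,$$ $$c\triangleright(vw)=\big(c_{(1)}\triangleright(v\triangleleft\mathcal R^{(1)})\big)\big((c_{(2)}\triangleleft\mathcal R^{(2)})\triangleright w\big),\qquad c\triangleright1=\epsilon(c)1.$$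 -/

import Mathlib

open scoped TensorProduct

namespace DoubleBosonisation

noncomputable section

/-! ### Actions -/

section Actions

variable {k : Type*} [Field k] {A V W : Type*}
  [AddCommGroup A] [Module k A] [AddCommGroup V] [Module k V] [AddCommGroup W] [Module k W]

/-- `ρ v a = v ◁ a` is a right action on `V` of the algebra `A` with product `m` and unit `e`. -/
structure IsRightAction (m : A →ₗ[k] A →ₗ[k] A) (e : A) (ρ : V →ₗ[k] A →ₗ[k] V) : Prop where
  act_one : ∀ v, ρ v e = v
  act_mul : ∀ v a b, ρ v (m a b) = ρ (ρ v a) b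

/-- `l a v = a ▷ v` is a left action on `V` of the algebra `A` with product `m` and unit `e`. -/
structure IsLeftAction (m : A →ₗ[k] A →ₗ[k] A) (e : A) (l : A →ₗ[k] V →ₗ[k] V) : Prop where
  one_act : ∀ v, l e v = v
  mul_act : ∀ a b v, l (m a b) v = l a (l b v)

/-- The algebra `V` is a right module algebra for the coproduct `Δ` and the counit `ε` on `A`:
`(v w) ◁ a = (v ◁ a₁) (w ◁ a₂)` and `1 ◁ a = ε(a) 1`. -/
structure IsModuleAlgebra {V : Type*} [Ring V] [Algebra k V]
    (Δ : A →ₗ[k] A ⊗[k] A) (ε : A →ₗ[k] k) (ρ : V →ₗ[k] A →ₗ[k] V) : Prop where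
  mul_act : ∀ v w a, ρ (v * w) a = LinearMap.mul' k V (TensorProduct.map (ρ v) (ρ w) (Δ a))
  one_act : ∀ a, ρ 1 a = ε a • (1 : V)

/-- `a ⊗ b` acts on `V ⊗ W` by `α a ⊗ β b`. -/
def act₂ (α : A →ₗ[k] V →ₗ[k] V) (β : A →ₗ[k] W →ₗ[k] W) :
    A ⊗[k] A →ₗ[k] V ⊗[k] W →ₗ[k] V ⊗[k] W :=
  TensorProduct.homTensorHomMap (RingHom.id k) V W V W ∘ₗ TensorProduct.map α β

@[simp] theorem act₂_tmul (α : A →ₗ[k] V →ₗ[k] V) (β : A →ₗ[k] W →ₗ[k] W) (a b : A) (v : V)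
    (w : W) : act₂ α β (a ⊗ₜ b) (v ⊗ₜ w) = α a v ⊗ₜ β b w := by
  simp [act₂]

end Actions

/-! ### Quasitriangular Hopf algebras and the braiding of right modules -/

section Braiding

variable {k : Type*} [Field k] {H : Type*} [Ring H] [HopfAlgebra k H]

/-- `R` is a quasitriangular structure on `H`: `(Δ ⊗ id) R = R₁₃ R₂₃`, `(id ⊗ Δ) R = R₁₃ R₁₂`,
`τ ∘ Δ = R (Δ ·) R⁻¹`. -/
structure IsQuasitriangular (R : (H ⊗[k] H)ˣ) : Prop where
  comul_id : TensorProduct.assoc k H H H (Coalgebra.comul.rTensor H (R : H ⊗[k] H)) =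
    (TensorProduct.mk k H H 1).lTensor H (R : H ⊗[k] H) * (1 : H) ⊗ₜ[k] (R : H ⊗[k] H)
  id_comul : Coalgebra.comul.lTensor H (R : H ⊗[k] H) =
    (TensorProduct.mk k H H 1).lTensor H (R : H ⊗[k] H) *
      ((TensorProduct.mk k H H).flip 1).lTensor H (R : H ⊗[k] H)
  comm_comul : ∀ h : H, TensorProduct.comm k H H (Coalgebra.comul h) =
    (R : H ⊗[k] H) * Coalgebra.comul h * ((R⁻¹ : (H ⊗[k] H)ˣ) : H ⊗[k] H)

variable {V W X Y : Type*} [AddCommGroup V] [Module k V] [AddCommGroup W] [Module k W]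
  [AddCommGroup X] [Module k X] [AddCommGroup Y] [Module k Y]

/-- The braiding `Ψ(v ⊗ w) = w ◁ R⁽¹⁾ ⊗ v ◁ R⁽²⁾` of the right `H`-modules `(V, ρ)`, `(W, σ)`. -/
def braiding (R : (H ⊗[k] H)ˣ) (ρ : V →ₗ[k] H →ₗ[k] V) (σ : W →ₗ[k] H →ₗ[k] W) :
    V ⊗[k] W →ₗ[k] W ⊗[k] V :=
  act₂ σ.flip ρ.flip (R : H ⊗[k] H) ∘ₗ (TensorProduct.comm k V W).toLinearMap

/-- `id ⊗ Ψ ⊗ id : (V ⊗ W) ⊗ (X ⊗ Y) → (V ⊗ X) ⊗ (W ⊗ Y)`, where `Ψ` is the braiding of the right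
`H`-modules `(W, σ)` and `(X, ξ)`. -/
def midBraiding (V Y : Type*) [AddCommGroup V] [Module k V] [AddCommGroup Y] [Module k Y]
    (R : (H ⊗[k] H)ˣ) (σ : W →ₗ[k] H →ₗ[k] W) (ξ : X →ₗ[k] H →ₗ[k] X) :
    (V ⊗[k] W) ⊗[k] (X ⊗[k] Y) →ₗ[k] (V ⊗[k] X) ⊗[k] (W ⊗[k] Y) :=
  (TensorProduct.assoc k V X (W ⊗[k] Y)).symm.toLinearMap ∘ₗ
    LinearMap.lTensor V ((TensorProduct.assoc k X W Y).toLinearMap ∘ₗ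
      (braiding R σ ξ).rTensor Y ∘ₗ (TensorProduct.assoc k W X Y).symm.toLinearMap) ∘ₗ
    (TensorProduct.assoc k V W (X ⊗[k] Y)).toLinearMap

/-- The action `V ⊗ A → X` is a morphism of right `H`-modules, where `H` acts on `V ⊗ W` through
its coproduct: `f(v ⊗ w) ◁ h = f(v ◁ h₁ ⊗ w ◁ h₂)`. -/
def IsEquivariant₂ (ρ : V →ₗ[k] H →ₗ[k] V) (σ : W →ₗ[k] H →ₗ[k] W) (ξ : X →ₗ[k] H →ₗ[k] X)
    (f : V →ₗ[k] W →ₗ[k] X) : Prop :=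
  ∀ v w h, ξ (f v w) h = TensorProduct.lift f (TensorProduct.map (ρ v) (σ w) (Coalgebra.comul h))

/-- The trivial right action `x ◁ h = x ε(h)` of `H` on `k`. -/
def trivialAction (k H : Type*) [Field k] [Ring H] [HopfAlgebra k H] : k →ₗ[k] H →ₗ[k] k :=
  (LinearMap.mul k k).compl₂ Coalgebra.counit

end Braiding

/-! ### Braided groups and their duality -/

section BraidedGroups

variable {k : Type*} [Field k] {H : Type*} [Ring H] [HopfAlgebra k H]

/-- The algebra and coalgebra `B` with the right action `β` of `H` is a bialgebra in the braided
category of right `H`-modules. -/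
structure IsBraidedBialgebra {B : Type*} [Ring B] [Algebra k B] [Coalgebra k B]
    (R : (H ⊗[k] H)ˣ) (β : B →ₗ[k] H →ₗ[k] B) : Prop where
  isRightAction : IsRightAction (LinearMap.mul k H) 1 β
  /-- the product and the unit are morphisms -/
  isModuleAlgebra : IsModuleAlgebra Coalgebra.comul Coalgebra.counit β
  /-- the coproduct and the counit are morphisms -/
  comul_act : ∀ b h, Coalgebra.comul (β b h) =
    act₂ β.flip β.flip (Coalgebra.comul h) (Coalgebra.comul (R := k) b)
  counit_act : ∀ b h, Coalgebra.counit (R := k) (β b h) =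
    Coalgebra.counit (R := k) b * Coalgebra.counit (R := k) h
  /-- the coproduct is an algebra map to the braided tensor product algebra:
  `Δ(a b) = a₁ (b₁ ◁ R⁽¹⁾) ⊗ (a₂ ◁ R⁽²⁾) b₂` -/
  comul_mul : ∀ a b : B, Coalgebra.comul (a * b) =
    TensorProduct.map (LinearMap.mul' k B) (LinearMap.mul' k B)
      (midBraiding B B R β β (Coalgebra.comul a ⊗ₜ[k] Coalgebra.comul b))
  comul_one : Coalgebra.comul (R := k) (1 : B) = 1 ⊗ₜ[k] 1
  counit_mul : ∀ a b : B, Coalgebra.counit (R := k) (a * b) =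
    Coalgebra.counit (R := k) a * Coalgebra.counit (R := k) b
  counit_one : Coalgebra.counit (R := k) (1 : B) = 1

/-- `S` is a braided antipode: a morphism of right `H`-modules, convolution inverse to `id`. -/
structure IsBraidedAntipode {B : Type*} [Ring B] [Algebra k B] [Coalgebra k B]
    (β : B →ₗ[k] H →ₗ[k] B) (S : B →ₗ[k] B) : Prop where
  map_act : ∀ b h, S (β b h) = β (S b) h
  mul_antipode_rTensor_comul : ∀ b, LinearMap.mul' k B (S.rTensor B (Coalgebra.comul b)) =
    algebraMap k B (Coalgebra.counit b)
  mul_antipode_lTensor_comul : ∀ b, LinearMap.mul' k B (S.lTensor B (Coalgebra.comul b)) =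
    algebraMap k B (Coalgebra.counit b)

/-- A categorical duality pairing of the braided groups `(C, γ)` and `(B, β)`. -/
structure IsDualPairing {B C : Type*} [Ring B] [Algebra k B] [Coalgebra k B]
    [Ring C] [Algebra k C] [Coalgebra k C]
    (β : B →ₗ[k] H →ₗ[k] B) (γ : C →ₗ[k] H →ₗ[k] C) (ev : C →ₗ[k] B →ₗ[k] k) : Prop where
  /-- `ev` is a morphism of right `H`-modules -/
  equivariant : IsEquivariant₂ γ β (trivialAction k H) ev
  /-- `ev(c d, b) = ev(d, b₁) ev(c, b₂)` -/
  mul_left : ∀ c d b, ev (c * d) b =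
    LinearMap.mul' k k (TensorProduct.map (ev d) (ev c) (Coalgebra.comul b))
  /-- `ev(c, a b) = ev(c₂, a) ev(c₁, b)` -/
  mul_right : ∀ c a b, ev c (a * b) =
    LinearMap.mul' k k (TensorProduct.map (ev.flip b) (ev.flip a) (Coalgebra.comul c))
  one_left : ∀ b, ev 1 b = Coalgebra.counit b
  one_right : ∀ c, ev c 1 = Coalgebra.counit c

end BraidedGroups

/-! ### The braided group `C̄` in left `H`-modules

`C̄` is the vector space `C` with the opposite product, the unit and counit of `C`, and the
following left `H`-action, coproduct and antipode; the pairing with `B` is `⟨c, b⟩ = ev(c, b)`. -/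

section CBar

variable {k : Type*} [Field k] {H : Type*} [Ring H] [HopfAlgebra k H]
  {C : Type*} [Ring C] [Algebra k C] [Coalgebra k C]

/-- The product of `C̄`. -/
def mulBar (k C : Type*) [Field k] [Ring C] [Algebra k C] : C →ₗ[k] C →ₗ[k] C :=
  (LinearMap.mul k C).flip

/-- The left action `h ▷ c = c ◁ S h` of `H` on `C̄`. -/
def actBar (γ : C →ₗ[k] H →ₗ[k] C) : H →ₗ[k] C →ₗ[k] C :=
  γ.flip ∘ₗ HopfAlgebra.antipode k

/-- The coproduct `c ↦ c₁ ◁ R⁻⁽¹⁾ ⊗ c₂ ◁ R⁻⁽²⁾` of `C̄`. -/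
def comulBar (R : (H ⊗[k] H)ˣ) (γ : C →ₗ[k] H →ₗ[k] C) : C →ₗ[k] C ⊗[k] C :=
  act₂ γ.flip γ.flip ((R⁻¹ : (H ⊗[k] H)ˣ) : H ⊗[k] H) ∘ₗ Coalgebra.comul

/-- The map `c ↦ R⁻⁽¹⁾ ⊗ R⁻⁽²⁾ ▷ c`. -/
def coactBar (R : (H ⊗[k] H)ˣ) (γ : C →ₗ[k] H →ₗ[k] C) : C →ₗ[k] H ⊗[k] C :=
  act₂ (LinearMap.mul k H) (actBar γ) ((R⁻¹ : (H ⊗[k] H)ˣ) : H ⊗[k] H) ∘ₗ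
    TensorProduct.mk k H C 1

end CBar

/-! ### The double bosonisation `U` on `C̄ ⊗ H ⊗ B` -/

section DoubleBosonisation

variable {k : Type*} [Field k] {H : Type*} [Ring H] [HopfAlgebra k H]
  {B : Type*} [Ring B] [Algebra k B] [Coalgebra k B]
  {C : Type*} [Ring C] [Algebra k C] [Coalgebra k C]

/-- The map `b ↦ b ◁ R⁽¹⁾ ⊗ R⁽²⁾`. -/
def coact (R : (H ⊗[k] H)ˣ) (β : B →ₗ[k] H →ₗ[k] B) : B →ₗ[k] B ⊗[k] H :=
  act₂ β.flip (LinearMap.mul k H) (R : H ⊗[k] H) ∘ₗ (TensorProduct.mk k B H).flip 1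

/-- `(x ⊗ y ⊗ p ⊗ z) ⊗ (u ⊗ q ⊗ w ⊗ t) ↦ ⟨x, u⟩ ⟨z, t⟩ y ⊗ q p ⊗ w`. -/
def contract (H : Type*) [Ring H] [HopfAlgebra k H] (ev : C →ₗ[k] B →ₗ[k] k) :
    (C ⊗[k] (C ⊗[k] (H ⊗[k] C))) ⊗[k] (B ⊗[k] (H ⊗[k] (B ⊗[k] B))) →ₗ[k]
      C ⊗[k] (H ⊗[k] B) :=
  let e : C ⊗[k] B →ₗ[k] k := TensorProduct.lift ev
  let pz : (H ⊗[k] C) ⊗[k] (B ⊗[k] B) →ₗ[k] H ⊗[k] B :=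
    (TensorProduct.rid k (H ⊗[k] B)).toLinearMap ∘ₗ e.lTensor (H ⊗[k] B) ∘ₗ
      (TensorProduct.tensorTensorTensorComm k H C B B).toLinearMap
  let qp : H ⊗[k] (H ⊗[k] B) →ₗ[k] H ⊗[k] B :=
    (LinearMap.mul' k H).rTensor B ∘ₗ (TensorProduct.assoc k H H B).symm.toLinearMap
  let y : (C ⊗[k] (H ⊗[k] C)) ⊗[k] (H ⊗[k] (B ⊗[k] B)) →ₗ[k] C ⊗[k] (H ⊗[k] B) :=
    (qp ∘ₗ pz.lTensor H).lTensor C ∘ₗ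
      (TensorProduct.assoc k C H ((H ⊗[k] C) ⊗[k] (B ⊗[k] B))).toLinearMap ∘ₗ
      (TensorProduct.tensorTensorTensorComm k C (H ⊗[k] C) H (B ⊗[k] B)).toLinearMap
  (TensorProduct.lid k (C ⊗[k] (H ⊗[k] B))).toLinearMap ∘ₗ TensorProduct.map e y ∘ₗ
    (TensorProduct.tensorTensorTensorComm k C (C ⊗[k] (H ⊗[k] C)) B
      (H ⊗[k] (B ⊗[k] B))).toLinearMap

theorem contract_tmul (ev : C →ₗ[k] B →ₗ[k] k) (x y z : C) (p q : H) (u w t : B) :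
    contract H ev ((x ⊗ₜ (y ⊗ₜ (p ⊗ₜ z))) ⊗ₜ (u ⊗ₜ (q ⊗ₜ (w ⊗ₜ t)))) =
      (ev x u * ev z t) • (y ⊗ₜ[k] ((q * p) ⊗ₜ[k] w)) := by
  simp [contract, TensorProduct.tmul_smul, smul_smul, mul_comm]

/-- The reordering of the product `b c` in `U` (with `R₁`, `R₂` copies of `R`):
`b c = (R₁⁽²⁾ ▷ c₂) ⊗ R₂⁽²⁾ R₁⁻⁽¹⁾ ⊗ (b₂ ◁ R₂⁻⁽¹⁾)
  ⟨R₁⁽¹⁾ ▷ c₁, b₁ ◁ R₂⁽¹⁾⟩ ⟨R₁⁻⁽²⁾ ▷ S̄ c₃, b₃ ◁ R₂⁻⁽²⁾⟩`,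
where `c₁ ⊗ c₂ ⊗ c₃` is the iterated coproduct of `C̄` and `S̄` is the inverse of the braided
antipode `S` of `C`. -/
def cross (R : (H ⊗[k] H)ˣ) (β : B →ₗ[k] H →ₗ[k] B) (γ : C →ₗ[k] H →ₗ[k] C) (S : C ≃ₗ[k] C)
    (ev : C →ₗ[k] B →ₗ[k] k) : B ⊗[k] C →ₗ[k] C ⊗[k] (H ⊗[k] B) :=
  let legsC : C →ₗ[k] C ⊗[k] (C ⊗[k] (H ⊗[k] C)) :=
    (TensorProduct.assoc k C C (H ⊗[k] C)).toLinearMap ∘ₗ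
      TensorProduct.map (act₂ (actBar γ) (actBar γ) (R : H ⊗[k] H) ∘ₗ comulBar R γ)
        (coactBar R γ ∘ₗ S.symm.toLinearMap) ∘ₗ comulBar R γ
  let legsB : B →ₗ[k] B ⊗[k] (H ⊗[k] (B ⊗[k] B)) :=
    (TensorProduct.assoc k B H (B ⊗[k] B)).toLinearMap ∘ₗ
      TensorProduct.map (coact R β)
        (act₂ β.flip β.flip ((R⁻¹ : (H ⊗[k] H)ˣ) : H ⊗[k] H) ∘ₗ Coalgebra.comul) ∘ₗ
      Coalgebra.comul
  contract H ev ∘ₗ TensorProduct.map legsC legsB ∘ₗ (TensorProduct.comm k B C).toLinearMap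

/-- Left multiplication by `c ∈ C̄` on `C̄ ⊗ H ⊗ B`. -/
def leftC (k H B C : Type*) [Field k] [Ring H] [HopfAlgebra k H] [Ring B] [Algebra k B]
    [Ring C] [Algebra k C] : C →ₗ[k] C ⊗[k] (H ⊗[k] B) →ₗ[k] C ⊗[k] (H ⊗[k] B) :=
  LinearMap.rTensorHom (H ⊗[k] B) ∘ₗ mulBar k C

/-- Left multiplication by `h ∈ H` on `C̄ ⊗ H ⊗ B`: `h (d ⊗ g ⊗ a) = h₁ ▷ d ⊗ h₂ g ⊗ a`. -/
def leftH (B : Type*) [Ring B] [Algebra k B] (γ : C →ₗ[k] H →ₗ[k] C) :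
    H →ₗ[k] C ⊗[k] (H ⊗[k] B) →ₗ[k] C ⊗[k] (H ⊗[k] B) :=
  act₂ (actBar γ) (LinearMap.rTensorHom B ∘ₗ LinearMap.mul k H) ∘ₗ Coalgebra.comul

/-- Right multiplication by `g ∈ H` on `C̄ ⊗ H ⊗ B`: `(c ⊗ h ⊗ b) g = c ⊗ h g₁ ⊗ b ◁ g₂`. -/
def rightH (C : Type*) [Ring C] [Algebra k C] (β : B →ₗ[k] H →ₗ[k] B) :
    H →ₗ[k] C ⊗[k] (H ⊗[k] B) →ₗ[k] C ⊗[k] (H ⊗[k] B) :=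
  LinearMap.lTensorHom C ∘ₗ act₂ (LinearMap.mul k H).flip β.flip ∘ₗ Coalgebra.comul

/-- Right multiplication by `a ∈ B` on `C̄ ⊗ H ⊗ B`. -/
def rightB (k H B C : Type*) [Field k] [Ring H] [HopfAlgebra k H] [Ring B] [Algebra k B]
    [Ring C] [Algebra k C] : B →ₗ[k] C ⊗[k] (H ⊗[k] B) →ₗ[k] C ⊗[k] (H ⊗[k] B) :=
  LinearMap.lTensorHom C ∘ₗ LinearMap.lTensorHom H ∘ₗ (LinearMap.mul k B).flip

/-- The product of `U`: if `b d = ∑ dᵢ ⊗ rᵢ ⊗ bᵢ` by the reordering above, then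
`(c ⊗ h ⊗ b) (d ⊗ g ⊗ a) = ∑ c (h₁ ▷ dᵢ) ⊗ h₂ rᵢ g₁ ⊗ (bᵢ ◁ g₂) a`. -/
def mulU (R : (H ⊗[k] H)ˣ) (β : B →ₗ[k] H →ₗ[k] B) (γ : C →ₗ[k] H →ₗ[k] C) (S : C ≃ₗ[k] C)
    (ev : C →ₗ[k] B →ₗ[k] k) :
    C ⊗[k] (H ⊗[k] B) →ₗ[k] C ⊗[k] (H ⊗[k] B) →ₗ[k] C ⊗[k] (H ⊗[k] B) :=
  let left : C ⊗[k] H →ₗ[k] Module.End k (C ⊗[k] (H ⊗[k] B)) :=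
    LinearMap.mul' k _ ∘ₗ TensorProduct.map (leftC k H B C) (leftH B γ)
  let right : H ⊗[k] B →ₗ[k] Module.End k (C ⊗[k] (H ⊗[k] B)) :=
    LinearMap.mul' k _ ∘ₗ TensorProduct.map (rightB k H B C) (rightH C β) ∘ₗ
      (TensorProduct.comm k H B).toLinearMap
  TensorProduct.curry <|
    TensorProduct.lift left ∘ₗ
    LinearMap.lTensor (C ⊗[k] H) (TensorProduct.lift (LinearMap.flip right) ∘ₗ
      (cross R β γ S ev).rTensor (H ⊗[k] B) ∘ₗ
      (TensorProduct.assoc k B C (H ⊗[k] B)).symm.toLinearMap) ∘ₗ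
    (TensorProduct.assoc k (C ⊗[k] H) B (C ⊗[k] (H ⊗[k] B))).toLinearMap ∘ₗ
    (TensorProduct.assoc k C H B).symm.toLinearMap.rTensor (C ⊗[k] (H ⊗[k] B))

theorem mulU_tmul (R : (H ⊗[k] H)ˣ) (β : B →ₗ[k] H →ₗ[k] B) (γ : C →ₗ[k] H →ₗ[k] C)
    (S : C ≃ₗ[k] C) (ev : C →ₗ[k] B →ₗ[k] k) (c d : C) (h g : H) (b a : B) :
    mulU R β γ S ev (c ⊗ₜ (h ⊗ₜ b)) (d ⊗ₜ (g ⊗ₜ a)) =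
      leftC k H B C c (leftH B γ h (rightB k H B C a (rightH C β g
        (cross R β γ S ev (b ⊗ₜ d))))) := by
  simp [mulU]

/-- The unit of `U`. -/
def oneU (k H B C : Type*) [Field k] [Ring H] [HopfAlgebra k H] [Ring B] [Algebra k B]
    [Ring C] [Algebra k C] : C ⊗[k] (H ⊗[k] B) := 1 ⊗ₜ (1 ⊗ₜ 1)

/-- The coproduct of `U`: `Δ(c ⊗ h ⊗ b) =
(c₁ ⊗ R⁻⁽¹⁾ h₁ ⊗ b₁ ◁ R⁽¹⁾) ⊗ (R⁻⁽²⁾ ▷ c₂ ⊗ h₂ R⁽²⁾ ⊗ b₂)`,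
where `c₁ ⊗ c₂` is the coproduct of `C̄`. -/
def comulU (R : (H ⊗[k] H)ˣ) (β : B →ₗ[k] H →ₗ[k] B) (γ : C →ₗ[k] H →ₗ[k] C) :
    C ⊗[k] (H ⊗[k] B) →ₗ[k] (C ⊗[k] (H ⊗[k] B)) ⊗[k] (C ⊗[k] (H ⊗[k] B)) :=
  let legsC : C →ₗ[k] (C ⊗[k] H) ⊗[k] C :=
    (TensorProduct.assoc k C H C).symm.toLinearMap ∘ₗ (coactBar R γ).lTensor C ∘ₗ comulBar R γ
  let legsB : B →ₗ[k] B ⊗[k] (H ⊗[k] B) :=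
    (TensorProduct.assoc k B H B).toLinearMap ∘ₗ (coact R β).rTensor B ∘ₗ Coalgebra.comul
  let mulH : H ⊗[k] (H ⊗[k] B) →ₗ[k] H ⊗[k] B :=
    (LinearMap.mul' k H).rTensor B ∘ₗ (TensorProduct.assoc k H H B).symm.toLinearMap
  let join : (C ⊗[k] H) ⊗[k] (H ⊗[k] B) →ₗ[k] C ⊗[k] (H ⊗[k] B) :=
    mulH.lTensor C ∘ₗ (TensorProduct.assoc k C H (H ⊗[k] B)).toLinearMap
  TensorProduct.map join (mulH.lTensor C) ∘ₗ
    (TensorProduct.tensorTensorTensorComm k (C ⊗[k] H) C (H ⊗[k] B)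
      (H ⊗[k] (H ⊗[k] B))).toLinearMap ∘ₗ
    TensorProduct.map legsC
      ((TensorProduct.tensorTensorTensorComm k H H B (H ⊗[k] B)).toLinearMap ∘ₗ
        TensorProduct.map Coalgebra.comul legsB)

/-- The counit of `U`. -/
def counitU (k H B C : Type*) [Field k] [Ring H] [HopfAlgebra k H] [Ring B] [Algebra k B]
    [Coalgebra k B] [Ring C] [Algebra k C] [Coalgebra k C] : C ⊗[k] (H ⊗[k] B) →ₗ[k] k :=
  LinearMap.mul' k k ∘ₗ TensorProduct.map Coalgebra.counit
    (LinearMap.mul' k k ∘ₗ TensorProduct.map Coalgebra.counit Coalgebra.counit)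

/-- The inclusion of `H` in `U`. -/
def inclH (k H B C : Type*) [Field k] [Ring H] [HopfAlgebra k H] [Ring B] [Algebra k B]
    [Ring C] [Algebra k C] : H →ₗ[k] C ⊗[k] (H ⊗[k] B) :=
  TensorProduct.mk k C (H ⊗[k] B) 1 ∘ₗ (TensorProduct.mk k H B).flip 1

/-- The inclusion of `B` in `U`. -/
def inclB (k H B C : Type*) [Field k] [Ring H] [HopfAlgebra k H] [Ring B] [Algebra k B]
    [Ring C] [Algebra k C] : B →ₗ[k] C ⊗[k] (H ⊗[k] B) :=
  TensorProduct.mk k C (H ⊗[k] B) 1 ∘ₗ TensorProduct.mk k H B 1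

/-- The inclusion of `C` in `U`. -/
def inclC (k H B C : Type*) [Field k] [Ring H] [HopfAlgebra k H] [Ring B] [Algebra k B]
    [Ring C] [Algebra k C] : C →ₗ[k] C ⊗[k] (H ⊗[k] B) :=
  (TensorProduct.mk k C (H ⊗[k] B)).flip (1 ⊗ₜ 1)

/-! ### Compatible actions of `H`, `B` and `C` -/

/-- A right action `v ◁ h` of `H`, a right action `v ◁ b` of `B` and a left action `c ▷ v` of `C`
on `V` (bare maps, without axioms). -/
@[ext] structure Actions (k H B C V : Type*) [Field k] [Ring H] [HopfAlgebra k H] [Ring B]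
    [Algebra k B] [Ring C] [Algebra k C] [AddCommGroup V] [Module k V] where
  actH : V →ₗ[k] H →ₗ[k] V
  actB : V →ₗ[k] B →ₗ[k] V
  actC : C →ₗ[k] V →ₗ[k] V

/-- The restriction of a right action of `U` to `H`, `B` and `C`, where `c ▷ v = v ◁ c`. -/
def restrict {V : Type*} [AddCommGroup V] [Module k V]
    (ρ : V →ₗ[k] C ⊗[k] (H ⊗[k] B) →ₗ[k] V) : Actions k H B C V where
  actH := ρ.compl₂ (inclH k H B C)
  actB := ρ.compl₂ (inclB k H B C)
  actC := (ρ.compl₂ (inclC k H B C)).flip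

/-- `V` is a right `H`-module with a right braided action of `B` and a left braided action of `C`
in the category of right `H`-modules that are compatible:
`c₁ ▷ ((v ◁ b₁) ◁ R⁽¹⁾) ev(c₂ ◁ R⁽²⁾, b₂) = ev(c₁, b₁ ◁ R⁽¹⁾) ((c₂ ▷ v) ◁ R⁽²⁾) ◁ b₂`. -/
structure Actions.IsCrossed {V : Type*} [AddCommGroup V] [Module k V]
    (R : (H ⊗[k] H)ˣ) (β : B →ₗ[k] H →ₗ[k] B) (γ : C →ₗ[k] H →ₗ[k] C)
    (ev : C →ₗ[k] B →ₗ[k] k) (t : Actions k H B C V) : Prop where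
  isRightAction_H : IsRightAction (LinearMap.mul k H) 1 t.actH
  isRightAction_B : IsRightAction (LinearMap.mul k B) 1 t.actB
  equivariant_B : IsEquivariant₂ t.actH β t.actH t.actB
  isLeftAction_C : IsLeftAction (LinearMap.mul k C) 1 t.actC
  equivariant_C : IsEquivariant₂ γ t.actH t.actH t.actC
  compatible : ∀ c v b,
    TensorProduct.rid k V (TensorProduct.map (TensorProduct.lift t.actC) (TensorProduct.lift ev)
      (midBraiding C B R γ t.actH
        (Coalgebra.comul c ⊗ₜ[k] (t.actB v).rTensor B (Coalgebra.comul b)))) =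
    TensorProduct.lid k V (TensorProduct.map (TensorProduct.lift ev) (TensorProduct.lift t.actB)
      (midBraiding C B R t.actH β
        ((t.actC.flip v).lTensor C (Coalgebra.comul c) ⊗ₜ[k] Coalgebra.comul b)))

/-- The algebra `V` is a right `H`-module algebra, a right braided `B`-module algebra and a left
braided `C`-module algebra in the category of right `H`-modules, for compatible actions. -/
structure Actions.IsCrossedAlgebra {V : Type*} [Ring V] [Algebra k V]
    (R : (H ⊗[k] H)ˣ) (β : B →ₗ[k] H →ₗ[k] B) (γ : C →ₗ[k] H →ₗ[k] C)
    (ev : C →ₗ[k] B →ₗ[k] k) (t : Actions k H B C V) : Prop extends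
    t.IsCrossed R β γ ev where
  isModuleAlgebra_H : IsModuleAlgebra Coalgebra.comul Coalgebra.counit t.actH
  /-- `(v w) ◁ b = (v ◁ (b₁ ◁ R⁽¹⁾)) ((w ◁ R⁽²⁾) ◁ b₂)` -/
  mul_actB : ∀ v w b, t.actB (v * w) b = LinearMap.mul' k V
    (TensorProduct.map (TensorProduct.lift t.actB) (TensorProduct.lift t.actB)
      (midBraiding V B R t.actH β ((v ⊗ₜ[k] w) ⊗ₜ[k] Coalgebra.comul b)))
  one_actB : ∀ b, t.actB 1 b = Coalgebra.counit (R := k) b • (1 : V)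
  /-- `c ▷ (v w) = (c₁ ▷ (v ◁ R⁽¹⁾)) ((c₂ ◁ R⁽²⁾) ▷ w)` -/
  mul_actC : ∀ c v w, t.actC c (v * w) = LinearMap.mul' k V
    (TensorProduct.map (TensorProduct.lift t.actC) (TensorProduct.lift t.actC)
      (midBraiding C V R γ t.actH (Coalgebra.comul c ⊗ₜ[k] (v ⊗ₜ[k] w))))
  one_actC : ∀ c, t.actC c 1 = Coalgebra.counit (R := k) c • (1 : V)

end DoubleBosonisation

end

end DoubleBosonisation

open DoubleBosonisation

/-! In `U` every `c ⊗ h ⊗ b` is the product `c h b`, so a right action of `U` is determined by its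
restrictions, and the only possible inverse of `restrict` is `v ◁ (c ⊗ h ⊗ b) = ((c ▷ v) ◁ h) ◁ b`,
the map `Actions.extend`. By `mulU_tmul` the product of `U` is made of the products of the three
factors, the relations `h c = (h₁ ▷ c) h₂` and `b h = h₁ (b ◁ h₂)`, and the reordering `cross` of `b
c`. All of these except the last translate directly into the module axioms and the equivariance of
the actions of `B` and `C`. What remains is `Actions.compatible_iff`: the compatibility condition is
equivalent to `c ▷ (v ◁ b) = v ◁ cross (b ⊗ c)`.

For this, fix `v` and work with maps from `C` to `Hom(B, V)`. Let `K(c)(b) = c ▷ (v ◁ b)` (`actBC`)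
and let `L(c)(b)` be the right-hand side of the compatibility condition (`crossRight`). Through
`pairAct` the space `Hom(B, V)` is a left `C`-module, with `(c · n)(b) = (n(b₁) ◁ R⁽¹⁾) ev(c ◁ R⁽²⁾,
b₂)`. In terms of the coproduct of `C̄`, the left-hand side of the condition is `c₂ · K(c₁)`
(`compatible_left_eq`), and the action of the reordered product is `S⁻¹(c₂) · L(c₁)`
(`extend_cross`). So the condition says that `L` is the twist of `K` by `id`, and the reordering
says that `K` is the twist of `L` by `S⁻¹`. The two twists are mutually inverse
(`twistBar_twistBar`) because `S⁻¹` is an antipode for `C̄`. This rests on the coassociativity of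
`C̄`, which is the Yang–Baxter equation, and on the braided anti-multiplicativity of `S`, which is
the uniqueness of convolution inverses on the braided tensor coalgebra `C ⊗ C`.

For module algebras, `extend_comulU` shows that the coproduct of `U` acts on `V ⊗ V` by the
composite of the braided tensor actions of `C`, `H` and `B`. Multiplicativity over the three factors
therefore gives it over `U`, and setting two of the three entries equal to `1` gives the converse.

Most identities that involve `R` are first stated for arbitrary elements of `H ⊗ H` in place of `R`
and `R⁻¹`, where pure tensors suffice; the properties of `R` are used only afterwards. -/

namespace DoubleBosonisation

noncomputable section

set_option linter.unusedSectionVars false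

/-! ### Actions of tensor product algebras on tensor products. -/

section TensorAct

variable {k : Type*} [Field k] {A A' V W : Type*}
  [Ring A] [Algebra k A] [Ring A'] [Algebra k A']
  [AddCommGroup V] [Module k V] [AddCommGroup W] [Module k W]

/-- `a ⊗ a'` acts on `V ⊗ W` by `α a ⊗ β a'`. -/
def tensorAct (α : A →ₗ[k] V →ₗ[k] V) (β : A' →ₗ[k] W →ₗ[k] W) :
    A ⊗[k] A' →ₗ[k] V ⊗[k] W →ₗ[k] V ⊗[k] W :=
  TensorProduct.homTensorHomMap (RingHom.id k) V W V W ∘ₗ TensorProduct.map α β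

@[simp] theorem tensorAct_tmul (α : A →ₗ[k] V →ₗ[k] V) (β : A' →ₗ[k] W →ₗ[k] W) (a : A) (b : A')
    (v : V) (w : W) : tensorAct α β (a ⊗ₜ b) (v ⊗ₜ w) = α a v ⊗ₜ β b w := by
  simp [tensorAct]

theorem act₂_eq_tensorAct (α : A →ₗ[k] V →ₗ[k] V) (β : A →ₗ[k] W →ₗ[k] W) :
    act₂ α β = tensorAct α β := rfl

/-- `α` is a unital anti-homomorphism to the endomorphisms of `V`. -/
structure IsAntiAction (α : A →ₗ[k] V →ₗ[k] V) : Prop where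
  map_one : ∀ v, α 1 v = v
  map_mul : ∀ a b v, α (a * b) v = α b (α a v)

theorem IsRightAction.flip {ρ : V →ₗ[k] A →ₗ[k] V} (h : IsRightAction (LinearMap.mul k A) 1 ρ) :
    IsAntiAction ρ.flip where
  map_one v := by simpa using h.act_one v
  map_mul a b v := by simpa using h.act_mul v a b

/-- This lets successive actions on several tensor factors be read as one product in a tensor power
of `H`, with the order reversed; in particular `R⁻¹` followed by `R` cancels. -/
theorem IsAntiAction.tensorAct {α : A →ₗ[k] V →ₗ[k] V} {β : A' →ₗ[k] W →ₗ[k] W}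
    (hα : IsAntiAction α) (hβ : IsAntiAction β) : IsAntiAction (tensorAct α β) where
  map_one t := by
    rw [Algebra.TensorProduct.one_def]
    induction t with
    | zero => simp
    | tmul v w => simp [hα.map_one, hβ.map_one]
    | add x y hx hy => rw [map_add, hx, hy]
  map_mul X Y t := by
    induction t with
    | zero => simp
    | add x y hx hy => simp only [map_add, hx, hy]
    | tmul v w =>
      induction X with
      | zero => simp
      | add x y hx hy => simp only [add_mul, map_add, LinearMap.add_apply, hx, hy]
      | tmul a a' =>
        induction Y with
        | zero => simp
        | add x y hx hy => simp only [mul_add, map_add, LinearMap.add_apply, hx, hy]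
        | tmul b b' => simp [hα.map_mul, hβ.map_mul]

end TensorAct

/-! ### Consequences of quasitriangularity: inverses, counits, antipodes, Yang–Baxter. -/

section Quasitriangular

variable {k : Type*} [Field k] {H : Type*} [Ring H] [HopfAlgebra k H]

/-- The embedding `a ⊗ b ↦ a ⊗ b ⊗ 1`. -/
def leg₁₂ (k H : Type*) [Field k] [Ring H] [HopfAlgebra k H] :
    H ⊗[k] H →ₐ[k] H ⊗[k] (H ⊗[k] H) :=
  Algebra.TensorProduct.map (AlgHom.id k H) Algebra.TensorProduct.includeLeft

/-- The embedding `a ⊗ b ↦ a ⊗ 1 ⊗ b`. -/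
def leg₁₃ (k H : Type*) [Field k] [Ring H] [HopfAlgebra k H] :
    H ⊗[k] H →ₐ[k] H ⊗[k] (H ⊗[k] H) :=
  Algebra.TensorProduct.map (AlgHom.id k H) Algebra.TensorProduct.includeRight

/-- The embedding `a ⊗ b ↦ 1 ⊗ a ⊗ b`. -/
def leg₂₃ (k H : Type*) [Field k] [Ring H] [HopfAlgebra k H] :
    H ⊗[k] H →ₐ[k] H ⊗[k] (H ⊗[k] H) :=
  Algebra.TensorProduct.includeRight

/-- The algebra map `Δ ⊗ id`. -/
def comulLeft (k H : Type*) [Field k] [Ring H] [HopfAlgebra k H] :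
    H ⊗[k] H →ₐ[k] H ⊗[k] (H ⊗[k] H) :=
  (Algebra.TensorProduct.assoc k k k H H H).toAlgHom.comp
    (Algebra.TensorProduct.map (Bialgebra.comulAlgHom k H) (AlgHom.id k H))

/-- The algebra map `id ⊗ Δ`. -/
def comulRight (k H : Type*) [Field k] [Ring H] [HopfAlgebra k H] :
    H ⊗[k] H →ₐ[k] H ⊗[k] (H ⊗[k] H) :=
  Algebra.TensorProduct.map (AlgHom.id k H) (Bialgebra.comulAlgHom k H)

@[simp] theorem leg₁₂_tmul (a b : H) : leg₁₂ k H (a ⊗ₜ b) = a ⊗ₜ (b ⊗ₜ 1) := by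
  simp [leg₁₂]

@[simp] theorem leg₁₃_tmul (a b : H) : leg₁₃ k H (a ⊗ₜ b) = a ⊗ₜ (1 ⊗ₜ b) := by
  simp [leg₁₃]

theorem leg₂₃_apply (x : H ⊗[k] H) : leg₂₃ k H x = 1 ⊗ₜ x := rfl

@[simp] theorem comulLeft_tmul (a b : H) : comulLeft k H (a ⊗ₜ b) =
    TensorProduct.assoc k H H H (Coalgebra.comul a ⊗ₜ b) := by
  rfl

@[simp] theorem comulRight_tmul (a b : H) : comulRight k H (a ⊗ₜ b) =
    a ⊗ₜ Coalgebra.comul b := by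
  simp [comulRight]

theorem inv_mul_eq_one (R : (H ⊗[k] H)ˣ) :
    ((R⁻¹ : (H ⊗[k] H)ˣ) : H ⊗[k] H) * (R : H ⊗[k] H) = 1 := R.inv_mul

variable {R : (H ⊗[k] H)ˣ}

theorem IsQuasitriangular.comulLeft_eq (hR : IsQuasitriangular R) :
    comulLeft k H R = leg₁₃ k H R * leg₂₃ k H R := by
  have h : ∀ X : H ⊗[k] H, comulLeft k H X =
      TensorProduct.assoc k H H H (Coalgebra.comul.rTensor H X) := by
    intro X
    induction X with
    | zero => simp
    | tmul a b => simp
    | add x y hx hy => simp only [map_add, hx, hy]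
  rw [h, hR.comul_id]
  rfl

theorem IsQuasitriangular.comulRight_eq (hR : IsQuasitriangular R) :
    comulRight k H R = leg₁₃ k H R * leg₁₂ k H R := hR.id_comul

/-- Algebra maps preserve inverses and inversion reverses products. Applied to the two hexagon
identities, this gives their versions for `R⁻¹`. -/
theorem eq_inv_mul_inv_of_eq_mul {A A' : Type*} [Ring A] [Algebra k A] [Ring A'] [Algebra k A']
    (f g h : A →ₐ[k] A') (u : Aˣ) (e : f u = g u * h u) :
    f (u⁻¹ : Aˣ) = h (u⁻¹ : Aˣ) * g (u⁻¹ : Aˣ) := by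
  have e' : Units.map (f : A →* A') u = Units.map (g : A →* A') u * Units.map (h : A →* A') u :=
    Units.ext e
  have := congrArg (fun x : A'ˣ => ((x⁻¹ : A'ˣ) : A')) e'
  simp only [mul_inv_rev, ← map_inv, Units.val_mul] at this
  exact this

theorem IsQuasitriangular.comulLeft_inv (hR : IsQuasitriangular R) :
    comulLeft k H (R⁻¹ : (H ⊗[k] H)ˣ) =
      leg₂₃ k H (R⁻¹ : (H ⊗[k] H)ˣ) * leg₁₃ k H (R⁻¹ : (H ⊗[k] H)ˣ) :=
  eq_inv_mul_inv_of_eq_mul _ _ _ R hR.comulLeft_eq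

theorem IsQuasitriangular.comulRight_inv (hR : IsQuasitriangular R) :
    comulRight k H (R⁻¹ : (H ⊗[k] H)ˣ) =
      leg₁₂ k H (R⁻¹ : (H ⊗[k] H)ˣ) * leg₁₃ k H (R⁻¹ : (H ⊗[k] H)ˣ) :=
  eq_inv_mul_inv_of_eq_mul _ _ _ R hR.comulRight_eq

/-- The algebra map `ε ⊗ id`. -/
def counitLeft (k H : Type*) [Field k] [Ring H] [HopfAlgebra k H] : H ⊗[k] H →ₐ[k] H :=
  (Algebra.TensorProduct.lid k H).toAlgHom.comp
    (Algebra.TensorProduct.map (Bialgebra.counitAlgHom k H) (AlgHom.id k H))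

/-- The algebra map `id ⊗ ε`. -/
def counitRight (k H : Type*) [Field k] [Ring H] [HopfAlgebra k H] : H ⊗[k] H →ₐ[k] H :=
  (Algebra.TensorProduct.rid k k H).toAlgHom.comp
    (Algebra.TensorProduct.map (AlgHom.id k H) (Bialgebra.counitAlgHom k H))

@[simp] theorem counitLeft_tmul (a b : H) :
    counitLeft k H (a ⊗ₜ b) = Coalgebra.counit (R := k) a • b := by
  simp [counitLeft]

@[simp] theorem counitRight_tmul (a b : H) :
    counitRight k H (a ⊗ₜ b) = Coalgebra.counit (R := k) b • a := by
  simp [counitRight]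

/-- `ε ⊗ id ⊗ id` undoes `Δ ⊗ id`. -/
theorem counit_comulLeft (X : H ⊗[k] H) : Algebra.TensorProduct.lid k (H ⊗[k] H)
    (Algebra.TensorProduct.map (Bialgebra.counitAlgHom k H) (AlgHom.id k (H ⊗[k] H))
      (comulLeft k H X)) = X := by
  induction X with
  | zero => simp
  | add x y hx hy => simp only [map_add, hx, hy]
  | tmul a b =>
    have h : ∀ t : H ⊗[k] H, Algebra.TensorProduct.lid k (H ⊗[k] H)
        (Algebra.TensorProduct.map (Bialgebra.counitAlgHom k H) (AlgHom.id k (H ⊗[k] H))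
          (TensorProduct.assoc k H H H (t ⊗ₜ b))) =
        (TensorProduct.lid k H (Coalgebra.counit.rTensor H t)) ⊗ₜ b := by
      intro t
      induction t with
      | zero => simp
      | add x y hx hy => simp only [map_add, TensorProduct.add_tmul, hx, hy]
      | tmul x y => simp [TensorProduct.smul_tmul']
    rw [comulLeft_tmul, h, Coalgebra.rTensor_counit_comul]
    simp

/-- `id ⊗ id ⊗ ε` undoes `id ⊗ Δ`. -/
theorem counit_comulRight (X : H ⊗[k] H) :
    Algebra.TensorProduct.map (AlgHom.id k H) (counitRight k H) (comulRight k H X) = X := by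
  induction X with
  | zero => simp
  | add x y hx hy => simp only [map_add, hx, hy]
  | tmul a b =>
    have h : ∀ t : H ⊗[k] H, counitRight k H t =
        TensorProduct.rid k H (Coalgebra.counit.lTensor H t) := by
      intro t
      induction t with
      | zero => simp
      | add x y hx hy => simp only [map_add, hx, hy]
      | tmul x y => simp
    simp [h, Coalgebra.lTensor_counit_comul]

/-- Applying `ε` to the first leg of `(Δ ⊗ id) R = R₁₃ R₂₃` gives `R = (1 ⊗ (ε ⊗ id) R) R`, and `R`
can be cancelled. -/
theorem IsQuasitriangular.counitLeft_eq_one (hR : IsQuasitriangular R) :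
    counitLeft k H R = 1 := by
  have h₁ : ∀ X : H ⊗[k] H, Algebra.TensorProduct.lid k (H ⊗[k] H)
      (Algebra.TensorProduct.map (Bialgebra.counitAlgHom k H) (AlgHom.id k (H ⊗[k] H))
        (leg₁₃ k H X)) = 1 ⊗ₜ counitLeft k H X := by
    intro X
    induction X with
    | zero => simp
    | add x y hx hy => simp only [map_add, hx, hy, TensorProduct.tmul_add]
    | tmul a b => simp
  have h := counit_comulLeft (R : H ⊗[k] H)
  rw [hR.comulLeft_eq, map_mul, map_mul, h₁, leg₂₃_apply] at h
  simp only [Algebra.TensorProduct.map_tmul, map_one, AlgHom.id_apply,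
    Algebra.TensorProduct.lid_tmul, one_smul] at h
  have h' : (1 : H) ⊗ₜ[k] counitLeft k H R = 1 := by
    simpa using congrArg (· * ((R⁻¹ : (H ⊗[k] H)ˣ) : H ⊗[k] H)) h
  have := congrArg (counitLeft k H) h'
  simpa using this

theorem IsQuasitriangular.counitRight_eq_one (hR : IsQuasitriangular R) :
    counitRight k H R = 1 := by
  have h₁ : ∀ X : H ⊗[k] H, Algebra.TensorProduct.map (AlgHom.id k H) (counitRight k H)
      (leg₁₃ k H X) = counitRight k H X ⊗ₜ 1 := by
    intro X
    induction X with
    | zero => simp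
    | add x y hx hy => simp only [map_add, hx, hy, TensorProduct.add_tmul]
    | tmul a b => simp [TensorProduct.smul_tmul]
  have h₂ : ∀ X : H ⊗[k] H, Algebra.TensorProduct.map (AlgHom.id k H) (counitRight k H)
      (leg₁₂ k H X) = X := by
    intro X
    induction X with
    | zero => simp
    | add x y hx hy => simp only [map_add, hx, hy]
    | tmul a b => simp
  have h := counit_comulRight (R : H ⊗[k] H)
  rw [hR.comulRight_eq, map_mul, h₁, h₂] at h
  have h' : counitRight k H R ⊗ₜ[k] (1 : H) = 1 := by
    simpa using congrArg (· * ((R⁻¹ : (H ⊗[k] H)ˣ) : H ⊗[k] H)) h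
  have := congrArg (counitRight k H) h'
  simpa using this

theorem map_inv_eq_one {A A' : Type*} [Ring A] [Algebra k A] [Ring A'] [Algebra k A']
    (f : A →ₐ[k] A') (u : Aˣ) (h : f u = 1) : f (u⁻¹ : Aˣ) = 1 := by
  have e : f (u * (u⁻¹ : Aˣ)) = 1 := by simp
  rwa [map_mul, h, one_mul] at e

/-- `(S ⊗ id) R = R⁻¹`. -/
theorem IsQuasitriangular.antipode_left (hR : IsQuasitriangular R) :
    (HopfAlgebra.antipode k).rTensor H (R : H ⊗[k] H) = ((R⁻¹ : (H ⊗[k] H)ˣ) : H ⊗[k] H) := by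
  -- Apply `S` to the first leg of `(Δ ⊗ id) R = R₁₃ R₂₃` and multiply the first two legs: one side
  -- collapses to `1`, the other is `(S ⊗ id)(R) R`.
  let f : H ⊗[k] (H ⊗[k] H) →ₗ[k] H ⊗[k] H :=
    (LinearMap.mul' k H ∘ₗ (HopfAlgebra.antipode k).rTensor H).rTensor H ∘ₗ
      (TensorProduct.assoc k H H H).symm.toLinearMap
  have h₁ : ∀ X : H ⊗[k] H, f (comulLeft k H X) = 1 ⊗ₜ counitLeft k H X := by
    intro X
    induction X with
    | zero => simp
    | add x y hx hy => simp only [map_add, hx, hy, TensorProduct.tmul_add]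
    | tmul a b => simp [f, Algebra.algebraMap_eq_smul_one, TensorProduct.smul_tmul]
  have h₂ : ∀ X Y : H ⊗[k] H, f (leg₁₃ k H X * leg₂₃ k H Y) =
      (HopfAlgebra.antipode k).rTensor H X * Y := by
    intro X Y
    induction X with
    | zero => simp
    | add x y hx hy => simp only [map_add, hx, hy, add_mul]
    | tmul a b =>
      induction Y with
      | zero => simp
      | add x y hx hy => simp only [map_add, hx, hy, mul_add]
      | tmul c d => simp [f, leg₂₃_apply]
  have h := h₁ (R : H ⊗[k] H)
  rw [hR.comulLeft_eq, h₂, hR.counitLeft_eq_one] at h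
  exact (Units.inv_eq_of_mul_eq_one_left h).symm

/-- `(id ⊗ S) R⁻¹ = R`. -/
theorem IsQuasitriangular.antipode_right_inv (hR : IsQuasitriangular R) :
    (HopfAlgebra.antipode k).lTensor H ((R⁻¹ : (H ⊗[k] H)ˣ) : H ⊗[k] H) = (R : H ⊗[k] H) := by
  -- The order of the factors in `(id ⊗ Δ) R⁻¹ = R₁₂⁻¹ R₁₃⁻¹` makes the result a genuine product
  -- `R⁻¹ · (id ⊗ S) R⁻¹`, so the antipode of `H` need not be inverted.
  let f : H ⊗[k] (H ⊗[k] H) →ₗ[k] H ⊗[k] H :=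
    (LinearMap.mul' k H ∘ₗ (HopfAlgebra.antipode k).lTensor H).lTensor H
  have h₁ : ∀ X : H ⊗[k] H, f (comulRight k H X) = counitRight k H X ⊗ₜ 1 := by
    intro X
    induction X with
    | zero => simp
    | add x y hx hy => simp only [map_add, hx, hy, TensorProduct.add_tmul]
    | tmul a b => simp [f, Algebra.algebraMap_eq_smul_one, TensorProduct.smul_tmul]
  have h₂ : ∀ X Y : H ⊗[k] H, f (leg₁₂ k H X * leg₁₃ k H Y) =
      X * (HopfAlgebra.antipode k).lTensor H Y := by
    intro X Y
    induction X with
    | zero => simp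
    | add x y hx hy => simp only [map_add, hx, hy, add_mul]
    | tmul a b =>
      induction Y with
      | zero => simp
      | add x y hx hy => simp only [map_add, hx, hy, mul_add]
      | tmul c d => simp [f]
  have h := h₁ ((R⁻¹ : (H ⊗[k] H)ˣ) : H ⊗[k] H)
  rw [hR.comulRight_inv, h₂, map_inv_eq_one _ _ hR.counitRight_eq_one] at h
  have := Units.inv_eq_of_mul_eq_one_right h
  rw [inv_inv] at this
  exact this.symm

/-- `(S ⊗ S) R = R`. -/
theorem IsQuasitriangular.antipode_antipode (hR : IsQuasitriangular R) :
    TensorProduct.map (HopfAlgebra.antipode k) (HopfAlgebra.antipode k) (R : H ⊗[k] H) =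
      (R : H ⊗[k] H) := by
  rw [← LinearMap.lTensor_comp_rTensor, LinearMap.comp_apply, hR.antipode_left,
    hR.antipode_right_inv]

/-- The quantum Yang–Baxter equation. -/
theorem IsQuasitriangular.yangBaxter (hR : IsQuasitriangular R) :
    leg₁₂ k H R * (leg₁₃ k H R * leg₂₃ k H R) = leg₂₃ k H R * (leg₁₃ k H R * leg₁₂ k H R) := by
  let s : H ⊗[k] (H ⊗[k] H) →ₗ[k] H ⊗[k] (H ⊗[k] H) :=
    (TensorProduct.leftComm k H H H).toLinearMap
  -- This is `R (Δ ·) = (τ Δ ·) R` in the first two legs; combined with the hexagon for `Δ ⊗ id` it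
  -- is the Yang–Baxter equation.
  have h₁ : ∀ X : H ⊗[k] H, leg₁₂ k H R * comulLeft k H X =
      s (comulLeft k H X) * leg₁₂ k H R := by
    intro X
    induction X with
    | zero => simp
    | add x y hx hy => simp only [map_add, hx, hy, add_mul, mul_add]
    | tmul a b =>
      have e₁ : ∀ Y Z : H ⊗[k] H, leg₁₂ k H Y * TensorProduct.assoc k H H H (Z ⊗ₜ b) =
          TensorProduct.assoc k H H H ((Y * Z) ⊗ₜ b) := by
        intro Y Z
        induction Y with
        | zero => simp
        | add x y hx hy => simp only [map_add, hx, hy, add_mul, TensorProduct.add_tmul]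
        | tmul c d =>
          induction Z with
          | zero => simp
          | add x y hx hy => simp only [map_add, hx, hy, mul_add, TensorProduct.add_tmul]
          | tmul e f => simp
      have e₂ : ∀ Y Z : H ⊗[k] H, TensorProduct.assoc k H H H (Z ⊗ₜ b) * leg₁₂ k H Y =
          TensorProduct.assoc k H H H ((Z * Y) ⊗ₜ b) := by
        intro Y Z
        induction Y with
        | zero => simp
        | add x y hx hy => simp only [map_add, hx, hy, mul_add, TensorProduct.add_tmul]
        | tmul c d =>
          induction Z with
          | zero => simp
          | add x y hx hy => simp only [map_add, hx, hy, add_mul, TensorProduct.add_tmul]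
          | tmul e f => simp
      have e₃ : ∀ Z : H ⊗[k] H, s (TensorProduct.assoc k H H H (Z ⊗ₜ b)) =
          TensorProduct.assoc k H H H (TensorProduct.comm k H H Z ⊗ₜ b) := by
        intro Z
        induction Z with
        | zero => simp
        | add x y hx hy => simp only [map_add, hx, hy, TensorProduct.add_tmul]
        | tmul e f => simp [s]
      rw [comulLeft_tmul, e₁, e₃, e₂, hR.comm_comul, mul_assoc, inv_mul_eq_one, mul_one]
  have h₂ : ∀ X Y : H ⊗[k] H, s (leg₁₃ k H X * leg₂₃ k H Y) = leg₂₃ k H X * leg₁₃ k H Y := by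
    intro X Y
    induction X with
    | zero => simp
    | add x y hx hy => simp only [map_add, hx, hy, add_mul]
    | tmul a b =>
      induction Y with
      | zero => simp
      | add x y hx hy => simp only [map_add, hx, hy, mul_add]
      | tmul c d => simp [s, leg₂₃_apply]
  rw [← hR.comulLeft_eq, h₁, hR.comulLeft_eq, h₂, mul_assoc]

/-- The inverted Yang–Baxter equation, grouped by the hexagons into the form in which the two
bracketings of the coproduct of `C̄` produce it. -/
theorem IsQuasitriangular.yangBaxter_inv (hR : IsQuasitriangular R) :
    comulRight k H (R⁻¹ : (H ⊗[k] H)ˣ) * leg₂₃ k H (R⁻¹ : (H ⊗[k] H)ˣ) =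
      comulLeft k H (R⁻¹ : (H ⊗[k] H)ˣ) * leg₁₂ k H (R⁻¹ : (H ⊗[k] H)ˣ) := by
  rw [hR.comulRight_inv, hR.comulLeft_inv]
  have e : Units.map (leg₁₂ k H : H ⊗[k] H →* H ⊗[k] (H ⊗[k] H)) R * (Units.map (leg₁₃ k H : H ⊗[k] H →* H ⊗[k] (H ⊗[k] H)) R *
      Units.map (leg₂₃ k H : H ⊗[k] H →* H ⊗[k] (H ⊗[k] H)) R) = Units.map (leg₂₃ k H : H ⊗[k] H →* H ⊗[k] (H ⊗[k] H)) R *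
      (Units.map (leg₁₃ k H : H ⊗[k] H →* H ⊗[k] (H ⊗[k] H)) R * Units.map (leg₁₂ k H : H ⊗[k] H →* H ⊗[k] (H ⊗[k] H)) R) :=
    Units.ext hR.yangBaxter
  have := congrArg (fun x => ((x⁻¹ : (H ⊗[k] (H ⊗[k] H))ˣ) : H ⊗[k] (H ⊗[k] H))) e
  simp only [mul_inv_rev, ← map_inv, Units.val_mul] at this
  exact this.symm

end Quasitriangular

/-! ### Convolution inverses and twisting by a coalgebra. -/

section Convolution

variable {k : Type*} [Field k] {E : Type*} [AddCommGroup E] [Module k E] [Coalgebra k E]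

/-- A left and a right convolution inverse of the same map agree. -/
theorem eq_of_convolution_inverse {A : Type*} [Ring A] [Algebra k A] {f g h : E →ₗ[k] A}
    (hfg : ∀ c : E, LinearMap.mul' k A (TensorProduct.map f g (Coalgebra.comul c)) =
      algebraMap k A (Coalgebra.counit c))
    (hgh : ∀ c : E, LinearMap.mul' k A (TensorProduct.map g h (Coalgebra.comul c)) =
      algebraMap k A (Coalgebra.counit c)) : f = h := by
  have e₁ : WithConv.toConv f * WithConv.toConv g = 1 := by
    ext c; simpa [LinearMap.convMul_apply] using hfg c
  have e₂ : WithConv.toConv g * WithConv.toConv h = 1 := by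
    ext c; simpa [LinearMap.convMul_apply] using hgh c
  have := left_inv_eq_right_inv e₁ e₂
  exact congrArg WithConv.ofConv this

/-- The map `c ↦ p(c₂) (K c₁)`. -/
def twist {N : Type*} [AddCommGroup N] [Module k N] (p : E →ₗ[k] N →ₗ[k] N) (K : E →ₗ[k] N) :
    E →ₗ[k] N :=
  TensorProduct.lift (p.flip ∘ₗ K) ∘ₗ Coalgebra.comul

/-- By coassociativity the double twist is `c ↦ p(c₃) (q(c₂) (K c₁))`; the hypothesis contracts the
last two legs to `ε`. -/
theorem twist_twist {N : Type*} [AddCommGroup N] [Module k N] (p q : E →ₗ[k] N →ₗ[k] N)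
    (hpq : ∀ c n, twist p (q.flip n) c = Coalgebra.counit (R := k) c • n)
    (K : E →ₗ[k] N) : twist p (twist q K) = K := by
  ext c
  let M : (E ⊗[k] E) ⊗[k] E →ₗ[k] N :=
    TensorProduct.lift (p.flip ∘ₗ TensorProduct.lift (q.flip ∘ₗ K))
  have h₁ : ∀ t : E ⊗[k] E, TensorProduct.lift (p.flip ∘ₗ twist q K) t =
      M (Coalgebra.comul.rTensor E t) := by
    intro t
    induction t with
    | zero => simp
    | add x y hx hy => simp only [map_add, hx, hy]
    | tmul a b => simp [M, twist]
  have h₂ : ∀ t : E ⊗[k] E, M ((TensorProduct.assoc k E E E).symm (Coalgebra.comul.lTensor E t)) =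
      K (TensorProduct.rid k E (Coalgebra.counit.lTensor E t)) := by
    intro t
    induction t with
    | zero => simp
    | add x y hx hy => simp only [map_add, hx, hy]
    | tmul a b =>
      have h₃ : ∀ u : E ⊗[k] E, M ((TensorProduct.assoc k E E E).symm (a ⊗ₜ u)) =
          TensorProduct.lift (p.flip ∘ₗ q.flip (K a)) u := by
        intro u
        induction u with
        | zero => simp
        | add x y hx hy => simp only [map_add, TensorProduct.tmul_add, hx, hy]
        | tmul u v => simp [M]
      rw [LinearMap.lTensor_tmul, h₃]
      simpa [twist] using hpq b (K a)
  rw [twist, LinearMap.comp_apply, h₁, ← Coalgebra.coassoc_symm_apply, h₂,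
    Coalgebra.lTensor_counit_comul]
  simp

end Convolution

/-! ### The braiding as a flip followed by the action of `R`. -/

section Braiding

variable {k : Type*} [Field k] {H : Type*} [Ring H] [HopfAlgebra k H]

variable {V W X Y : Type*} [AddCommGroup V] [Module k V] [AddCommGroup W] [Module k W]
  [AddCommGroup X] [Module k X] [AddCommGroup Y] [Module k Y]

/-- `(v ⊗ w) ⊗ (x ⊗ y) ↦ (v ⊗ x ◁ a) ⊗ (w ◁ b ⊗ y)` for `a ⊗ b` in `H ⊗ H`. -/
def midAct (V Y : Type*) [AddCommGroup V] [Module k V] [AddCommGroup Y] [Module k Y]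
    (σ : W →ₗ[k] H →ₗ[k] W) (ξ : X →ₗ[k] H →ₗ[k] X) :
    H ⊗[k] H →ₗ[k] (V ⊗[k] X) ⊗[k] (W ⊗[k] Y) →ₗ[k] (V ⊗[k] X) ⊗[k] (W ⊗[k] Y) :=
  tensorAct (LinearMap.lTensorHom V ∘ₗ ξ.flip) (LinearMap.rTensorHom Y ∘ₗ σ.flip)

@[simp] theorem midAct_tmul (σ : W →ₗ[k] H →ₗ[k] W) (ξ : X →ₗ[k] H →ₗ[k] X) (a b : H) (v : V)
    (w : W) (x : X) (y : Y) :
    midAct V Y σ ξ (a ⊗ₜ b) ((v ⊗ₜ x) ⊗ₜ (w ⊗ₜ y)) = (v ⊗ₜ ξ x a) ⊗ₜ (σ w b ⊗ₜ y) := by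
  simp [midAct]

/-- Separating the flip from the action of `R` lets `R` be replaced by an arbitrary element of `H ⊗
H`, on which one can induct. -/
theorem midBraiding_apply (R : (H ⊗[k] H)ˣ) (σ : W →ₗ[k] H →ₗ[k] W) (ξ : X →ₗ[k] H →ₗ[k] X)
    (t : (V ⊗[k] W) ⊗[k] (X ⊗[k] Y)) : midBraiding V Y R σ ξ t =
      midAct V Y σ ξ (R : H ⊗[k] H) (TensorProduct.tensorTensorTensorComm k V W X Y t) := by
  have h : ∀ (Z : H ⊗[k] H) (v : V) (w : W) (x : X) (y : Y),
      (TensorProduct.assoc k V X (W ⊗[k] Y)).symm (v ⊗ₜ TensorProduct.assoc k X W Y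
        (act₂ ξ.flip σ.flip Z (x ⊗ₜ w) ⊗ₜ y)) = midAct V Y σ ξ Z ((v ⊗ₜ x) ⊗ₜ (w ⊗ₜ y)) := by
    intro Z v w x y
    induction Z with
    | zero => simp
    | add a b ha hb =>
      simp only [map_add, LinearMap.add_apply, TensorProduct.add_tmul, TensorProduct.tmul_add,
        ha, hb]
    | tmul a b => simp
  induction t with
  | zero => simp
  | add a b ha hb => simp only [map_add, ha, hb]
  | tmul p q =>
    induction p with
    | zero => simp
    | add a b ha hb => simp only [map_add, TensorProduct.add_tmul, ha, hb]
    | tmul v w =>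
      induction q with
      | zero => simp
      | add a b ha hb => simp only [map_add, TensorProduct.tmul_add, ha, hb]
      | tmul x y =>
        rw [TensorProduct.tensorTensorTensorComm_tmul, ← h]
        simp [midBraiding, braiding]

end Braiding

/-! ### The coalgebra `C̄`. -/

section BraidedBialgebra

variable {k : Type*} [Field k] {H : Type*} [Ring H] [HopfAlgebra k H]
  {C : Type*} [Ring C] [Algebra k C] [Coalgebra k C]
  {R : (H ⊗[k] H)ˣ} {γ : C →ₗ[k] H →ₗ[k] C}

/-- The action of `H ⊗ H ⊗ H` on `C ⊗ C ⊗ C`. -/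
def tripleAct (γ : C →ₗ[k] H →ₗ[k] C) :
    H ⊗[k] (H ⊗[k] H) →ₗ[k] C ⊗[k] (C ⊗[k] C) →ₗ[k] C ⊗[k] (C ⊗[k] C) :=
  tensorAct γ.flip (tensorAct γ.flip γ.flip)

theorem IsBraidedBialgebra.isAntiAction (hC : IsBraidedBialgebra R γ) : IsAntiAction γ.flip :=
  hC.isRightAction.flip

theorem IsBraidedBialgebra.isAntiAction_triple (hC : IsBraidedBialgebra R γ) :
    IsAntiAction (tripleAct γ) :=
  hC.isAntiAction.tensorAct (hC.isAntiAction.tensorAct hC.isAntiAction)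

/-- Since the coproduct of `C` is a morphism, splitting the first leg splits the first leg of `X`.
This and the three lemmas that follow express both iterated coproducts of `C̄` through `H ⊗ H ⊗ H`.
-/
theorem IsBraidedBialgebra.rTensor_comul_act (hC : IsBraidedBialgebra R γ) (X : H ⊗[k] H)
    (t : C ⊗[k] C) :
    TensorProduct.assoc k C C C (Coalgebra.comul.rTensor C (act₂ γ.flip γ.flip X t)) =
      tripleAct γ (comulLeft k H X)
        (TensorProduct.assoc k C C C (Coalgebra.comul.rTensor C t)) := by
  induction t with
  | zero => simp
  | add x y hx hy => simp only [map_add, hx, hy]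
  | tmul c d =>
    induction X with
    | zero => simp
    | add x y hx hy => simp only [map_add, LinearMap.add_apply, hx, hy]
    | tmul a b =>
      have h : ∀ (Y : H ⊗[k] H) (u : C ⊗[k] C),
          TensorProduct.assoc k C C C (act₂ γ.flip γ.flip Y u ⊗ₜ γ d b) =
          tripleAct γ (TensorProduct.assoc k H H H (Y ⊗ₜ b))
            (TensorProduct.assoc k C C C (u ⊗ₜ d)) := by
        intro Y u
        induction Y with
        | zero => simp
        | add x y hx hy =>
          simp only [map_add, LinearMap.add_apply, TensorProduct.add_tmul, hx, hy]
        | tmul p q =>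
          induction u with
          | zero => simp
          | add x y hx hy => simp only [map_add, TensorProduct.add_tmul, hx, hy]
          | tmul e f => simp [tripleAct]
      rw [act₂_tmul, LinearMap.rTensor_tmul, LinearMap.flip_apply, hC.comul_act,
        LinearMap.flip_apply, h]
      simp

theorem IsBraidedBialgebra.lTensor_comul_act (hC : IsBraidedBialgebra R γ) (X : H ⊗[k] H)
    (t : C ⊗[k] C) :
    Coalgebra.comul.lTensor C (act₂ γ.flip γ.flip X t) =
      tripleAct γ (comulRight k H X) (Coalgebra.comul.lTensor C t) := by
  induction t with
  | zero => simp
  | add x y hx hy => simp only [map_add, hx, hy]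
  | tmul c d =>
    induction X with
    | zero => simp
    | add x y hx hy => simp only [map_add, LinearMap.add_apply, hx, hy]
    | tmul a b =>
      rw [act₂_tmul, LinearMap.lTensor_tmul, LinearMap.flip_apply, LinearMap.flip_apply,
        hC.comul_act]
      simp [tripleAct, act₂_eq_tensorAct]

theorem IsBraidedBialgebra.rTensor_act (hC : IsBraidedBialgebra R γ) (X : H ⊗[k] H)
    (t : (C ⊗[k] C) ⊗[k] C) :
    TensorProduct.assoc k C C C ((act₂ γ.flip γ.flip X).rTensor C t) =
      tripleAct γ (leg₁₂ k H X) (TensorProduct.assoc k C C C t) := by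
  have h1 : ∀ c, γ c 1 = c := hC.isAntiAction.map_one
  induction t with
  | zero => simp
  | add x y hx hy => simp only [map_add, hx, hy]
  | tmul u e =>
    induction u with
    | zero => simp
    | add x y hx hy => simp only [map_add, TensorProduct.add_tmul, hx, hy]
    | tmul c d =>
      induction X with
      | zero => simp
      | add x y hx hy =>
        simp only [map_add, LinearMap.add_apply, LinearMap.rTensor_add, hx, hy]
      | tmul a b => simp [tripleAct, h1]

theorem IsBraidedBialgebra.lTensor_act (hC : IsBraidedBialgebra R γ) (X : H ⊗[k] H)
    (t : C ⊗[k] (C ⊗[k] C)) :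
    (act₂ γ.flip γ.flip X).lTensor C t = tripleAct γ (leg₂₃ k H X) t := by
  have h1 : ∀ c, γ c 1 = c := hC.isAntiAction.map_one
  induction t with
  | zero => simp
  | add x y hx hy => simp only [map_add, hx, hy]
  | tmul u e => simp [tripleAct, h1, leg₂₃_apply, act₂_eq_tensorAct]

/-- Both sides are the iterated coproduct of `C` acted on by an element of `H ⊗ H ⊗ H`, and
`yangBaxter_inv` says that the two elements agree. -/
theorem comulBar_coassoc (hR : IsQuasitriangular R) (hC : IsBraidedBialgebra R γ) (c : C) :
    TensorProduct.assoc k C C C ((comulBar R γ).rTensor C (comulBar R γ c)) =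
      (comulBar R γ).lTensor C (comulBar R γ c) := by
  simp only [comulBar, LinearMap.rTensor_comp, LinearMap.lTensor_comp, LinearMap.comp_apply]
  rw [hC.rTensor_act, hC.lTensor_act, hC.rTensor_comul_act, hC.lTensor_comul_act,
    ← hC.isAntiAction_triple.map_mul, ← hC.isAntiAction_triple.map_mul, hR.yangBaxter_inv,
    Coalgebra.coassoc_apply]

theorem IsBraidedBialgebra.rTensor_counit_act (hC : IsBraidedBialgebra R γ) (X : H ⊗[k] H)
    (t : C ⊗[k] C) : Coalgebra.counit.rTensor C (act₂ γ.flip γ.flip X t) =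
      (γ.flip (counitLeft k H X)).lTensor k (Coalgebra.counit.rTensor C t) := by
  induction t with
  | zero => simp
  | add x y hx hy => simp only [map_add, hx, hy]
  | tmul c d =>
    induction X with
    | zero => simp
    | add x y hx hy => simp only [map_add, LinearMap.add_apply, LinearMap.lTensor_add, hx, hy]
    | tmul a b => simp [hC.counit_act, TensorProduct.smul_tmul', mul_comm]

theorem IsBraidedBialgebra.lTensor_counit_act (hC : IsBraidedBialgebra R γ) (X : H ⊗[k] H)
    (t : C ⊗[k] C) : Coalgebra.counit.lTensor C (act₂ γ.flip γ.flip X t) =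
      (γ.flip (counitRight k H X)).rTensor k (Coalgebra.counit.lTensor C t) := by
  induction t with
  | zero => simp
  | add x y hx hy => simp only [map_add, hx, hy]
  | tmul c d =>
    induction X with
    | zero => simp
    | add x y hx hy => simp only [map_add, LinearMap.add_apply, LinearMap.rTensor_add, hx, hy]
    | tmul a b => simp [hC.counit_act, ← TensorProduct.tmul_smul, mul_comm]

/-- The coalgebra `C̄`. -/
@[reducible] def barCoalgebra (hR : IsQuasitriangular R) (hC : IsBraidedBialgebra R γ) :
    Coalgebra k C where
  comul := comulBar R γ
  counit := Coalgebra.counit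
  coassoc := LinearMap.ext fun c => comulBar_coassoc hR hC c
  rTensor_counit_comp_comul := LinearMap.ext fun c => by
    have h1 : ∀ c, γ c 1 = c := hC.isAntiAction.map_one
    simp [comulBar, hC.rTensor_counit_act, map_inv_eq_one _ _ hR.counitLeft_eq_one, h1]
  lTensor_counit_comp_comul := LinearMap.ext fun c => by
    have h1 : ∀ c, γ c 1 = c := hC.isAntiAction.map_one
    simp [comulBar, hC.lTensor_counit_act, map_inv_eq_one _ _ hR.counitRight_eq_one, h1]

end BraidedBialgebra

/-! ### The braided tensor product coalgebra `C ⊗ C`. -/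

section BraidedTensorCoalgebra

set_option maxSynthPendingDepth 6

variable {k : Type*} [Field k] {H : Type*} [Ring H] [HopfAlgebra k H]

/-- `p ⊗ q ↦ (1 ⊗ q ⊗ 1) ⊗ (p ⊗ 1 ⊗ 1)`. -/
def crossLeg₂₁ (k H : Type*) [Field k] [Ring H] [HopfAlgebra k H] :
    H ⊗[k] H →ₗ[k] (H ⊗[k] (H ⊗[k] H)) ⊗[k] (H ⊗[k] (H ⊗[k] H)) :=
  (TensorProduct.comm k _ _).toLinearMap ∘ₗ
    TensorProduct.map ((TensorProduct.mk k H (H ⊗[k] H)).flip 1)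
      (TensorProduct.mk k H (H ⊗[k] H) 1 ∘ₗ (TensorProduct.mk k H H).flip 1)

/-- `p ⊗ q ↦ (1 ⊗ 1 ⊗ q) ⊗ (1 ⊗ p ⊗ 1)`. -/
def crossLeg₃₂ (k H : Type*) [Field k] [Ring H] [HopfAlgebra k H] :
    H ⊗[k] H →ₗ[k] (H ⊗[k] (H ⊗[k] H)) ⊗[k] (H ⊗[k] (H ⊗[k] H)) :=
  (TensorProduct.comm k _ _).toLinearMap ∘ₗ
    TensorProduct.map (TensorProduct.mk k H (H ⊗[k] H) 1 ∘ₗ (TensorProduct.mk k H H).flip 1)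
      (TensorProduct.mk k H (H ⊗[k] H) 1 ∘ₗ TensorProduct.mk k H H 1)

/-- `a ⊗ b ⊗ e ↦ (1 ⊗ 1 ⊗ e) ⊗ (a ⊗ b ⊗ 1)`. -/
def crossLeg₃ (k H : Type*) [Field k] [Ring H] [HopfAlgebra k H] :
    H ⊗[k] (H ⊗[k] H) →ₗ[k] (H ⊗[k] (H ⊗[k] H)) ⊗[k] (H ⊗[k] (H ⊗[k] H)) :=
  (TensorProduct.comm k _ _).toLinearMap ∘ₗ
    TensorProduct.map (leg₁₂ k H).toLinearMap
      (TensorProduct.mk k H (H ⊗[k] H) 1 ∘ₗ TensorProduct.mk k H H 1) ∘ₗ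
    (TensorProduct.assoc k H H H).symm.toLinearMap

/-- `a ⊗ b ⊗ e ↦ (1 ⊗ b ⊗ e) ⊗ (a ⊗ 1 ⊗ 1)`. -/
def crossLeg₁ (k H : Type*) [Field k] [Ring H] [HopfAlgebra k H] :
    H ⊗[k] (H ⊗[k] H) →ₗ[k] (H ⊗[k] (H ⊗[k] H)) ⊗[k] (H ⊗[k] (H ⊗[k] H)) :=
  (TensorProduct.comm k _ _).toLinearMap ∘ₗ
    TensorProduct.map ((TensorProduct.mk k H (H ⊗[k] H)).flip 1)
      (TensorProduct.mk k H (H ⊗[k] H) 1)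

/-- To interleave `c₁, c₂, c₃` with `d₁, d₂, d₃`, three crossings are needed: `c₂` with `d₁` (by
`Z`), `c₃` with `d₁` (by `X`) and `c₃` with `d₂` (by `Y`). Both bracketings perform them with the
same order of factors on each leg. -/
theorem crossLeg_mul (X Y Z : H ⊗[k] H) :
    crossLeg₃ k H (leg₁₃ k H X * leg₂₃ k H Y) * crossLeg₂₁ k H Z =
      crossLeg₁ k H (leg₁₃ k H X * leg₁₂ k H Z) * crossLeg₃₂ k H Y := by
  induction X with
  | zero => simp
  | add x y hx hy => simp only [map_add, add_mul, hx, hy]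
  | tmul a b =>
    induction Y with
    | zero => simp
    | add x y hx hy => simp only [map_add, mul_add, add_mul, hx, hy]
    | tmul c d =>
      induction Z with
      | zero => simp
      | add x y hx hy => simp only [map_add, mul_add, add_mul, hx, hy]
      | tmul e f =>
        simp [crossLeg₃, crossLeg₂₁, crossLeg₁, crossLeg₃₂, leg₂₃_apply,
          Algebra.TensorProduct.one_def]

variable {C : Type*} [Ring C] [Algebra k C] [Coalgebra k C]
  {R : (H ⊗[k] H)ˣ} {γ : C →ₗ[k] H →ₗ[k] C}

/-- The coproduct `c ⊗ d ↦ (c₁ ⊗ d₁ ◁ R⁽¹⁾) ⊗ (c₂ ◁ R⁽²⁾ ⊗ d₂)`. -/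
def braidedComul (R : (H ⊗[k] H)ˣ) (γ : C →ₗ[k] H →ₗ[k] C) :
    C ⊗[k] C →ₗ[k] (C ⊗[k] C) ⊗[k] (C ⊗[k] C) :=
  midBraiding C C R γ γ ∘ₗ TensorProduct.map Coalgebra.comul Coalgebra.comul

/-- `(c₁ ⊗ c₂ ⊗ c₃) ⊗ (d₁ ⊗ d₂ ⊗ d₃) ↦ (c₁ ⊗ d₁) ⊗ (c₂ ⊗ d₂) ⊗ (c₃ ⊗ d₃)`. -/
def tripleComm (k C : Type*) [Field k] [Ring C] [Algebra k C] :
    (C ⊗[k] (C ⊗[k] C)) ⊗[k] (C ⊗[k] (C ⊗[k] C)) →ₗ[k]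
      (C ⊗[k] C) ⊗[k] ((C ⊗[k] C) ⊗[k] (C ⊗[k] C)) :=
  (TensorProduct.tensorTensorTensorComm k C C C C).toLinearMap.lTensor (C ⊗[k] C) ∘ₗ
    (TensorProduct.tensorTensorTensorComm k C (C ⊗[k] C) C (C ⊗[k] C)).toLinearMap

theorem braidedComul_tmul (c d : C) : braidedComul R γ (c ⊗ₜ d) =
    midAct C C γ γ (R : H ⊗[k] H) (TensorProduct.tensorTensorTensorComm k C C C C
      (Coalgebra.comul c ⊗ₜ Coalgebra.comul d)) := by
  simp [braidedComul, midBraiding_apply]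

/-- The coproduct of `d₁ ◁ X⁽¹⁾` spreads `X⁽¹⁾` over two legs, whence `(Δ ⊗ id) X`; the inner
braiding contributes the factor with `R`. -/
theorem rTensor_braidedComul (hC : IsBraidedBialgebra R γ) (X : H ⊗[k] H) (u w : C ⊗[k] C) :
    TensorProduct.assoc k _ _ _ ((braidedComul R γ).rTensor (C ⊗[k] C)
      (midAct C C γ γ X (TensorProduct.tensorTensorTensorComm k C C C C (u ⊗ₜ w)))) =
    tripleComm k C (tensorAct (tripleAct γ) (tripleAct γ)
      (crossLeg₃ k H (comulLeft k H X) * crossLeg₂₁ k H (R : H ⊗[k] H))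
      (TensorProduct.assoc k C C C (Coalgebra.comul.rTensor C u) ⊗ₜ
        TensorProduct.assoc k C C C (Coalgebra.comul.rTensor C w))) := by
  have h1 : ∀ c, γ c 1 = c := hC.isAntiAction.map_one
  have hm : ∀ a b c, γ c (a * b) = γ (γ c a) b := hC.isAntiAction.map_mul
  induction u with
  | zero => simp
  | add x y hx hy => simp only [map_add, TensorProduct.add_tmul, hx, hy]
  | tmul c c₃ =>
  induction w with
  | zero => simp
  | add x y hx hy => simp only [map_add, TensorProduct.tmul_add, hx, hy]
  | tmul d d₃ =>
  induction X with
  | zero => simp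
  | add x y hx hy => simp only [map_add, LinearMap.add_apply, add_mul, hx, hy]
  | tmul a b =>
  have h : ∀ (Y Z : H ⊗[k] H) (u w : C ⊗[k] C),
      TensorProduct.assoc k (C ⊗[k] C) (C ⊗[k] C) (C ⊗[k] C)
        (midAct C C γ γ Z (TensorProduct.tensorTensorTensorComm k C C C C
          (u ⊗ₜ act₂ γ.flip γ.flip Y w)) ⊗ₜ (γ c₃ b ⊗ₜ d₃)) =
      tripleComm k C (tensorAct (tripleAct γ) (tripleAct γ)
        (crossLeg₃ k H (TensorProduct.assoc k H H H (Y ⊗ₜ b)) * crossLeg₂₁ k H Z)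
          (TensorProduct.assoc k C C C (u ⊗ₜ c₃) ⊗ₜ
            TensorProduct.assoc k C C C (w ⊗ₜ d₃))) := by
    intro Y Z u w
    induction u with
    | zero => simp
    | add x y hx hy => simp only [map_add, TensorProduct.add_tmul, hx, hy]
    | tmul c₁ c₂ =>
    induction w with
    | zero => simp
    | add x y hx hy => simp only [map_add, TensorProduct.add_tmul, TensorProduct.tmul_add, hx, hy]
    | tmul d₁ d₂ =>
    induction Y with
    | zero => simp
    | add x y hx hy =>
      simp only [map_add, LinearMap.add_apply, add_mul, TensorProduct.add_tmul,
        TensorProduct.tmul_add, hx, hy]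
    | tmul e f =>
    induction Z with
    | zero => simp
    | add x y hx hy =>
      simp only [map_add, LinearMap.add_apply, mul_add, TensorProduct.add_tmul, hx, hy]
    | tmul p q =>
      simp [crossLeg₃, crossLeg₂₁, tripleAct, tripleComm, Algebra.TensorProduct.one_def, h1, hm]
  rw [TensorProduct.tensorTensorTensorComm_tmul, midAct_tmul, LinearMap.rTensor_tmul,
    braidedComul_tmul, hC.comul_act, h]
  simp

theorem lTensor_braidedComul (hC : IsBraidedBialgebra R γ) (X : H ⊗[k] H) (u w : C ⊗[k] C) :
    (braidedComul R γ).lTensor (C ⊗[k] C)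
      (midAct C C γ γ X (TensorProduct.tensorTensorTensorComm k C C C C (u ⊗ₜ w))) =
    tripleComm k C (tensorAct (tripleAct γ) (tripleAct γ)
      (crossLeg₁ k H (comulRight k H X) * crossLeg₃₂ k H (R : H ⊗[k] H))
      (Coalgebra.comul.lTensor C u ⊗ₜ Coalgebra.comul.lTensor C w)) := by
  have h1 : ∀ c, γ c 1 = c := hC.isAntiAction.map_one
  have hm : ∀ a b c, γ c (a * b) = γ (γ c a) b := hC.isAntiAction.map_mul
  induction u with
  | zero => simp
  | add x y hx hy => simp only [map_add, TensorProduct.add_tmul, hx, hy]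
  | tmul c₁ c =>
  induction w with
  | zero => simp
  | add x y hx hy => simp only [map_add, TensorProduct.tmul_add, hx, hy]
  | tmul d₁ d =>
  induction X with
  | zero => simp
  | add x y hx hy => simp only [map_add, LinearMap.add_apply, add_mul, hx, hy]
  | tmul a b =>
  have h : ∀ (Y Z : H ⊗[k] H) (u w : C ⊗[k] C),
      (c₁ ⊗ₜ γ d₁ a) ⊗ₜ midAct C C γ γ Z (TensorProduct.tensorTensorTensorComm k C C C C
          (act₂ γ.flip γ.flip Y u ⊗ₜ w)) =
      tripleComm k C (tensorAct (tripleAct γ) (tripleAct γ)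
        (crossLeg₁ k H (a ⊗ₜ Y) * crossLeg₃₂ k H Z)
          ((c₁ ⊗ₜ u) ⊗ₜ (d₁ ⊗ₜ w))) := by
    intro Y Z u w
    induction u with
    | zero => simp
    | add x y hx hy => simp only [map_add, TensorProduct.tmul_add, TensorProduct.add_tmul, hx, hy]
    | tmul c₂ c₃ =>
    induction w with
    | zero => simp
    | add x y hx hy => simp only [map_add, TensorProduct.tmul_add, hx, hy]
    | tmul d₂ d₃ =>
    induction Y with
    | zero => simp
    | add x y hx hy =>
      simp only [map_add, LinearMap.add_apply, add_mul, TensorProduct.add_tmul,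
        TensorProduct.tmul_add, hx, hy]
    | tmul e f =>
    induction Z with
    | zero => simp
    | add x y hx hy =>
      simp only [map_add, LinearMap.add_apply, mul_add, TensorProduct.tmul_add, hx, hy]
    | tmul p q =>
      simp [crossLeg₁, crossLeg₃₂, tripleAct, tripleComm, Algebra.TensorProduct.one_def, h1, hm]
  rw [TensorProduct.tensorTensorTensorComm_tmul, midAct_tmul, LinearMap.lTensor_tmul,
    braidedComul_tmul, hC.comul_act, h]
  simp

/-- The two hexagon identities turn the bracketings into the two sides of `crossLeg_mul`. -/
theorem braidedComul_coassoc (hR : IsQuasitriangular R) (hC : IsBraidedBialgebra R γ) (c d : C) :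
    TensorProduct.assoc k _ _ _ ((braidedComul R γ).rTensor (C ⊗[k] C)
      (braidedComul R γ (c ⊗ₜ d))) =
      (braidedComul R γ).lTensor (C ⊗[k] C) (braidedComul R γ (c ⊗ₜ d)) := by
  rw [braidedComul_tmul, rTensor_braidedComul hC, lTensor_braidedComul hC, hR.comulLeft_eq,
    hR.comulRight_eq, crossLeg_mul, Coalgebra.coassoc_apply, Coalgebra.coassoc_apply]

/-- The counit `c ⊗ d ↦ ε(c) ε(d)`. -/
def braidedCounit (k C : Type*) [Field k] [Ring C] [Algebra k C] [Coalgebra k C] :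
    C ⊗[k] C →ₗ[k] k :=
  LinearMap.mul' k k ∘ₗ TensorProduct.map Coalgebra.counit Coalgebra.counit

theorem rTensor_braidedCounit (hC : IsBraidedBialgebra R γ) (X : H ⊗[k] H) (u w : C ⊗[k] C) :
    TensorProduct.lid k _ ((braidedCounit k C).rTensor (C ⊗[k] C)
      (midAct C C γ γ X (TensorProduct.tensorTensorTensorComm k C C C C (u ⊗ₜ w)))) =
    γ (TensorProduct.lid k C (Coalgebra.counit.rTensor C u)) (counitLeft k H X) ⊗ₜ
      TensorProduct.lid k C (Coalgebra.counit.rTensor C w) := by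
  induction u with
  | zero => simp
  | add x y hx hy =>
    simp only [map_add, LinearMap.add_apply, TensorProduct.add_tmul, hx, hy]
  | tmul c c₃ =>
  induction w with
  | zero => simp
  | add x y hx hy => simp only [map_add, TensorProduct.tmul_add, hx, hy]
  | tmul d d₃ =>
  induction X with
  | zero => simp
  | add x y hx hy => simp only [map_add, LinearMap.add_apply, TensorProduct.add_tmul, hx, hy]
  | tmul a b =>
    simp only [TensorProduct.tensorTensorTensorComm_tmul, midAct_tmul, LinearMap.rTensor_tmul,
      braidedCounit, LinearMap.comp_apply, TensorProduct.map_tmul, LinearMap.mul'_apply,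
      TensorProduct.lid_tmul, hC.counit_act, counitLeft_tmul, map_smul, LinearMap.smul_apply,
      TensorProduct.smul_tmul', TensorProduct.tmul_smul, smul_smul]
    congr 2
    ring

theorem lTensor_braidedCounit (hC : IsBraidedBialgebra R γ) (X : H ⊗[k] H) (u w : C ⊗[k] C) :
    TensorProduct.rid k _ ((braidedCounit k C).lTensor (C ⊗[k] C)
      (midAct C C γ γ X (TensorProduct.tensorTensorTensorComm k C C C C (u ⊗ₜ w)))) =
    TensorProduct.rid k C (Coalgebra.counit.lTensor C u) ⊗ₜ
      γ (TensorProduct.rid k C (Coalgebra.counit.lTensor C w)) (counitRight k H X) := by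
  induction u with
  | zero => simp
  | add x y hx hy =>
    simp only [map_add, TensorProduct.add_tmul, hx, hy]
  | tmul c c₃ =>
  induction w with
  | zero => simp
  | add x y hx hy => simp only [map_add, LinearMap.add_apply, TensorProduct.tmul_add, hx, hy]
  | tmul d d₃ =>
  induction X with
  | zero => simp
  | add x y hx hy => simp only [map_add, LinearMap.add_apply, TensorProduct.tmul_add, hx, hy]
  | tmul a b =>
    simp only [TensorProduct.tensorTensorTensorComm_tmul, midAct_tmul, LinearMap.lTensor_tmul,
      braidedCounit, LinearMap.comp_apply, TensorProduct.map_tmul, LinearMap.mul'_apply,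
      TensorProduct.rid_tmul, hC.counit_act, counitRight_tmul, map_smul, LinearMap.smul_apply,
      TensorProduct.smul_tmul', TensorProduct.tmul_smul, smul_smul]
    congr 2
    ring

/-- The braided tensor product coalgebra `C ⊗ C`. -/
@[reducible] def braidedTensorCoalgebra (hR : IsQuasitriangular R)
    (hC : IsBraidedBialgebra R γ) : Coalgebra k (C ⊗[k] C) where
  comul := braidedComul R γ
  counit := braidedCounit k C
  coassoc := TensorProduct.ext' fun c d => braidedComul_coassoc hR hC c d
  rTensor_counit_comp_comul := TensorProduct.ext' fun c d => by
    have h1 : ∀ c, γ c 1 = c := hC.isAntiAction.map_one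
    apply (TensorProduct.lid k (C ⊗[k] C)).injective
    rw [LinearMap.comp_apply, braidedComul_tmul, rTensor_braidedCounit hC,
      hR.counitLeft_eq_one]
    simp [h1]
  lTensor_counit_comp_comul := TensorProduct.ext' fun c d => by
    have h1 : ∀ c, γ c 1 = c := hC.isAntiAction.map_one
    apply (TensorProduct.rid k (C ⊗[k] C)).injective
    rw [LinearMap.comp_apply, braidedComul_tmul, lTensor_braidedCounit hC,
      hR.counitRight_eq_one]
    simp [h1]

end BraidedTensorCoalgebra

/-! ### Braided anti-multiplicativity of `S`, and `S⁻¹` as the antipode of `C̄`. -/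

section Antipode

variable {k : Type*} [Field k] {H : Type*} [Ring H] [HopfAlgebra k H]
  {C : Type*} [Ring C] [Algebra k C] [Coalgebra k C]
  {R : (H ⊗[k] H)ˣ} {γ : C →ₗ[k] H →ₗ[k] C}

theorem act₂_flip_tmul {V W : Type*} [AddCommGroup V] [Module k V] [AddCommGroup W] [Module k W]
    (ρ : V →ₗ[k] H →ₗ[k] V) (σ : W →ₗ[k] H →ₗ[k] W) (X : H ⊗[k] H) (v : V) (w : W) :
    act₂ ρ.flip σ.flip X (v ⊗ₜ w) = TensorProduct.map (ρ v) (σ w) X := by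
  induction X with
  | zero => simp
  | add x y hx hy => simp only [map_add, LinearMap.add_apply, hx, hy]
  | tmul a b => simp

theorem IsBraidedBialgebra.mul_act₂_comul (hC : IsBraidedBialgebra R γ) (h : H) (t : C ⊗[k] C) :
    LinearMap.mul' k C (act₂ γ.flip γ.flip (Coalgebra.comul h) t) =
      γ (LinearMap.mul' k C t) h := by
  induction t with
  | zero => simp
  | add x y hx hy => simp only [map_add, LinearMap.add_apply, hx, hy]
  | tmul c d => rw [act₂_flip_tmul, ← hC.isModuleAlgebra.mul_act, LinearMap.mul'_apply]

theorem IsBraidedAntipode.map_one {S : C →ₗ[k] C} (hC : IsBraidedBialgebra R γ)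
    (hS : IsBraidedAntipode γ S) : S 1 = 1 := by
  simpa [hC.comul_one, hC.counit_one] using hS.mul_antipode_rTensor_comul 1

/-- The braided antipode is braided anti-multiplicative:
`S(c d) = (S d ◁ R⁽¹⁾) (S c ◁ R⁽²⁾)`. -/
theorem IsBraidedAntipode.map_mul {S : C →ₗ[k] C} (hR : IsQuasitriangular R)
    (hC : IsBraidedBialgebra R γ) (hS : IsBraidedAntipode γ S) (c d : C) :
    S (c * d) = LinearMap.mul' k C (act₂ γ.flip γ.flip (R : H ⊗[k] H) (S d ⊗ₜ S c)) := by
  have h1 : ∀ c, γ c 1 = c := hC.isAntiAction.map_one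
  have hm : ∀ a b c, γ c (a * b) = γ (γ c a) b := hC.isAntiAction.map_mul
  -- For `Y = R` this is the expected formula for `S(c d)`, to be shown a right convolution inverse
  -- of the product.
  let ν : H ⊗[k] H → C ⊗[k] C →ₗ[k] C := fun Y =>
    LinearMap.mul' k C ∘ₗ act₂ γ.flip γ.flip Y ∘ₗ
      TensorProduct.map S S ∘ₗ (TensorProduct.comm k C C).toLinearMap
  -- On `x ⊗ y ⊗ z` the value is `c₁ (w₁ ◁ x) (S w₂ ◁ y) (S c₂ ◁ z)`.
  let F : C → C → C ⊗[k] C → H ⊗[k] (H ⊗[k] H) →ₗ[k] C := fun c₁ c₂ w =>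
    LinearMap.mulLeft k c₁ ∘ₗ LinearMap.mul' k C ∘ₗ
      TensorProduct.map (LinearMap.mul' k C ∘ₗ (act₂ γ.flip γ.flip).flip (S.lTensor C w))
        (γ (S c₂)) ∘ₗ (TensorProduct.assoc k H H H).symm.toLinearMap
  have e₁ : ∀ (X Y : H ⊗[k] H) (c₁ c₂ : C) (w : C ⊗[k] C),
      LinearMap.mul' k C (TensorProduct.map (LinearMap.mul' k C) (ν Y)
        (midAct C C γ γ X (TensorProduct.tensorTensorTensorComm k C C C C
          ((c₁ ⊗ₜ c₂) ⊗ₜ w)))) = F c₁ c₂ w (leg₁₃ k H X * leg₂₃ k H Y) := by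
    intro X Y c₁ c₂ w
    induction w with
    | zero => simp [F]
    | add x y hx hy =>
      simp only [F] at hx hy
      simp only [F, map_add, TensorProduct.tmul_add, hx, hy, LinearMap.comp_add,
        TensorProduct.map_add_left, LinearMap.add_apply, LinearMap.comp_apply]
    | tmul d₁ d₂ =>
    induction X with
    | zero => simp
    | add x y hx hy => simp only [map_add, LinearMap.add_apply, add_mul, hx, hy]
    | tmul a b =>
    induction Y with
    | zero => simp [ν]
    | add x y hx hy =>
      simp only [ν] at hx hy
      simp only [ν, map_add, mul_add, LinearMap.add_comp, LinearMap.comp_add,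
        TensorProduct.map_add_right, LinearMap.add_apply, hx, hy]
    | tmul e f => simp [ν, F, hS.map_act, hm, mul_assoc, leg₂₃_apply]
  -- A coproduct acting on `d₁ ⊗ S d₂` acts on the product `d₁ S d₂ = ε(d)`, so only the counit of
  -- the first leg of `X` survives.
  have e₂ : ∀ (X : H ⊗[k] H) (c₁ c₂ d : C),
      F c₁ c₂ (Coalgebra.comul d) (comulLeft k H X) =
        Coalgebra.counit (R := k) d • (c₁ * γ (S c₂) (counitLeft k H X)) := by
    intro X c₁ c₂ d
    induction X with
    | zero => simp
    | add x y hx hy => simp only [map_add, mul_add, smul_add, hx, hy]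
    | tmul a b =>
      simp [F, hC.mul_act₂_comul, hS.mul_antipode_lTensor_comul, Algebra.algebraMap_eq_smul_one,
        hC.isModuleAlgebra.one_act]
  let _ : Coalgebra k (C ⊗[k] C) := braidedTensorCoalgebra hR hC
  have e : S ∘ₗ LinearMap.mul' k C = ν (R : H ⊗[k] H) := by
    -- `S ∘ m` is a left convolution inverse of the product `m` by the antipode axiom at `c d`; `ν
    -- R` is a right one by the hexagon and `e₂`.
    refine eq_of_convolution_inverse (g := LinearMap.mul' k C) ?_ ?_
    · intro t
      change LinearMap.mul' k C (TensorProduct.map (S ∘ₗ LinearMap.mul' k C) (LinearMap.mul' k C)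
        (braidedComul R γ t)) = algebraMap k C (braidedCounit k C t)
      induction t with
      | zero => simp
      | add x y hx hy => simp only [_root_.map_add, hx, hy]
      | tmul c d =>
        have := hS.mul_antipode_rTensor_comul (c * d)
        rw [hC.comul_mul, hC.counit_mul, ← LinearMap.comp_apply (S.rTensor C),
          LinearMap.rTensor_comp_map] at this
        simpa [braidedComul, braidedCounit] using this
    · intro t
      change LinearMap.mul' k C (TensorProduct.map (LinearMap.mul' k C) (ν (R : H ⊗[k] H))
        (braidedComul R γ t)) = algebraMap k C (braidedCounit k C t)
      induction t with
      | zero => simp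
      | add x y hx hy => simp only [_root_.map_add, hx, hy]
      | tmul c d =>
        have e₃ : ∀ u : C ⊗[k] C, LinearMap.mul' k C
            (TensorProduct.map (LinearMap.mul' k C) (ν (R : H ⊗[k] H))
              (midAct C C γ γ (R : H ⊗[k] H) (TensorProduct.tensorTensorTensorComm k C C C C
                (u ⊗ₜ Coalgebra.comul d)))) =
            Coalgebra.counit (R := k) d • LinearMap.mul' k C (S.lTensor C u) := by
          intro u
          induction u with
          | zero => simp
          | add x y hx hy =>
            simp only [_root_.map_add, TensorProduct.add_tmul, smul_add, hx, hy]
          | tmul c₁ c₂ =>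
            rw [e₁, ← hR.comulLeft_eq, e₂, hR.counitLeft_eq_one, h1]
            simp
        rw [braidedComul_tmul, e₃, hS.mul_antipode_lTensor_comul]
        simp [braidedCounit, Algebra.algebraMap_eq_smul_one, smul_smul, mul_comm]
  simpa [ν] using LinearMap.congr_fun e (c ⊗ₜ d)

/-- For `f`, `g` equivariant, `S (f(c₂) g(c₁)) = S g(c₁) S f(c₂)` where the coproduct on the left is
that of `C̄` and the one on the right that of `C`. -/
theorem IsBraidedAntipode.map_mul_comulBar {S : C →ₗ[k] C} (hR : IsQuasitriangular R)
    (hC : IsBraidedBialgebra R γ) (hS : IsBraidedAntipode γ S) (f g : C →ₗ[k] C)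
    (hf : ∀ c h, f (γ c h) = γ (f c) h) (hg : ∀ c h, g (γ c h) = γ (g c) h) (c : C) :
    S (LinearMap.mul' k C (TensorProduct.comm k C C (TensorProduct.map g f (comulBar R γ c)))) =
      LinearMap.mul' k C (TensorProduct.map (S ∘ₗ g) (S ∘ₗ f) (Coalgebra.comul c)) := by
  have e₁ : ∀ t : C ⊗[k] C,
      S (LinearMap.mul' k C (TensorProduct.comm k C C (TensorProduct.map g f t))) =
        LinearMap.mul' k C (act₂ γ.flip γ.flip (R : H ⊗[k] H)
          (TensorProduct.map (S ∘ₗ g) (S ∘ₗ f) t)) := by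
    intro t
    induction t with
    | zero => simp
    | add x y hx hy => simp only [_root_.map_add, hx, hy]
    | tmul a b => simp [hS.map_mul hR hC]
  have e₂ : ∀ (X : H ⊗[k] H) (t : C ⊗[k] C),
      TensorProduct.map (S ∘ₗ g) (S ∘ₗ f) (act₂ γ.flip γ.flip X t) =
        act₂ γ.flip γ.flip X (TensorProduct.map (S ∘ₗ g) (S ∘ₗ f) t) := by
    intro X t
    induction t with
    | zero => simp
    | add x y hx hy => simp only [_root_.map_add, hx, hy]
    | tmul a b =>
      induction X with
      | zero => simp
      | add x y hx hy => simp only [_root_.map_add, LinearMap.add_apply, hx, hy]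
      | tmul p q => simp [hf, hg, hS.map_act]
  have h := hC.isAntiAction.tensorAct hC.isAntiAction
  -- The `R` from anti-multiplicativity cancels the `R⁻¹` in the coproduct of `C̄`; equivariance of
  -- `f`, `g` and `S` brings the two together.
  rw [e₁, comulBar, LinearMap.comp_apply, e₂, act₂_eq_tensorAct, ← h.map_mul, inv_mul_eq_one,
    h.map_one]

theorem symm_map_act {S : C ≃ₗ[k] C} (hS : IsBraidedAntipode γ S.toLinearMap) (c : C) (h : H) :
    S.symm (γ c h) = γ (S.symm c) h := by
  apply S.injective
  have := hS.map_act (S.symm c) h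
  simp at this
  simp [this]

/-- `S⁻¹(c₂) c₁ = ε(c)` for the coproduct of `C̄`. -/
theorem symm_mul_comulBar {S : C ≃ₗ[k] C} (hR : IsQuasitriangular R)
    (hC : IsBraidedBialgebra R γ) (hS : IsBraidedAntipode γ S.toLinearMap) (c : C) :
    LinearMap.mul' k C (TensorProduct.comm k C C
      (TensorProduct.map LinearMap.id S.symm.toLinearMap (comulBar R γ c))) =
      algebraMap k C (Coalgebra.counit c) := by
  -- Applying `S` turns the claim into the antipode axiom of `S` for the coproduct of `C`.
  apply S.injective
  have h := hS.map_mul_comulBar hR hC S.symm.toLinearMap LinearMap.id (symm_map_act hS)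
    (fun _ _ => rfl) c
  have e : S.toLinearMap ∘ₗ S.symm.toLinearMap = LinearMap.id := by ext; simp
  rw [e, LinearMap.comp_id, ← LinearMap.rTensor_def, hS.mul_antipode_rTensor_comul] at h
  refine h.trans ?_
  have := hS.map_one hC
  simp at this
  simp [Algebra.algebraMap_eq_smul_one, this]

/-- `c₂ S⁻¹(c₁) = ε(c)` for the coproduct of `C̄`. -/
theorem mul_symm_comulBar {S : C ≃ₗ[k] C} (hR : IsQuasitriangular R)
    (hC : IsBraidedBialgebra R γ) (hS : IsBraidedAntipode γ S.toLinearMap) (c : C) :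
    LinearMap.mul' k C (TensorProduct.comm k C C
      (TensorProduct.map S.symm.toLinearMap LinearMap.id (comulBar R γ c))) =
      algebraMap k C (Coalgebra.counit c) := by
  apply S.injective
  have h := hS.map_mul_comulBar hR hC LinearMap.id S.symm.toLinearMap
    (fun _ _ => rfl) (symm_map_act hS) c
  have e : S.toLinearMap ∘ₗ S.symm.toLinearMap = LinearMap.id := by ext; simp
  rw [e, LinearMap.comp_id, ← LinearMap.lTensor_def, hS.mul_antipode_lTensor_comul] at h
  refine h.trans ?_
  have := hS.map_one hC
  simp at this
  simp [Algebra.algebraMap_eq_smul_one, this]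

end Antipode

/-! ### The action of `C` on `Hom(B, V)`, and twisting by it. -/

section PairAction

variable {k : Type*} [Field k] {H : Type*} [Ring H] [HopfAlgebra k H]
  {B : Type*} [Ring B] [Algebra k B] [Coalgebra k B]
  {C : Type*} [Ring C] [Algebra k C] [Coalgebra k C]
  {V : Type*} [AddCommGroup V] [Module k V]
  {R : (H ⊗[k] H)ˣ} {β : B →ₗ[k] H →ₗ[k] B} {γ : C →ₗ[k] H →ₗ[k] C} {ev : C →ₗ[k] B →ₗ[k] k}
  {τ : V →ₗ[k] H →ₗ[k] V}

/-- `(v ⊗ c) ⊗ b ↦ ev(c, b) v`. -/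
def evRight (V : Type*) [AddCommGroup V] [Module k V] (ev : C →ₗ[k] B →ₗ[k] k) :
    (V ⊗[k] C) ⊗[k] B →ₗ[k] V :=
  (TensorProduct.rid k V).toLinearMap ∘ₗ (TensorProduct.lift ev).lTensor V ∘ₗ
    (TensorProduct.assoc k V C B).toLinearMap

@[simp] theorem evRight_tmul (v : V) (c : C) (b : B) :
    evRight V ev ((v ⊗ₜ c) ⊗ₜ b) = ev c b • v := by
  simp [evRight]

/-- The map `n ↦ n(b₁) ◁ X⁽¹⁾ ev(c ◁ X⁽²⁾, b₂)` on linear maps from `B` to `V`. -/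
def pairAct (τ : V →ₗ[k] H →ₗ[k] V) (γ : C →ₗ[k] H →ₗ[k] C) (ev : C →ₗ[k] B →ₗ[k] k)
    (X : H ⊗[k] H) : C →ₗ[k] (B →ₗ[k] V) →ₗ[k] B →ₗ[k] V :=
  LinearMap.mk₂ k (fun c n => evRight V ev ∘ₗ
    (act₂ τ.flip γ.flip X ∘ₗ (TensorProduct.mk k V C).flip c ∘ₗ n).rTensor B ∘ₗ Coalgebra.comul)
    (fun c d n => by
      simp only [map_add, LinearMap.add_comp, LinearMap.comp_add, LinearMap.rTensor_add])
    (fun r c n => by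
      simp only [map_smul, LinearMap.smul_comp, LinearMap.comp_smul, LinearMap.rTensor_smul])
    (fun c n n' => by
      simp only [LinearMap.add_comp, LinearMap.comp_add, LinearMap.rTensor_add])
    (fun r c n => by
      simp only [LinearMap.smul_comp, LinearMap.comp_smul, LinearMap.rTensor_smul])

theorem pairAct_apply (X : H ⊗[k] H) (c : C) (n : B →ₗ[k] V) (b : B) :
    pairAct τ γ ev X c n b = evRight V ev
      ((act₂ τ.flip γ.flip X ∘ₗ (TensorProduct.mk k V C).flip c ∘ₗ n).rTensor B
        (Coalgebra.comul b)) := rfl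

theorem pairAct_one (hR : IsQuasitriangular R) (hτ : IsRightAction (LinearMap.mul k H) 1 τ)
    (hC : IsBraidedBialgebra R γ) (hev : IsDualPairing β γ ev) (n : B →ₗ[k] V) :
    pairAct τ γ ev (R : H ⊗[k] H) 1 n = n := by
  ext b
  have h : ∀ (X : H ⊗[k] H) (t : B ⊗[k] B), evRight V ev
      ((act₂ τ.flip γ.flip X ∘ₗ (TensorProduct.mk k V C).flip 1 ∘ₗ n).rTensor B t) =
      τ (n (TensorProduct.rid k B (Coalgebra.counit.lTensor B t))) (counitRight k H X) := by
    intro X t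
    induction t with
    | zero => simp
    | add x y hx hy => simp only [map_add, LinearMap.add_apply, hx, hy]
    | tmul b₁ b₂ =>
      induction X with
      | zero => simp
      | add x y hx hy =>
        simp only [map_add, LinearMap.add_apply, LinearMap.add_comp, LinearMap.rTensor_add, hx, hy]
        | tmul p q =>
        simp [hC.isModuleAlgebra.one_act, hev.one_left, smul_smul, ← TensorProduct.smul_tmul']
  rw [pairAct_apply, h, hR.counitRight_eq_one, hτ.act_one, Coalgebra.lTensor_counit_comul]
  simp

/-- `pairAct` is a left action of the algebra `C`. -/
theorem pairAct_mul (hR : IsQuasitriangular R) (hτ : IsRightAction (LinearMap.mul k H) 1 τ)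
    (hC : IsBraidedBialgebra R γ) (hev : IsDualPairing β γ ev) (x y : C) (n : B →ₗ[k] V) :
    pairAct τ γ ev (R : H ⊗[k] H) (x * y) n =
      pairAct τ γ ev (R : H ⊗[k] H) x (pairAct τ γ ev (R : H ⊗[k] H) y n) := by
  ext b
  have tm : ∀ v a b, τ v (a * b) = τ (τ v a) b := hτ.act_mul
  let P : C ⊗[k] C →ₗ[k] B ⊗[k] B →ₗ[k] k :=
    LinearMap.compRight k (LinearMap.mul' k k) ∘ₗ
      TensorProduct.homTensorHomMap (RingHom.id k) B B k k ∘ₗ TensorProduct.map ev ev ∘ₗ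
      (TensorProduct.comm k C C).toLinearMap
  let Ψ : V ⊗[k] (C ⊗[k] C) →ₗ[k] B ⊗[k] B →ₗ[k] V :=
    TensorProduct.lift (LinearMap.smulRightₗ ∘ₗ P).flip
  have hΨ : ∀ v x y b₂ b₃, Ψ (v ⊗ₜ (x ⊗ₜ y)) (b₂ ⊗ₜ b₃) = (ev y b₂ * ev x b₃) • v := by
    intro v x y b₂ b₃
    simp [Ψ, P]
  let Q : V → H ⊗[k] (H ⊗[k] H) →ₗ[k] V ⊗[k] (C ⊗[k] C) := fun v =>
    (tensorAct τ.flip (tensorAct γ.flip γ.flip)).flip (v ⊗ₜ (x ⊗ₜ y))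
  have e₁ : ∀ (X : H ⊗[k] H) (v : V), act₂ τ.flip γ.flip X (v ⊗ₜ (x * y)) =
      (LinearMap.mul' k C).lTensor V (Q v (comulRight k H X)) := by
    intro X v
    induction X with
    | zero => simp
    | add x y hx hy => simp only [map_add, LinearMap.add_apply, hx, hy]
    | tmul p q =>
      have := hC.mul_act₂_comul q (x ⊗ₜ y)
      rw [act₂_eq_tensorAct] at this
      simp [Q, this]
  have e₂ : ∀ (z : V ⊗[k] (C ⊗[k] C)) (b' : B),
      evRight V ev ((LinearMap.mul' k C).lTensor V z ⊗ₜ b') = Ψ z (Coalgebra.comul b') := by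
    intro z b'
    induction z with
    | zero => simp
    | add x y hx hy => simp only [map_add, TensorProduct.add_tmul, LinearMap.add_apply, hx, hy]
    | tmul v t =>
      induction t with
      | zero => simp
      | add x y hx hy =>
        simp only [map_add, TensorProduct.add_tmul, TensorProduct.tmul_add, LinearMap.add_apply,
          hx, hy]
      | tmul x y => simp [hev.mul_left, Ψ, P]
  have e₃ : ∀ (X Y : H ⊗[k] H) (v : V) (b₂ b₃ : B),
      evRight V ev (act₂ τ.flip γ.flip X
        (evRight V ev (act₂ τ.flip γ.flip Y (v ⊗ₜ y) ⊗ₜ b₂) ⊗ₜ x) ⊗ₜ b₃) =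
      Ψ (Q v (leg₁₃ k H Y * leg₁₂ k H X)) (b₂ ⊗ₜ b₃) := by
    intro X Y v b₂ b₃
    induction X with
    | zero => simp
    | add x y hx hy =>
      simp only [map_add, mul_add, TensorProduct.add_tmul, LinearMap.add_apply, hx, hy]
    | tmul a b =>
      induction Y with
      | zero => simp
      | add x y hx hy =>
        simp only [map_add, add_mul, TensorProduct.add_tmul, LinearMap.add_apply, hx, hy]
      | tmul c d =>
        simp [Q, hΨ, tm, smul_smul, mul_comm]
  -- Both sides are `M` on an iterated coproduct of `b`. The action of `R⁽²⁾` on `x y` gives `(id ⊗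
  -- Δ) R`, two successive braidings give `R₁₃ R₁₂`, and these agree by the hexagon.
  let M : B ⊗[k] (B ⊗[k] B) →ₗ[k] V := TensorProduct.lift (Ψ ∘ₗ
    tensorAct τ.flip (tensorAct γ.flip γ.flip) (comulRight k H (R : H ⊗[k] H)) ∘ₗ
    (TensorProduct.mk k V (C ⊗[k] C)).flip (x ⊗ₜ y) ∘ₗ n)
  have e₄ : ∀ t : B ⊗[k] B, evRight V ev ((act₂ τ.flip γ.flip (R : H ⊗[k] H) ∘ₗ
      (TensorProduct.mk k V C).flip (x * y) ∘ₗ n).rTensor B t) =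
      M (Coalgebra.comul.lTensor B t) := by
    intro t
    induction t with
    | zero => simp
    | add x y hx hy => simp only [map_add, hx, hy]
    | tmul b₁ b₂ => simp [e₁, e₂, M, Q]
  have e₅ : ∀ t : B ⊗[k] B, evRight V ev ((act₂ τ.flip γ.flip (R : H ⊗[k] H) ∘ₗ
      (TensorProduct.mk k V C).flip x ∘ₗ pairAct τ γ ev (R : H ⊗[k] H) y n).rTensor B t) =
      M (TensorProduct.assoc k B B B (Coalgebra.comul.rTensor B t)) := by
    intro t
    induction t with
    | zero => simp
    | add x y hx hy => simp only [map_add, hx, hy]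
    | tmul b b₃ =>
      have e₆ : ∀ u : B ⊗[k] B, evRight V ev (act₂ τ.flip γ.flip (R : H ⊗[k] H)
          (evRight V ev ((act₂ τ.flip γ.flip (R : H ⊗[k] H) ∘ₗ
            (TensorProduct.mk k V C).flip y ∘ₗ n).rTensor B u) ⊗ₜ x) ⊗ₜ b₃) =
          M (TensorProduct.assoc k B B B (u ⊗ₜ b₃)) := by
        intro u
        induction u with
        | zero => simp
        | add x y hx hy => simp only [map_add, TensorProduct.add_tmul, hx, hy]
        | tmul b₁ b₂ => simp [e₃, M, Q, hR.comulRight_eq]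
      simpa [pairAct_apply] using e₆ (Coalgebra.comul b)
  rw [pairAct_apply, pairAct_apply, e₄, e₅, Coalgebra.coassoc_apply]

/-- The map `c ↦ p(c₂) (K c₁)` for the coproduct of `C̄`. -/
def twistBar {N : Type*} [AddCommGroup N] [Module k N] (R : (H ⊗[k] H)ˣ) (γ : C →ₗ[k] H →ₗ[k] C)
    (p : C →ₗ[k] N →ₗ[k] N) (K : C →ₗ[k] N) : C →ₗ[k] N :=
  TensorProduct.lift (p.flip ∘ₗ K) ∘ₗ comulBar R γ

/-- As `pairAct` is multiplicative, the convolution identity `f(c₂) g(c₁) = ε(c)` becomes the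
hypothesis of `twist_twist`, applied to the coalgebra `C̄` rather than `C`. -/
theorem twistBar_twistBar (hR : IsQuasitriangular R)
    (hτ : IsRightAction (LinearMap.mul k H) 1 τ)
    (hC : IsBraidedBialgebra R γ) (hev : IsDualPairing β γ ev) (f g : C →ₗ[k] C)
    (hfg : ∀ c, LinearMap.mul' k C (TensorProduct.comm k C C (TensorProduct.map g f
      (comulBar R γ c))) = algebraMap k C (Coalgebra.counit c)) (K : C →ₗ[k] B →ₗ[k] V) :
    twistBar R γ (pairAct τ γ ev (R : H ⊗[k] H) ∘ₗ f)
      (twistBar R γ (pairAct τ γ ev (R : H ⊗[k] H) ∘ₗ g) K) = K := by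
  refine @twist_twist k _ C _ _ (barCoalgebra hR hC) _ _ _ _ _ (fun c n => ?_) K
  have h : ∀ t : C ⊗[k] C, TensorProduct.lift ((pairAct τ γ ev (R : H ⊗[k] H) ∘ₗ f).flip ∘ₗ
      (pairAct τ γ ev (R : H ⊗[k] H) ∘ₗ g).flip n) t =
      pairAct τ γ ev (R : H ⊗[k] H) (LinearMap.mul' k C (TensorProduct.comm k C C
        (TensorProduct.map g f t))) n := by
    intro t
    induction t with
    | zero => simp
    | add x y hx hy => simp only [map_add, LinearMap.add_apply, hx, hy]
    | tmul a b => simp [pairAct_mul hR hτ hC hev]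
  refine (h _).trans ?_
  change pairAct τ γ ev (R : H ⊗[k] H) (LinearMap.mul' k C (TensorProduct.comm k C C
    (TensorProduct.map g f (comulBar R γ c)))) n = _
  rw [hfg, Algebra.algebraMap_eq_smul_one, map_smul, LinearMap.smul_apply,
    pairAct_one hR hτ hC hev]
  rfl

end PairAction

/-! ### The extended action, and the left-hand side of the compatibility condition as a twist. -/

section Reordering

variable {k : Type*} [Field k] {H : Type*} [Ring H] [HopfAlgebra k H]
  {B : Type*} [Ring B] [Algebra k B] [Coalgebra k B]
  {C : Type*} [Ring C] [Algebra k C] [Coalgebra k C]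
  {V : Type*} [AddCommGroup V] [Module k V]
  {R : (H ⊗[k] H)ˣ} {β : B →ₗ[k] H →ₗ[k] B} {γ : C →ₗ[k] H →ₗ[k] C} {ev : C →ₗ[k] B →ₗ[k] k}

namespace Actions

/-- The map `v ⊗ (c ⊗ h ⊗ b) ↦ ((c ▷ v) ◁ h) ◁ b`. -/
def extend (t : Actions k H B C V) : V →ₗ[k] C ⊗[k] (H ⊗[k] B) →ₗ[k] V :=
  TensorProduct.uncurry (.id k) C (H ⊗[k] B) V ∘ₗ
    LinearMap.llcomp k C V (H ⊗[k] B →ₗ[k] V)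
      (TensorProduct.uncurry (.id k) H B V ∘ₗ LinearMap.llcomp k H V (B →ₗ[k] V) t.actB ∘ₗ t.actH) ∘ₗ
    t.actC.flip

@[simp] theorem extend_tmul (t : Actions k H B C V) (v : V) (c : C) (h : H) (b : B) :
    t.extend v (c ⊗ₜ (h ⊗ₜ b)) = t.actB (t.actH (t.actC c v) h) b := by
  simp [extend]

/-- The right-hand side `ev(c₁, b₁ ◁ R⁽¹⁾) ((c₂ ▷ v) ◁ R⁽²⁾) ◁ b₂` of the compatibility condition,
with `c₁ ⊗ c₂` and `b₁ ⊗ b₂` replaced by arbitrary tensors. -/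
def crossRight₂ (R : (H ⊗[k] H)ˣ) (β : B →ₗ[k] H →ₗ[k] B) (ev : C →ₗ[k] B →ₗ[k] k)
    (t : Actions k H B C V) (v : V) : (C ⊗[k] C) ⊗[k] (B ⊗[k] B) →ₗ[k] V :=
  (TensorProduct.lid k V).toLinearMap ∘ₗ
    TensorProduct.map (TensorProduct.lift ev) (TensorProduct.lift t.actB) ∘ₗ
    midBraiding C B R t.actH β ∘ₗ ((t.actC.flip v).lTensor C).rTensor (B ⊗[k] B)

/-- The map `c ⊗ b ↦ ev(c₁, b₁ ◁ R⁽¹⁾) ((c₂ ▷ v) ◁ R⁽²⁾) ◁ b₂`. -/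
def crossRight (R : (H ⊗[k] H)ˣ) (β : B →ₗ[k] H →ₗ[k] B) (ev : C →ₗ[k] B →ₗ[k] k)
    (t : Actions k H B C V) (v : V) : C →ₗ[k] B →ₗ[k] V :=
  TensorProduct.curry (t.crossRight₂ R β ev v ∘ₗ
    TensorProduct.map Coalgebra.comul Coalgebra.comul)

theorem crossRight_apply (t : Actions k H B C V) (v : V) (c : C) (b : B) :
    t.crossRight R β ev v c b =
      t.crossRight₂ R β ev v (Coalgebra.comul c ⊗ₜ Coalgebra.comul b) := by
  simp [crossRight]

/-- The map `c ⊗ b ↦ c ▷ (v ◁ b)`. -/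
def actBC (t : Actions k H B C V) (v : V) : C →ₗ[k] B →ₗ[k] V :=
  LinearMap.lcomp k V (t.actB v) ∘ₗ t.actC

/-- For `c₁ ⊗ c₂` in `C ⊗ C` one has
`((c₁ ◁ R⁻⁽¹⁾) ▷ w) ◁ R'⁽¹⁾ ⊗ c₂ ◁ R⁻⁽²⁾ R'⁽²⁾ = c₁ ▷ (w ◁ R⁽¹⁾) ⊗ c₂ ◁ R⁽²⁾`. -/
theorem actC_braiding (hR : IsQuasitriangular R) (hC : IsBraidedBialgebra R γ)
    {t : Actions k H B C V}
    (hCe : IsEquivariant₂ γ t.actH t.actH t.actC) (w : V) (u : C ⊗[k] C) :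
    act₂ t.actH.flip γ.flip (R : H ⊗[k] H) ((t.actC.flip w).rTensor C
      (act₂ γ.flip γ.flip ((R⁻¹ : (H ⊗[k] H)ˣ) : H ⊗[k] H) u)) =
    (TensorProduct.lift t.actC).rTensor C ((TensorProduct.assoc k C V C).symm
      ((act₂ t.actH.flip γ.flip (R : H ⊗[k] H) ∘ₗ TensorProduct.mk k V C w).lTensor C u)) := by
  have hm : ∀ a b c, γ c (a * b) = γ (γ c a) b := hC.isAntiAction.map_mul
  let A := tensorAct γ.flip (tensorAct t.actH.flip γ.flip)
  let F : C ⊗[k] (V ⊗[k] C) →ₗ[k] V ⊗[k] C := (TensorProduct.lift t.actC).rTensor C ∘ₗ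
    (TensorProduct.assoc k C V C).symm.toLinearMap
  -- Equivariance distributes `X⁽¹⁾` over `c₁` and `w` by the coproduct.
  have e₁ : ∀ (X : H ⊗[k] H) (z : C ⊗[k] C),
      act₂ t.actH.flip γ.flip X ((t.actC.flip w).rTensor C z) =
        F (A (comulLeft k H X) ((TensorProduct.mk k V C w).lTensor C z)) := by
    intro X z
    induction z with
    | zero => simp
    | add x y hx hy => simp only [map_add, hx, hy]
    | tmul c₁ c₂ =>
      induction X with
      | zero => simp
      | add x y hx hy => simp only [map_add, LinearMap.add_apply, hx, hy]
      | tmul a b =>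
        have e₂ : ∀ Y : H ⊗[k] H, F (A (TensorProduct.assoc k H H H (Y ⊗ₜ b))
            (c₁ ⊗ₜ (w ⊗ₜ c₂))) =
            TensorProduct.lift t.actC (TensorProduct.map (γ c₁) (t.actH w) Y) ⊗ₜ γ c₂ b := by
          intro Y
          induction Y with
          | zero => simp
          | add x y hx hy =>
            simp only [map_add, TensorProduct.add_tmul, LinearMap.add_apply, hx, hy]
          | tmul p q => simp [F, A]
        simp [e₂, hCe c₁ w a]
  -- In `(Δ ⊗ id) R = R₁₃ R₂₃` the factor `R₁₃` acts on `c₁ ⊗ c₂`, where it will cancel `R⁻¹`, and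
  -- `R₂₃` remains as the braiding of `w` with `c₂`.
  have e₃ : ∀ (X Y : H ⊗[k] H) (z : C ⊗[k] C),
      A (leg₁₃ k H X * leg₂₃ k H Y) ((TensorProduct.mk k V C w).lTensor C z) =
        (act₂ t.actH.flip γ.flip Y ∘ₗ TensorProduct.mk k V C w).lTensor C
          (act₂ γ.flip γ.flip X z) := by
    intro X Y z
    induction z with
    | zero => simp
    | add x y hx hy => simp only [map_add, hx, hy]
    | tmul c₁ c₂ =>
      induction X with
      | zero => simp
      | add x y hx hy => simp only [map_add, add_mul, LinearMap.add_apply, hx, hy]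
      | tmul a b =>
        induction Y with
        | zero => simp
        | add x y hx hy =>
          simp only [map_add, mul_add, LinearMap.add_apply, LinearMap.add_comp,
            LinearMap.lTensor_add, hx, hy]
        | tmul p q => simp [A, leg₂₃_apply, hm]
  have h := hC.isAntiAction.tensorAct hC.isAntiAction
  rw [e₁, hR.comulLeft_eq, e₃, act₂_eq_tensorAct γ.flip, ← h.map_mul, inv_mul_eq_one, h.map_one]
  rfl

/-- The left-hand side of the compatibility condition, in terms of the coproduct of `C̄`. -/
theorem compatible_left_eq (hR : IsQuasitriangular R) (hC : IsBraidedBialgebra R γ)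
    {t : Actions k H B C V} (hH : IsRightAction (LinearMap.mul k H) 1 t.actH)
    (hCe : IsEquivariant₂ γ t.actH t.actH t.actC) (c : C) (v : V) (b : B) :
    TensorProduct.rid k V (TensorProduct.map (TensorProduct.lift t.actC) (TensorProduct.lift ev)
      (midBraiding C B R γ t.actH
        (Coalgebra.comul c ⊗ₜ[k] (t.actB v).rTensor B (Coalgebra.comul b)))) =
    twistBar R γ (pairAct t.actH γ ev (R : H ⊗[k] H)) (t.actBC v) c b := by
  have e₁ : ∀ (X : H ⊗[k] H) (c₁ c₂ : C) (w : V) (b₂ : B),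
      TensorProduct.rid k V (TensorProduct.map (TensorProduct.lift t.actC)
        (TensorProduct.lift ev) (midAct C B γ t.actH X ((c₁ ⊗ₜ w) ⊗ₜ (c₂ ⊗ₜ b₂)))) =
      evRight V ev ((TensorProduct.lift t.actC).rTensor C ((TensorProduct.assoc k C V C).symm
        (c₁ ⊗ₜ act₂ t.actH.flip γ.flip X (w ⊗ₜ c₂))) ⊗ₜ b₂) := by
    intro X c₁ c₂ w b₂
    induction X with
    | zero => simp
    | add x y hx hy =>
      simp only [map_add, TensorProduct.add_tmul, TensorProduct.tmul_add, LinearMap.add_apply,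
        hx, hy]
    | tmul p q => simp
  have e₂ : ∀ z : C ⊗[k] C, TensorProduct.lift ((pairAct t.actH γ ev (R : H ⊗[k] H)).flip ∘ₗ
      t.actBC v) z b = evRight V ev ((act₂ t.actH.flip γ.flip (R : H ⊗[k] H) ∘ₗ
        (LinearMap.rTensorHom C ∘ₗ t.actC.flip ∘ₗ t.actB v).flip z).rTensor B
        (Coalgebra.comul b)) := by
    intro z
    induction z with
    | zero => simp
    | add x y hx hy =>
      simp only [map_add, LinearMap.comp_add, LinearMap.rTensor_add, LinearMap.add_apply, hx, hy]
    | tmul c₁ c₂ =>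
      rw [TensorProduct.lift.tmul, LinearMap.comp_apply, LinearMap.flip_apply, pairAct_apply]
      rfl
  have e₃ : ∀ (u : C ⊗[k] C) (s : B ⊗[k] B),
      TensorProduct.rid k V (TensorProduct.map (TensorProduct.lift t.actC)
        (TensorProduct.lift ev) (midBraiding C B R γ t.actH (u ⊗ₜ (t.actB v).rTensor B s))) =
      evRight V ev ((act₂ t.actH.flip γ.flip (R : H ⊗[k] H) ∘ₗ
        (LinearMap.rTensorHom C ∘ₗ t.actC.flip ∘ₗ t.actB v).flip
          (act₂ γ.flip γ.flip ((R⁻¹ : (H ⊗[k] H)ˣ) : H ⊗[k] H) u)).rTensor B s) := by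
    intro u s
    induction s with
    | zero => simp
    | add x y hx hy => simp only [map_add, TensorProduct.tmul_add, hx, hy]
    | tmul b₁ b₂ =>
      -- This trades the braiding of `c₂` past `v ◁ b₁` for the coproduct of `C̄`, followed by the
      -- braiding built into `pairAct`.
      have h := actC_braiding hR hC hCe (t.actB v b₁) u
      simp only [LinearMap.rTensor_tmul, LinearMap.comp_apply, LinearMap.flip_apply,
        LinearMap.coe_rTensorHom]
      rw [h]
      induction u with
      | zero => simp
      | add x y hx hy =>
        simp only [map_add, TensorProduct.add_tmul,
          hx (actC_braiding hR hC hCe (t.actB v b₁) x),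
          hy (actC_braiding hR hC hCe (t.actB v b₁) y)]
      | tmul c₁ c₂ => simp [midBraiding_apply, e₁]
  rw [e₃, twistBar, LinearMap.comp_apply, e₂]
  rfl

end Actions

end Reordering

/-! ### The action of the reordered product, and its equivalence with compatibility. -/

section Cross

variable {k : Type*} [Field k] {H : Type*} [Ring H] [HopfAlgebra k H]
  {B : Type*} [Ring B] [Algebra k B] [Coalgebra k B]
  {C : Type*} [Ring C] [Algebra k C] [Coalgebra k C]
  {V : Type*} [AddCommGroup V] [Module k V]
  {R : (H ⊗[k] H)ˣ} {β : B →ₗ[k] H →ₗ[k] B} {γ : C →ₗ[k] H →ₗ[k] C} {ev : C →ₗ[k] B →ₗ[k] k}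

/-- By `(S ⊗ S) R = R` the left action of `R` equals its right action, which undoes the `R⁻¹` in the
coproduct of `C̄`. Hence the first two `C`-legs of `cross` carry the coproduct of `C` itself. -/
theorem actBar_comulBar (hR : IsQuasitriangular R) (hC : IsBraidedBialgebra R γ) (c : C) :
    act₂ (actBar γ) (actBar γ) (R : H ⊗[k] H) (comulBar R γ c) = Coalgebra.comul c := by
  have e : ∀ (X : H ⊗[k] H) (z : C ⊗[k] C), act₂ (actBar γ) (actBar γ) X z =
      act₂ γ.flip γ.flip
        (TensorProduct.map (HopfAlgebra.antipode k) (HopfAlgebra.antipode k) X) z := by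
    intro X z
    induction z with
    | zero => simp
    | add x y hx hy => simp only [map_add, hx, hy]
    | tmul c d =>
      induction X with
      | zero => simp
      | add x y hx hy => simp only [map_add, LinearMap.add_apply, hx, hy]
      | tmul a b => simp [actBar]
  have h := hC.isAntiAction.tensorAct hC.isAntiAction
  rw [e, hR.antipode_antipode, comulBar, LinearMap.comp_apply, act₂_eq_tensorAct, ← h.map_mul,
    inv_mul_eq_one, h.map_one]

/-- The antipode in `actBar` is absorbed by `(id ⊗ S) R⁻¹ = R`. -/
theorem coactBar_apply (hR : IsQuasitriangular R) (c : C) : coactBar R γ c =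
    act₂ (LinearMap.mul k H) γ.flip (R : H ⊗[k] H) (1 ⊗ₜ c) := by
  have e : ∀ X : H ⊗[k] H, act₂ (LinearMap.mul k H) (actBar γ) X (1 ⊗ₜ c) =
      act₂ (LinearMap.mul k H) γ.flip ((HopfAlgebra.antipode k).lTensor H X) (1 ⊗ₜ c) := by
    intro X
    induction X with
    | zero => simp
    | add x y hx hy => simp only [map_add, LinearMap.add_apply, hx, hy]
    | tmul a b => simp [actBar]
  rw [coactBar, LinearMap.comp_apply, TensorProduct.mk_apply, e, hR.antipode_right_inv]

/-- `ev(c, b ◁ h) = ev(c ◁ S h, b)`. -/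
theorem IsDualPairing.act_right (hC : IsBraidedBialgebra R γ)
    (hev : IsDualPairing β γ ev) (c : C) (b : B) (h : H) :
    ev c (β b h) = ev (γ c (HopfAlgebra.antipode k h)) b := by
  have hm : ∀ a b c, γ c (a * b) = γ (γ c a) b := hC.isAntiAction.map_mul
  have h1 : ∀ c, γ c 1 = c := hC.isAntiAction.map_one
  -- On `h₁ ⊗ h₂ ⊗ h₃` the value is `ev(c ◁ S(h₁) h₂, b ◁ h₃)`. The first pair contracts by the
  -- antipode axiom, the last pair by equivariance of `ev`.
  let F : H ⊗[k] (H ⊗[k] H) →ₗ[k] k :=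
    TensorProduct.lift ev ∘ₗ
      TensorProduct.map (γ c ∘ₗ LinearMap.mul' k H ∘ₗ (HopfAlgebra.antipode k).rTensor H) (β b) ∘ₗ
      (TensorProduct.assoc k H H H).symm.toLinearMap
  have e₁ : ∀ t : H ⊗[k] H, F (TensorProduct.assoc k H H H (Coalgebra.comul.rTensor H t)) =
      ev c (β b (TensorProduct.lid k H (Coalgebra.counit.rTensor H t))) := by
    intro t
    induction t with
    | zero => simp
    | add x y hx hy => simp only [map_add, hx, hy]
    | tmul p q => simp [F, Algebra.algebraMap_eq_smul_one, h1]
  have e₂ : ∀ t : H ⊗[k] H, F (Coalgebra.comul.lTensor H t) =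
      ev (γ c (HopfAlgebra.antipode k (TensorProduct.rid k H (Coalgebra.counit.lTensor H t)))) b := by
    intro t
    induction t with
    | zero => simp
    | add x y hx hy => simp only [map_add, LinearMap.add_apply, hx, hy]
    | tmul p q =>
      have e₃ : ∀ u : H ⊗[k] H, F (p ⊗ₜ u) =
          TensorProduct.lift ev (TensorProduct.map (γ (γ c (HopfAlgebra.antipode k p))) (β b) u) := by
        intro u
        induction u with
        | zero => simp
        | add x y hx hy => simp only [map_add, TensorProduct.tmul_add, hx, hy]
        | tmul x y => simp [F, hm]
      rw [LinearMap.lTensor_tmul, e₃, ← hev.equivariant]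
      simp [trivialAction, mul_comm]
  have := e₁ (Coalgebra.comul h)
  rw [Coalgebra.coassoc_apply, e₂, Coalgebra.rTensor_counit_comul,
    Coalgebra.lTensor_counit_comul] at this
  simpa using this.symm

namespace Actions

/-- `(v ⊗ z) ⊗ (b ⊗ b') ↦ (v ◁ b) ev(z, b')`. -/
def actEv (ev : C →ₗ[k] B →ₗ[k] k) (t : Actions k H B C V) :
    (V ⊗[k] C) ⊗[k] (B ⊗[k] B) →ₗ[k] V :=
  (TensorProduct.rid k V).toLinearMap ∘ₗ
    TensorProduct.map (TensorProduct.lift t.actB) (TensorProduct.lift ev) ∘ₗ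
    (TensorProduct.tensorTensorTensorComm k V C B B).toLinearMap

@[simp] theorem actEv_tmul (t : Actions k H B C V) (v : V) (z : C) (b b' : B) :
    t.actEv ev ((v ⊗ₜ z) ⊗ₜ (b ⊗ₜ b')) = ev z b' • t.actB v b := by
  simp [actEv]

/-- `(v ◁ R⁽¹⁾) ◁ (b ◁ R⁻⁽¹⁾) ev(z ◁ R⁽²⁾, b' ◁ R⁻⁽²⁾) = (v ◁ b) ◁ R⁽¹⁾ ev(z ◁ R⁽²⁾, b')`. -/
theorem actEv_act (hR : IsQuasitriangular R) (hB : IsBraidedBialgebra R β)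
    (hC : IsBraidedBialgebra R γ) (hev : IsDualPairing β γ ev)
    {t : Actions k H B C V} (hBe : IsEquivariant₂ t.actH β t.actH t.actB) (v : V) (z : C) (b b' : B) :
    t.actEv ev (act₂ t.actH.flip γ.flip (R : H ⊗[k] H) (v ⊗ₜ z) ⊗ₜ
      act₂ β.flip β.flip ((R⁻¹ : (H ⊗[k] H)ˣ) : H ⊗[k] H) (b ⊗ₜ b')) =
    evRight V ev (act₂ t.actH.flip γ.flip (R : H ⊗[k] H) (t.actB v b ⊗ₜ z) ⊗ₜ b') := by
  have hm : ∀ a b c, γ c (a * b) = γ (γ c a) b := hC.isAntiAction.map_mul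
  let D : V → C → H ⊗[k] H →ₗ[k] V := fun v z => (TensorProduct.rid k V).toLinearMap ∘ₗ
    TensorProduct.map (t.actB v ∘ₗ β b) (ev.flip b' ∘ₗ γ z)
  let F : H ⊗[k] (H ⊗[k] H) →ₗ[k] V := (TensorProduct.rid k V).toLinearMap ∘ₗ
    TensorProduct.map (TensorProduct.lift t.actB ∘ₗ TensorProduct.map (t.actH v) (β b))
      (ev.flip b' ∘ₗ γ z) ∘ₗ (TensorProduct.assoc k H H H).symm.toLinearMap
  -- Moving `R⁻⁽²⁾` from `b'` to `z` costs an antipode, so `R⁻¹` becomes `R`. The two copies of `R`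
  -- then form `R₁₃ R₂₃ = (Δ ⊗ id) R`, which is what equivariance of the action of `B` requires.
  have e₁ : ∀ (Y : H ⊗[k] H) (v : V) (z : C),
      t.actEv ev ((v ⊗ₜ z) ⊗ₜ act₂ β.flip β.flip Y (b ⊗ₜ b')) =
        D v z ((HopfAlgebra.antipode k).lTensor H Y) := by
    intro Y v z
    induction Y with
    | zero => simp
    | add x y hx hy => simp only [map_add, TensorProduct.tmul_add, LinearMap.add_apply, hx, hy]
    | tmul p q => simp [D, hev.act_right hC]
  have e₂ : ∀ X : H ⊗[k] H, evRight V ev (act₂ t.actH.flip γ.flip X (t.actB v b ⊗ₜ z) ⊗ₜ b') =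
      F (comulLeft k H X) := by
    intro X
    induction X with
    | zero => simp
    | add x y hx hy => simp only [map_add, TensorProduct.add_tmul, LinearMap.add_apply, hx, hy]
    | tmul p q => simp [F, hBe v b p]
  have e₃ : ∀ (p q : H) (Y : H ⊗[k] H),
      D (t.actH v p) (γ z q) Y = F (leg₁₃ k H (p ⊗ₜ q) * leg₂₃ k H Y) := by
    intro p q Y
    induction Y with
    | zero => simp
    | add x y hx hy => simp only [map_add, mul_add, hx, hy]
    | tmul c d => simp [D, F, leg₂₃_apply, hm]
  have e₄ : ∀ X Y : H ⊗[k] H, t.actEv ev (act₂ t.actH.flip γ.flip X (v ⊗ₜ z) ⊗ₜ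
      act₂ β.flip β.flip Y (b ⊗ₜ b')) =
        F (leg₁₃ k H X * leg₂₃ k H ((HopfAlgebra.antipode k).lTensor H Y)) := by
    intro X Y
    induction X with
    | zero => simp
    | add x y hx hy =>
      simp only [map_add, add_mul, TensorProduct.add_tmul, LinearMap.add_apply, hx, hy]
    | tmul p q =>
      rw [← e₃, ← e₁]
      simp
  rw [e₄, e₂, hR.antipode_right_inv, hR.comulLeft_eq]

/-- With `actEv_act` absorbing `R⁻¹`, the last legs `z` and `b₃` separate from the others. The first
two legs give the right-hand side of the compatibility condition, and the last ones pair with it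
exactly as in `pairAct`. -/
theorem extend_contract (hR : IsQuasitriangular R) (hB : IsBraidedBialgebra R β)
    (hC : IsBraidedBialgebra R γ) (hev : IsDualPairing β γ ev)
    {t : Actions k H B C V} (hH : IsRightAction (LinearMap.mul k H) 1 t.actH)
    (hBe : IsEquivariant₂ t.actH β t.actH t.actB) (v : V) (u : C ⊗[k] C) (z : C)
    (w : B ⊗[k] B) (b₃ : B) :
    t.extend v (contract H ev (TensorProduct.assoc k C C (H ⊗[k] C) (u ⊗ₜ coactBar R γ z) ⊗ₜ
      TensorProduct.assoc k B H (B ⊗[k] B) (TensorProduct.map (coact R β)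
        (act₂ β.flip β.flip ((R⁻¹ : (H ⊗[k] H)ˣ) : H ⊗[k] H))
          (TensorProduct.assoc k B B B (w ⊗ₜ b₃))))) =
    evRight V ev (act₂ t.actH.flip γ.flip (R : H ⊗[k] H)
      (t.crossRight₂ R β ev v (u ⊗ₜ w) ⊗ₜ z) ⊗ₜ b₃) := by
  have tm : ∀ v a b, t.actH v (a * b) = t.actH (t.actH v a) b := hH.act_mul
  induction u with
  | zero => simp
  | add x y hx hy => simp only [map_add, TensorProduct.add_tmul, hx, hy]
  | tmul x y =>
  induction w with
  | zero => simp
  | add x y hx hy => simp only [map_add, TensorProduct.add_tmul, TensorProduct.tmul_add, hx, hy]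
  | tmul b₁ b₂ =>
  have e₁ : ∀ (X Y : H ⊗[k] H) (e f : H),
      t.extend v (contract H ev (TensorProduct.assoc k C C (H ⊗[k] C) ((x ⊗ₜ y) ⊗ₜ
        act₂ (LinearMap.mul k H) γ.flip X (1 ⊗ₜ z)) ⊗ₜ
        TensorProduct.assoc k B H (B ⊗[k] B) ((β b₁ e ⊗ₜ f) ⊗ₜ
          act₂ β.flip β.flip Y (b₂ ⊗ₜ b₃)))) =
      ev x (β b₁ e) • t.actEv ev (act₂ t.actH.flip γ.flip X (t.actH (t.actC y v) f ⊗ₜ z) ⊗ₜ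
        act₂ β.flip β.flip Y (b₂ ⊗ₜ b₃)) := by
    intro X Y e f
    induction X with
    | zero => simp
    | add x y hx hy =>
      simp only [map_add, TensorProduct.add_tmul, TensorProduct.tmul_add, LinearMap.add_apply,
        smul_add, hx, hy]
    | tmul p q =>
      induction Y with
      | zero => simp
      | add x y hx hy =>
        simp only [map_add, TensorProduct.tmul_add, LinearMap.add_apply, smul_add, hx, hy]
      | tmul c d => simp [contract_tmul, smul_smul, tm]
  have e₂ : ∀ W : H ⊗[k] H,
      t.extend v (contract H ev (TensorProduct.assoc k C C (H ⊗[k] C) ((x ⊗ₜ y) ⊗ₜ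
        coactBar R γ z) ⊗ₜ
        TensorProduct.assoc k B H (B ⊗[k] B) (act₂ β.flip (LinearMap.mul k H) W (b₁ ⊗ₜ 1) ⊗ₜ
          act₂ β.flip β.flip ((R⁻¹ : (H ⊗[k] H)ˣ) : H ⊗[k] H) (b₂ ⊗ₜ b₃)))) =
      evRight V ev (act₂ t.actH.flip γ.flip (R : H ⊗[k] H)
        (TensorProduct.lid k V (TensorProduct.map (TensorProduct.lift ev)
          (TensorProduct.lift t.actB) (midAct C B t.actH β W
            ((x ⊗ₜ b₁) ⊗ₜ (t.actC y v ⊗ₜ b₂)))) ⊗ₜ z) ⊗ₜ b₃) := by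
    intro W
    induction W with
    | zero => simp
    | add x y hx hy =>
      simp only [map_add, TensorProduct.add_tmul, TensorProduct.tmul_add, LinearMap.add_apply,
        hx, hy]
    | tmul e f =>
      have := e₁ (R : H ⊗[k] H) ((R⁻¹ : (H ⊗[k] H)ˣ) : H ⊗[k] H) e f
      rw [actEv_act hR hB hC hev hBe, ← coactBar_apply hR] at this
      simpa [← TensorProduct.smul_tmul'] using this
  simpa [crossRight₂, midBraiding_apply, coact] using e₂ (R : H ⊗[k] H)

/-- The action of the reordered product `b c` on `v`. -/
theorem extend_cross (hR : IsQuasitriangular R) (hB : IsBraidedBialgebra R β)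
    (hC : IsBraidedBialgebra R γ) (S : C ≃ₗ[k] C) (hev : IsDualPairing β γ ev)
    {t : Actions k H B C V} (hH : IsRightAction (LinearMap.mul k H) 1 t.actH)
    (hBe : IsEquivariant₂ t.actH β t.actH t.actB) (v : V) (b : B) (c : C) :
    t.extend v (cross R β γ S ev (b ⊗ₜ c)) =
      twistBar R γ (pairAct t.actH γ ev (R : H ⊗[k] H) ∘ₗ S.symm.toLinearMap)
        (t.crossRight R β ev v) c b := by
  have e₁ : act₂ (actBar γ) (actBar γ) (R : H ⊗[k] H) ∘ₗ comulBar R γ = Coalgebra.comul :=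
    LinearMap.ext fun c => actBar_comulBar hR hC c
  have e₂ : ∀ (z : C ⊗[k] C),
      t.extend v (contract H ev (TensorProduct.assoc k C C (H ⊗[k] C)
        (TensorProduct.map Coalgebra.comul (coactBar R γ ∘ₗ S.symm.toLinearMap) z) ⊗ₜ
        TensorProduct.assoc k B H (B ⊗[k] B) (TensorProduct.map (coact R β)
          (act₂ β.flip β.flip ((R⁻¹ : (H ⊗[k] H)ˣ) : H ⊗[k] H))
            (TensorProduct.assoc k B B B (Coalgebra.comul.rTensor B (Coalgebra.comul b)))))) =
      TensorProduct.lift ((pairAct t.actH γ ev (R : H ⊗[k] H) ∘ₗ S.symm.toLinearMap).flip ∘ₗ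
        t.crossRight R β ev v) z b := by
    intro z
    induction z with
    | zero => simp
    | add x y hx hy =>
      simp only [map_add, TensorProduct.add_tmul, LinearMap.add_apply, hx, hy]
    | tmul c₁ c₂ =>
      rw [TensorProduct.lift.tmul, LinearMap.comp_apply, LinearMap.flip_apply,
        LinearMap.comp_apply, pairAct_apply]
      generalize (Coalgebra.comul b : B ⊗[k] B) = s
      induction s with
      | zero => simp
      | add x y hx hy => simp only [map_add, TensorProduct.tmul_add, hx, hy]
      | tmul b₁ b₂ =>
        rw [TensorProduct.map_tmul, LinearMap.rTensor_tmul, LinearMap.comp_apply,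
          extend_contract hR hB hC hev hH hBe]
        simp [crossRight_apply]
  -- Coassociativity rebrackets the legs of `b` as `(b₁ ⊗ b₂) ⊗ b₃`, since the first two belong to
  -- `crossRight`.
  have e₃ : TensorProduct.map (coact R β)
      (act₂ β.flip β.flip ((R⁻¹ : (H ⊗[k] H)ˣ) : H ⊗[k] H) ∘ₗ Coalgebra.comul)
        (Coalgebra.comul b) = TensorProduct.map (coact R β)
          (act₂ β.flip β.flip ((R⁻¹ : (H ⊗[k] H)ˣ) : H ⊗[k] H))
            (TensorProduct.assoc k B B B (Coalgebra.comul.rTensor B (Coalgebra.comul b))) := by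
    rw [Coalgebra.coassoc_apply, ← LinearMap.comp_apply (TensorProduct.map _ _) (LinearMap.lTensor _ _),
      LinearMap.map_comp_lTensor]
  rw [twistBar, LinearMap.comp_apply, ← e₂, ← e₃]
  simp [cross, e₁]

/-- The compatibility condition amounts to the reordering of `b c`. -/
theorem compatible_iff (hR : IsQuasitriangular R) (hB : IsBraidedBialgebra R β)
    (hC : IsBraidedBialgebra R γ) {S : C ≃ₗ[k] C} (hS : IsBraidedAntipode γ S.toLinearMap)
    (hev : IsDualPairing β γ ev)
    {t : Actions k H B C V} (hH : IsRightAction (LinearMap.mul k H) 1 t.actH)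
    (hBe : IsEquivariant₂ t.actH β t.actH t.actB)
    (hCe : IsEquivariant₂ γ t.actH t.actH t.actC) (v : V) :
    (∀ c b, TensorProduct.rid k V (TensorProduct.map (TensorProduct.lift t.actC)
      (TensorProduct.lift ev) (midBraiding C B R γ t.actH
        (Coalgebra.comul c ⊗ₜ[k] (t.actB v).rTensor B (Coalgebra.comul b)))) =
      TensorProduct.lid k V (TensorProduct.map (TensorProduct.lift ev) (TensorProduct.lift t.actB)
        (midBraiding C B R t.actH β
          ((t.actC.flip v).lTensor C (Coalgebra.comul c) ⊗ₜ[k] Coalgebra.comul b)))) ↔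
    ∀ c b, t.actC c (t.actB v b) = t.extend v (cross R β γ S ev (b ⊗ₜ c)) := by
  have e : ∀ c b, TensorProduct.lid k V (TensorProduct.map (TensorProduct.lift ev)
      (TensorProduct.lift t.actB) (midBraiding C B R t.actH β
        ((t.actC.flip v).lTensor C (Coalgebra.comul c) ⊗ₜ[k] Coalgebra.comul b))) =
      t.crossRight R β ev v c b := fun c b => by
    rw [crossRight_apply]
    rfl
  -- The twists by `id` and by `S⁻¹` are inverse in both orders; each order gives one direction of
  -- the equivalence.
  have e₁ := twistBar_twistBar (V := V) hR hH hC hev S.symm.toLinearMap LinearMap.id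
    (symm_mul_comulBar hR hC hS) (t.actBC v)
  have e₂ := twistBar_twistBar (V := V) hR hH hC hev LinearMap.id S.symm.toLinearMap
    (mul_symm_comulBar hR hC hS) (t.crossRight R β ev v)
  rw [LinearMap.comp_id] at e₁ e₂
  constructor
  · intro h c b
    have h' : twistBar R γ (pairAct t.actH γ ev (R : H ⊗[k] H)) (t.actBC v) =
        t.crossRight R β ev v := by
      ext c b
      rw [← compatible_left_eq hR hC hH hCe, h, e]
    rw [extend_cross hR hB hC S hev hH hBe, ← h', e₁]
    rfl
  · intro h c b
    have h' : t.actBC v = twistBar R γ (pairAct t.actH γ ev (R : H ⊗[k] H) ∘ₗ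
        S.symm.toLinearMap) (t.crossRight R β ev v) := by
      ext c b
      rw [← extend_cross hR hB hC S hev hH hBe, ← h]
      rfl
    rw [compatible_left_eq hR hC hH hCe, e, h', e₂]

end Actions

end Cross

/-! ### Units in the reordering and in the product of `U`. -/

section Product

variable {k : Type*} [Field k] {H : Type*} [Ring H] [HopfAlgebra k H]
  {B : Type*} [Ring B] [Algebra k B] [Coalgebra k B]
  {C : Type*} [Ring C] [Algebra k C] [Coalgebra k C]
  {V : Type*} [AddCommGroup V] [Module k V]
  {R : (H ⊗[k] H)ˣ} {β : B →ₗ[k] H →ₗ[k] B} {γ : C →ₗ[k] H →ₗ[k] C} {ev : C →ₗ[k] B →ₗ[k] k}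

theorem act₂_inv_one_tmul_one (hR : IsQuasitriangular R) (hC : IsBraidedBialgebra R γ) :
    act₂ γ.flip γ.flip ((R⁻¹ : (H ⊗[k] H)ˣ) : H ⊗[k] H) ((1 : C) ⊗ₜ (1 : C)) = 1 ⊗ₜ 1 := by
  have e : ∀ X : H ⊗[k] H, act₂ γ.flip γ.flip X ((1 : C) ⊗ₜ (1 : C)) =
      Coalgebra.counit (R := k) (counitLeft k H X) • (1 ⊗ₜ 1) := by
    intro X
    induction X with
    | zero => simp
    | add x y hx hy => simp only [map_add, LinearMap.add_apply, add_smul, hx, hy]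
    | tmul a b =>
      simp [hC.isModuleAlgebra.one_act, TensorProduct.smul_tmul', smul_smul, mul_comm]
  rw [e, map_inv_eq_one _ _ hR.counitLeft_eq_one]
  simp

theorem comulBar_one (hR : IsQuasitriangular R) (hC : IsBraidedBialgebra R γ) :
    comulBar R γ (1 : C) = 1 ⊗ₜ 1 := by
  rw [comulBar, LinearMap.comp_apply, hC.comul_one, act₂_inv_one_tmul_one hR hC]

theorem coactBar_one (hR : IsQuasitriangular R) (hC : IsBraidedBialgebra R γ) :
    coactBar R γ (1 : C) = 1 ⊗ₜ 1 := by
  have e : ∀ X : H ⊗[k] H, act₂ (LinearMap.mul k H) γ.flip X (1 ⊗ₜ (1 : C)) =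
      counitRight k H X ⊗ₜ 1 := by
    intro X
    induction X with
    | zero => simp
    | add x y hx hy => simp only [map_add, LinearMap.add_apply, TensorProduct.add_tmul, hx, hy]
    | tmul a b => simp [hC.isModuleAlgebra.one_act, TensorProduct.smul_tmul']
  rw [coactBar_apply hR, e, hR.counitRight_eq_one]

theorem coact_one (hR : IsQuasitriangular R) (hB : IsBraidedBialgebra R β) :
    coact R β (1 : B) = 1 ⊗ₜ 1 := by
  have e : ∀ X : H ⊗[k] H, act₂ β.flip (LinearMap.mul k H) X ((1 : B) ⊗ₜ 1) =
      1 ⊗ₜ counitLeft k H X := by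
    intro X
    induction X with
    | zero => simp
    | add x y hx hy => simp only [map_add, LinearMap.add_apply, TensorProduct.tmul_add, hx, hy]
    | tmul a b => simp [hB.isModuleAlgebra.one_act, TensorProduct.smul_tmul']
  rw [coact, LinearMap.comp_apply, LinearMap.flip_apply, TensorProduct.mk_apply, e,
    hR.counitLeft_eq_one]

/-- Apply `ε` to the antipode axiom `S(c₁) c₂ = ε(c) 1`. It is needed for `S⁻¹`, whose value on the
last leg is paired with `1` when `1 c` is reordered. -/
theorem IsBraidedAntipode.counit_map {S : C →ₗ[k] C} (hC : IsBraidedBialgebra R γ)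
    (hS : IsBraidedAntipode γ S) (c : C) :
    Coalgebra.counit (R := k) (S c) = Coalgebra.counit (R := k) c := by
  have e : ∀ t : C ⊗[k] C, Coalgebra.counit (R := k) (LinearMap.mul' k C (S.rTensor C t)) =
      Coalgebra.counit (R := k) (S (TensorProduct.rid k C (Coalgebra.counit.lTensor C t))) := by
    intro t
    induction t with
    | zero => simp
    | add x y hx hy => simp only [map_add, hx, hy]
    | tmul a b => simp [hC.counit_mul, mul_comm]
  have h := e (Coalgebra.comul c)
  rw [hS.mul_antipode_rTensor_comul, Coalgebra.lTensor_counit_comul] at h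
  simpa [Algebra.algebraMap_eq_smul_one, hC.counit_one] using h.symm

/-- The reordering of `b 1` is `b`. -/
theorem cross_tmul_one (hR : IsQuasitriangular R) (hB : IsBraidedBialgebra R β)
    (hC : IsBraidedBialgebra R γ) {S : C ≃ₗ[k] C} (hS : IsBraidedAntipode γ S.toLinearMap)
    (hev : IsDualPairing β γ ev) (b : B) :
    cross R β γ S ev (b ⊗ₜ 1) = 1 ⊗ₜ (1 ⊗ₜ b) := by
  have b1 : ∀ b, β b 1 = b := hB.isAntiAction.map_one
  have S1 : S.symm 1 = 1 := by
    rw [LinearEquiv.symm_apply_eq]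
    exact (hS.map_one hC).symm
  -- With every `C`-leg equal to `1`, both pairings become counits of `B`; these turn the elements
  -- `X` and `Y` into their one-sided counits.
  have e₁ : ∀ (X Y : H ⊗[k] H) (b' : B) (w : B ⊗[k] B),
      contract H ev (((1 : C) ⊗ₜ ((1 : C) ⊗ₜ ((1 : H) ⊗ₜ (1 : C)))) ⊗ₜ
        TensorProduct.assoc k B H (B ⊗[k] B) (act₂ β.flip (LinearMap.mul k H) X (b' ⊗ₜ 1) ⊗ₜ
          act₂ β.flip β.flip Y w)) =
      Coalgebra.counit (R := k) b' • ((1 : C) ⊗ₜ (counitLeft k H X ⊗ₜ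
        β (TensorProduct.rid k B (Coalgebra.counit.lTensor B w)) (counitRight k H Y))) := by
    intro X Y b' w
    induction w with
    | zero => simp
    | add x y hx hy =>
      simp only [map_add, TensorProduct.tmul_add, LinearMap.add_apply, smul_add, hx, hy]
    | tmul b₂ b₃ =>
    induction X with
    | zero => simp
    | add x y hx hy =>
      simp only [map_add, TensorProduct.tmul_add, TensorProduct.add_tmul, LinearMap.add_apply,
        smul_add, hx, hy]
    | tmul p q =>
    induction Y with
    | zero => simp
    | add x y hx hy =>
      simp only [map_add, TensorProduct.tmul_add, LinearMap.add_apply, smul_add, hx, hy]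
    | tmul e f =>
      simp only [act₂_tmul, TensorProduct.assoc_tmul, contract_tmul, hev.one_left,
        LinearMap.flip_apply, hB.counit_act, LinearMap.lTensor_tmul, TensorProduct.rid_tmul,
        counitLeft_tmul, counitRight_tmul, map_smul, LinearMap.smul_apply, LinearMap.mul_apply',
        mul_one, TensorProduct.tmul_smul, ← TensorProduct.smul_tmul', smul_smul]
      congr 1
      ring
  have e₂ : ∀ t : B ⊗[k] B,
      contract H ev (((1 : C) ⊗ₜ ((1 : C) ⊗ₜ ((1 : H) ⊗ₜ (1 : C)))) ⊗ₜ
        TensorProduct.assoc k B H (B ⊗[k] B) (TensorProduct.map (coact R β)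
          (act₂ β.flip β.flip ((R⁻¹ : (H ⊗[k] H)ˣ) : H ⊗[k] H) ∘ₗ Coalgebra.comul) t)) =
      1 ⊗ₜ (1 ⊗ₜ TensorProduct.lid k B (Coalgebra.counit.rTensor B t)) := by
    intro t
    induction t with
    | zero => simp
    | add x y hx hy => simp only [map_add, TensorProduct.tmul_add, hx, hy]
    | tmul b₁ b₂ =>
      have := e₁ (R : H ⊗[k] H) ((R⁻¹ : (H ⊗[k] H)ˣ) : H ⊗[k] H) b₁ (Coalgebra.comul b₂)
      rw [hR.counitLeft_eq_one, map_inv_eq_one _ _ hR.counitRight_eq_one,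
        Coalgebra.lTensor_counit_comul] at this
      simpa [coact, b1] using this
  have := e₂ (Coalgebra.comul b)
  rw [Coalgebra.rTensor_counit_comul] at this
  have e₃ : act₂ (actBar γ) (actBar γ) (R : H ⊗[k] H) (1 ⊗ₜ 1) = 1 ⊗ₜ[k] 1 := by
    have := actBar_comulBar hR hC 1
    rwa [comulBar_one hR hC, hC.comul_one] at this
  simpa [cross, comulBar_one hR hC, e₃, coactBar_one hR hC, S1] using this

/-- The reordering of `1 c` is `c`. -/
theorem cross_one_tmul (hR : IsQuasitriangular R) (hB : IsBraidedBialgebra R β)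
    (hC : IsBraidedBialgebra R γ) {S : C ≃ₗ[k] C} (hS : IsBraidedAntipode γ S.toLinearMap)
    (hev : IsDualPairing β γ ev) (c : C) :
    cross R β γ S ev (1 ⊗ₜ c) = c ⊗ₜ (1 ⊗ₜ 1) := by
  have hSε : ∀ c, Coalgebra.counit (R := k) (S.symm c) = Coalgebra.counit (R := k) c := by
    intro c
    have := hS.counit_map hC (S.symm c)
    simpa using this.symm
  have e₁ : ∀ (X : H ⊗[k] H) (u : C ⊗[k] C) (z : C),
      contract H ev (TensorProduct.assoc k C C (H ⊗[k] C) (u ⊗ₜ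
        act₂ (LinearMap.mul k H) γ.flip X (1 ⊗ₜ z)) ⊗ₜ
        ((1 : B) ⊗ₜ ((1 : H) ⊗ₜ ((1 : B) ⊗ₜ (1 : B))))) =
      Coalgebra.counit (R := k) z • (TensorProduct.lid k C (Coalgebra.counit.rTensor C u) ⊗ₜ
        (counitRight k H X ⊗ₜ 1)) := by
    intro X u z
    induction u with
    | zero => simp
    | add x y hx hy =>
      simp only [map_add, TensorProduct.add_tmul, smul_add, hx, hy]
    | tmul x y =>
    induction X with
    | zero => simp
    | add x y hx hy =>
      simp only [map_add, TensorProduct.tmul_add, TensorProduct.add_tmul, LinearMap.add_apply,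
        smul_add, hx, hy]
    | tmul p q =>
      simp only [act₂_tmul, TensorProduct.assoc_tmul, contract_tmul, hev.one_right,
        LinearMap.flip_apply, hC.counit_act, LinearMap.rTensor_tmul, TensorProduct.lid_tmul,
        counitRight_tmul, LinearMap.mul_apply', one_mul, mul_one, TensorProduct.tmul_smul, ← TensorProduct.smul_tmul', smul_smul]
      congr 1
      ring
  have e₂ : ∀ t : C ⊗[k] C,
      contract H ev (TensorProduct.assoc k C C (H ⊗[k] C) (TensorProduct.map Coalgebra.comul
        (coactBar R γ ∘ₗ S.symm.toLinearMap) t) ⊗ₜ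
        ((1 : B) ⊗ₜ ((1 : H) ⊗ₜ ((1 : B) ⊗ₜ (1 : B))))) =
      TensorProduct.rid k C (Coalgebra.counit.lTensor C t) ⊗ₜ (1 ⊗ₜ 1) := by
    intro t
    induction t with
    | zero => simp
    | add x y hx hy => simp only [map_add, TensorProduct.add_tmul, hx, hy]
    | tmul c₁ c₂ =>
      have := e₁ (R : H ⊗[k] H) (Coalgebra.comul c₁) (S.symm c₂)
      rw [hR.counitRight_eq_one, Coalgebra.rTensor_counit_comul, hSε,
        ← coactBar_apply hR] at this
      simpa [TensorProduct.smul_tmul'] using this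
  have e₃ : act₂ (actBar γ) (actBar γ) (R : H ⊗[k] H) ∘ₗ comulBar R γ = Coalgebra.comul :=
    LinearMap.ext fun c => actBar_comulBar hR hC c
  -- The counit law needed here is that of `C̄`, because the outer coproduct of `cross` is the one
  -- of `C̄`.
  have e₄ : Coalgebra.counit.lTensor C (comulBar R γ c) = c ⊗ₜ[k] (1 : k) :=
    @Coalgebra.lTensor_counit_comul k C _ _ _ (barCoalgebra hR hC) c
  have := e₂ (comulBar R γ c)
  rw [e₄] at this
  simpa [cross, e₃, hB.comul_one, coact_one hR hB, act₂_inv_one_tmul_one hR hB] using this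

theorem leftC_tmul (c d : C) (x : H ⊗[k] B) : leftC k H B C c (d ⊗ₜ x) = (d * c) ⊗ₜ x := by
  simp [leftC, mulBar]

theorem rightB_tmul (a b : B) (c : C) (h : H) :
    rightB k H B C a (c ⊗ₜ (h ⊗ₜ b)) = c ⊗ₜ (h ⊗ₜ (b * a)) := by
  simp [rightB]

theorem leftC_one (x : C ⊗[k] (H ⊗[k] B)) : leftC k H B C 1 x = x := by
  induction x with
  | zero => simp
  | add x y hx hy => simp only [map_add, hx, hy]
  | tmul d y => simp [leftC_tmul]

theorem rightB_one (x : C ⊗[k] (H ⊗[k] B)) : rightB k H B C 1 x = x := by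
  have : (LinearMap.mul k B).flip 1 = LinearMap.id := by ext; simp
  simp [rightB, this]

theorem leftH_one (hC : IsBraidedBialgebra R γ) (x : C ⊗[k] (H ⊗[k] B)) :
    leftH B γ 1 x = x := by
  have h1 : ∀ c, γ c 1 = c := hC.isAntiAction.map_one
  have : LinearMap.mul k H 1 = LinearMap.id := by ext; simp
  induction x with
  | zero => simp
  | add x y hx hy => simp only [map_add, hx, hy]
  | tmul d y =>
    simp [leftH, Bialgebra.comul_one, Algebra.TensorProduct.one_def, actBar,
      HopfAlgebra.antipode_one, h1, this]

end Product

/-! ### Modules over `U` and compatible triples of actions. -/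

section Modules

variable {k : Type*} [Field k] {H : Type*} [Ring H] [HopfAlgebra k H]
  {B : Type*} [Ring B] [Algebra k B] [Coalgebra k B]
  {C : Type*} [Ring C] [Algebra k C] [Coalgebra k C]
  {V : Type*} [AddCommGroup V] [Module k V]
  {R : (H ⊗[k] H)ˣ} {β : B →ₗ[k] H →ₗ[k] B} {γ : C →ₗ[k] H →ₗ[k] C} {ev : C →ₗ[k] B →ₗ[k] k}

theorem rightH_one_tmul_tmul_one (hB : IsBraidedBialgebra R β) (c : C) (g h : H) :
    rightH C β g (c ⊗ₜ (h ⊗ₜ (1 : B))) = c ⊗ₜ ((h * g) ⊗ₜ 1) := by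
  have e : ∀ X : H ⊗[k] H, act₂ (LinearMap.mul k H).flip β.flip X (h ⊗ₜ (1 : B)) =
      (h * counitRight k H X) ⊗ₜ 1 := by
    intro X
    induction X with
    | zero => simp
    | add x y hx hy =>
      simp only [map_add, LinearMap.add_apply, mul_add, TensorProduct.add_tmul, hx, hy]
    | tmul a b => simp [hB.isModuleAlgebra.one_act, TensorProduct.smul_tmul']
  have e' : counitRight k H (Coalgebra.comul g) = g := by
    have h : ∀ t : H ⊗[k] H, counitRight k H t =
        TensorProduct.rid k H (Coalgebra.counit.lTensor H t) := by
      intro t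
      induction t with
      | zero => simp
      | add x y hx hy => simp only [map_add, hx, hy]
      | tmul x y => simp
    simp [h]
  simp [rightH, e, e']

theorem leftH_one_tmul (hC : IsBraidedBialgebra R γ) (h g : H) (b : B) :
    leftH B γ h ((1 : C) ⊗ₜ (g ⊗ₜ b)) = 1 ⊗ₜ ((h * g) ⊗ₜ b) := by
  have e : ∀ X : H ⊗[k] H, act₂ (actBar γ) (LinearMap.rTensorHom B ∘ₗ LinearMap.mul k H) X
      ((1 : C) ⊗ₜ (g ⊗ₜ b)) = 1 ⊗ₜ ((counitLeft k H X * g) ⊗ₜ b) := by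
    intro X
    induction X with
    | zero => simp
    | add x y hx hy =>
      simp only [map_add, LinearMap.add_apply, add_mul, TensorProduct.add_tmul,
        TensorProduct.tmul_add, hx, hy]
    | tmul p q =>
      simp [actBar, hC.isModuleAlgebra.one_act, ← TensorProduct.smul_tmul',
        TensorProduct.tmul_smul]
  have e' : counitLeft k H (Coalgebra.comul h) = h := by
    have h' : ∀ t : H ⊗[k] H, counitLeft k H t =
        TensorProduct.lid k H (Coalgebra.counit.rTensor H t) := by
      intro t
      induction t with
      | zero => simp
      | add x y hx hy => simp only [map_add, hx, hy]
      | tmul x y => simp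
    simp [h']
  simp [leftH, e, e']

/-- `(c ⊗ h ⊗ 1) (1 ⊗ g ⊗ b) = c ⊗ h g ⊗ b`. -/
theorem mulU_tmul_one_one_tmul (hR : IsQuasitriangular R) (hB : IsBraidedBialgebra R β)
    (hC : IsBraidedBialgebra R γ) {S : C ≃ₗ[k] C} (hS : IsBraidedAntipode γ S.toLinearMap)
    (hev : IsDualPairing β γ ev) (c : C) (h g : H) (b : B) :
    mulU R β γ S ev (c ⊗ₜ (h ⊗ₜ 1)) (1 ⊗ₜ (g ⊗ₜ b)) = c ⊗ₜ ((h * g) ⊗ₜ b) := by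
  rw [mulU_tmul, cross_tmul_one hR hB hC hS hev, rightH_one_tmul_tmul_one hB, rightB_tmul,
    leftH_one_tmul hC, leftC_tmul, one_mul, one_mul, one_mul]

theorem mulU_inclB (hR : IsQuasitriangular R) (hB : IsBraidedBialgebra R β)
    (hC : IsBraidedBialgebra R γ) {S : C ≃ₗ[k] C} (hS : IsBraidedAntipode γ S.toLinearMap)
    (hev : IsDualPairing β γ ev) (b a : B) (g : H) :
    mulU R β γ S ev (1 ⊗ₜ (1 ⊗ₜ b)) (1 ⊗ₜ (g ⊗ₜ a)) =
      rightB k H B C a (rightH C β g (1 ⊗ₜ (1 ⊗ₜ b))) := by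
  rw [mulU_tmul, cross_tmul_one hR hB hC hS hev, leftH_one hC, leftC_one]

theorem rightH_one (hB : IsBraidedBialgebra R β) (x : C ⊗[k] (H ⊗[k] B)) :
    rightH C β 1 x = x := by
  have h1 : ∀ b, β b 1 = b := hB.isAntiAction.map_one
  induction x with
  | zero => simp
  | add x y hx hy => simp only [map_add, hx, hy]
  | tmul d y =>
    induction y with
    | zero => simp
    | add x y hx hy => simp only [map_add, TensorProduct.tmul_add, hx, hy]
    | tmul h b => simp [rightH, Bialgebra.comul_one, Algebra.TensorProduct.one_def, h1]

theorem mulU_tmul_inclC (hR : IsQuasitriangular R) (hB : IsBraidedBialgebra R β)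
    (hC : IsBraidedBialgebra R γ) {S : C ≃ₗ[k] C} (hS : IsBraidedAntipode γ S.toLinearMap)
    (hev : IsDualPairing β γ ev) (c d : C) (h : H) :
    mulU R β γ S ev (c ⊗ₜ (h ⊗ₜ 1)) (d ⊗ₜ (1 ⊗ₜ 1)) =
      leftC k H B C c (leftH B γ h (d ⊗ₜ (1 ⊗ₜ 1))) := by
  rw [mulU_tmul, cross_one_tmul hR hB hC hS hev, rightH_one hB, rightB_one]

theorem mulU_inclB_inclC (hB : IsBraidedBialgebra R β) (hC : IsBraidedBialgebra R γ)
    (S : C ≃ₗ[k] C) (b : B) (c : C) :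
    mulU R β γ S ev (1 ⊗ₜ (1 ⊗ₜ b)) (c ⊗ₜ (1 ⊗ₜ 1)) = cross R β γ S ev (b ⊗ₜ c) := by
  rw [mulU_tmul, rightH_one hB, rightB_one, leftH_one hC, leftC_one]

namespace Actions

variable {t : Actions k H B C V}

/-- Equivariance of the action of `C` in terms of the relation `h c = (h₁ ▷ c) h₂` of `U`. -/
theorem equivariant_actC_iff (hC : IsBraidedBialgebra R γ) :
    IsEquivariant₂ γ t.actH t.actH t.actC ↔ ∀ c v h, t.actC c (t.actH v h) =
      TensorProduct.lift (t.actH ∘ₗ t.actC.flip v ∘ₗ γ c)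
        ((HopfAlgebra.antipode k).rTensor H (Coalgebra.comul h)) := by
  have h1 : ∀ c, γ c 1 = c := hC.isAntiAction.map_one
  have hm : ∀ a b c, γ c (a * b) = γ (γ c a) b := hC.isAntiAction.map_mul
  constructor
  · intro hE c v h
    -- On `h₁ ⊗ h₂ ⊗ h₃` the value is `(c ◁ S(h₁) h₂) ▷ (v ◁ h₃)`: the first pair contracts by the
    -- antipode axiom, the last by equivariance.
    let N : H ⊗[k] (H ⊗[k] H) →ₗ[k] V := TensorProduct.lift t.actC ∘ₗ
      TensorProduct.map (γ c ∘ₗ LinearMap.mul' k H ∘ₗ (HopfAlgebra.antipode k).rTensor H)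
        (t.actH v) ∘ₗ (TensorProduct.assoc k H H H).symm.toLinearMap
    have e₁ : ∀ s : H ⊗[k] H, TensorProduct.lift (t.actH ∘ₗ t.actC.flip v ∘ₗ γ c)
        ((HopfAlgebra.antipode k).rTensor H s) = N (Coalgebra.comul.lTensor H s) := by
      intro s
      induction s with
      | zero => simp
      | add x y hx hy => simp only [map_add, hx, hy]
      | tmul p q =>
        have e₂ : ∀ X : H ⊗[k] H, TensorProduct.lift t.actC
            (TensorProduct.map (γ (γ c (HopfAlgebra.antipode k p))) (t.actH v) X) =
            N (p ⊗ₜ X) := by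
          intro X
          induction X with
          | zero => simp
          | add x y hx hy => simp only [map_add, TensorProduct.tmul_add, hx, hy]
          | tmul x y => simp [N, hm]
        rw [LinearMap.lTensor_tmul, ← e₂, ← hE]
        simp
    have e₃ : ∀ s : H ⊗[k] H, N (TensorProduct.assoc k H H H (Coalgebra.comul.rTensor H s)) =
        t.actC c (t.actH v (TensorProduct.lid k H (Coalgebra.counit.rTensor H s))) := by
      intro s
      induction s with
      | zero => simp
      | add x y hx hy => simp only [map_add, hx, hy]
      | tmul p q => simp [N, Algebra.algebraMap_eq_smul_one, h1]
    rw [e₁, ← Coalgebra.coassoc_apply, e₃, Coalgebra.rTensor_counit_comul]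
    simp
  · intro hE c v h
    -- On `h₁ ⊗ h₂ ⊗ h₃` the value is `((c ◁ h₁ S(h₂)) ▷ v) ◁ h₃`: the first pair contracts by the
    -- antipode axiom, the last by the assumed relation.
    let N : H ⊗[k] (H ⊗[k] H) →ₗ[k] V :=
      TensorProduct.lift (t.actH ∘ₗ t.actC.flip v ∘ₗ γ c ∘ₗ LinearMap.mul' k H ∘ₗ
        (HopfAlgebra.antipode k).lTensor H) ∘ₗ (TensorProduct.assoc k H H H).symm.toLinearMap
    have e₁ : ∀ s : H ⊗[k] H, TensorProduct.lift t.actC (TensorProduct.map (γ c) (t.actH v) s) =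
        N (Coalgebra.comul.lTensor H s) := by
      intro s
      induction s with
      | zero => simp
      | add x y hx hy => simp only [map_add, hx, hy]
      | tmul p q =>
        have e₂ : ∀ X : H ⊗[k] H, TensorProduct.lift (t.actH ∘ₗ t.actC.flip v ∘ₗ γ (γ c p))
            ((HopfAlgebra.antipode k).rTensor H X) = N (p ⊗ₜ X) := by
          intro X
          induction X with
          | zero => simp
          | add x y hx hy => simp only [map_add, TensorProduct.tmul_add, hx, hy]
          | tmul x y => simp [N, hm]
        rw [LinearMap.lTensor_tmul, ← e₂, ← hE]
        simp
    have e₃ : ∀ s : H ⊗[k] H, N (TensorProduct.assoc k H H H (Coalgebra.comul.rTensor H s)) =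
        t.actH (t.actC c v) (TensorProduct.lid k H (Coalgebra.counit.rTensor H s)) := by
      intro s
      induction s with
      | zero => simp
      | add x y hx hy => simp only [map_add, hx, hy]
      | tmul p q => simp [N, Algebra.algebraMap_eq_smul_one, h1]
    rw [e₁, ← Coalgebra.coassoc_apply, e₃, Coalgebra.rTensor_counit_comul]
    simp

/-- In a right action the left factor of a product acts first, so left multiplications act on `v`
and right multiplications on the result. The opposite product of `C̄` is what makes a left action of
`C` a right action of `C̄`. -/
theorem extend_leftC (hC : IsLeftAction (LinearMap.mul k C) 1 t.actC) (v : V) (c : C)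
    (x : C ⊗[k] (H ⊗[k] B)) : t.extend v (leftC k H B C c x) = t.extend (t.actC c v) x := by
  have hm : ∀ a b v, t.actC (a * b) v = t.actC a (t.actC b v) := hC.mul_act
  induction x with
  | zero => simp
  | add x y hx hy => simp only [map_add, hx, hy]
  | tmul d y =>
    induction y with
    | zero => simp
    | add x y hx hy => simp only [map_add, TensorProduct.tmul_add, hx, hy]
    | tmul h b => simp [leftC_tmul, hm]

theorem extend_rightB (hB : IsRightAction (LinearMap.mul k B) 1 t.actB) (v : V) (b : B)
    (x : C ⊗[k] (H ⊗[k] B)) : t.extend v (rightB k H B C b x) = t.actB (t.extend v x) b := by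
  have hm : ∀ v a b, t.actB v (a * b) = t.actB (t.actB v a) b := hB.act_mul
  induction x with
  | zero => simp
  | add x y hx hy => simp only [map_add, LinearMap.add_apply, hx, hy]
  | tmul d y =>
    induction y with
    | zero => simp
    | add x y hx hy => simp only [map_add, TensorProduct.tmul_add, LinearMap.add_apply, hx, hy]
    | tmul h b => simp [rightB_tmul, hm]

/-- Only the action axioms of `H` are assumed, so that this also applies to the restriction of an
action of `U`, where equivariance is still to be proved. -/
theorem extend_act₂_left (hH : IsRightAction (LinearMap.mul k H) 1 t.actH) (v : V) (X : H ⊗[k] H)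
    (c : C) (g : H) (b : B) :
    t.extend v (act₂ (actBar γ) (LinearMap.rTensorHom B ∘ₗ LinearMap.mul k H) X
      (c ⊗ₜ (g ⊗ₜ b))) = t.actB (t.actH (TensorProduct.lift (t.actH ∘ₗ t.actC.flip v ∘ₗ γ c)
        ((HopfAlgebra.antipode k).rTensor H X)) g) b := by
  have hm : ∀ v a b, t.actH v (a * b) = t.actH (t.actH v a) b := hH.act_mul
  induction X with
  | zero => simp
  | add x y hx hy => simp only [map_add, LinearMap.add_apply, hx, hy]
  | tmul p q => simp [actBar, hm]

theorem extend_act₂_right (hH : IsRightAction (LinearMap.mul k H) 1 t.actH) (v : V) (X : H ⊗[k] H)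
    (c : C) (h : H) (b : B) :
    t.extend v (c ⊗ₜ act₂ (LinearMap.mul k H).flip β.flip X (h ⊗ₜ b)) =
      TensorProduct.lift t.actB (TensorProduct.map (t.actH (t.actH (t.actC c v) h)) (β b) X) := by
  have hm : ∀ v a b, t.actH v (a * b) = t.actH (t.actH v a) b := hH.act_mul
  induction X with
  | zero => simp
  | add x y hx hy =>
    simp only [map_add, LinearMap.add_apply, TensorProduct.tmul_add, hx, hy]
  | tmul p q => simp [hm]

theorem extend_leftH (hC : IsBraidedBialgebra R γ)
    (hH : IsRightAction (LinearMap.mul k H) 1 t.actH)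
    (hCe : IsEquivariant₂ γ t.actH t.actH t.actC) (v : V) (h : H)
    (x : C ⊗[k] (H ⊗[k] B)) : t.extend v (leftH B γ h x) = t.extend (t.actH v h) x := by
  induction x with
  | zero => simp
  | add x y hx hy => simp only [map_add, hx, hy]
  | tmul d y =>
    induction y with
    | zero => simp
    | add x y hx hy => simp only [map_add, TensorProduct.tmul_add, hx, hy]
    | tmul g b =>
      rw [leftH, LinearMap.comp_apply, extend_act₂_left hH, ← (equivariant_actC_iff hC).1 hCe,
        extend_tmul]

theorem extend_rightH (hH : IsRightAction (LinearMap.mul k H) 1 t.actH)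
    (hBe : IsEquivariant₂ t.actH β t.actH t.actB) (v : V) (g : H)
    (x : C ⊗[k] (H ⊗[k] B)) : t.extend v (rightH C β g x) = t.actH (t.extend v x) g := by
  induction x with
  | zero => simp
  | add x y hx hy => simp only [map_add, LinearMap.add_apply, hx, hy]
  | tmul d y =>
    induction y with
    | zero => simp
    | add x y hx hy => simp only [map_add, TensorProduct.tmul_add, LinearMap.add_apply, hx, hy]
    | tmul h b =>
      rw [rightH, LinearMap.comp_apply, LinearMap.comp_apply, LinearMap.coe_lTensorHom,
        LinearMap.lTensor_tmul, extend_act₂_right hH, extend_tmul, hBe]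

/-- Compatible actions extend to an action of `U`. -/
theorem IsCrossed.isRightAction_extend (hR : IsQuasitriangular R) (hB : IsBraidedBialgebra R β)
    (hC : IsBraidedBialgebra R γ) {S : C ≃ₗ[k] C} (hS : IsBraidedAntipode γ S.toLinearMap)
    (hev : IsDualPairing β γ ev) (ht : t.IsCrossed R β γ ev) :
    IsRightAction (mulU R β γ S ev) (oneU k H B C) t.extend where
  act_one v := by
    simp [oneU, ht.isLeftAction_C.one_act, ht.isRightAction_H.act_one, ht.isRightAction_B.act_one]
  act_mul v x y := by
    have key := (compatible_iff hR hB hC hS hev ht.isRightAction_H ht.equivariant_B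
      ht.equivariant_C)
    induction x with
    | zero => simp
    | add x y hx hy => simp only [map_add, LinearMap.add_apply, hx, hy]
    | tmul c x =>
    induction x with
    | zero => simp
    | add x y hx hy => simp only [map_add, TensorProduct.tmul_add, LinearMap.add_apply, hx, hy]
    | tmul h b =>
    induction y with
    | zero => simp
    | add x y hx hy => simp only [map_add, hx, hy]
    | tmul d y =>
    induction y with
    | zero => simp
    | add x y hx hy => simp only [map_add, TensorProduct.tmul_add, hx, hy]
    | tmul g a =>
      -- Once the outer factors are peeled off, what is left is the reordering of `b d` acting on
      -- `(c ▷ v) ◁ h`, which `key` identifies with `d ▷ (((c ▷ v) ◁ h) ◁ b)`.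
      rw [mulU_tmul, extend_leftC ht.isLeftAction_C,
        extend_leftH hC ht.isRightAction_H ht.equivariant_C, extend_rightB ht.isRightAction_B,
        extend_rightH ht.isRightAction_H ht.equivariant_B,
        ← (key _).1 (fun c b => ht.compatible c _ b), extend_tmul, extend_tmul]

theorem IsCrossed.restrict_extend (ht : t.IsCrossed R β γ ev) : restrict t.extend = t := by
  ext <;> simp [restrict, inclH, inclB, inclC, ht.isLeftAction_C.one_act,
    ht.isRightAction_H.act_one, ht.isRightAction_B.act_one]

end Actions

variable {ρ : V →ₗ[k] C ⊗[k] (H ⊗[k] B) →ₗ[k] V}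

/-- An action of `U` is determined by its restriction to `H`, `B` and `C`. -/
theorem extend_restrict (hR : IsQuasitriangular R) (hB : IsBraidedBialgebra R β)
    (hC : IsBraidedBialgebra R γ) {S : C ≃ₗ[k] C} (hS : IsBraidedAntipode γ S.toLinearMap)
    (hev : IsDualPairing β γ ev) (hρ : IsRightAction (mulU R β γ S ev) (oneU k H B C) ρ) :
    (restrict ρ).extend = ρ := by
  ext v c h b
  -- These two products factor `c ⊗ h ⊗ b` as `(c h) b`.
  have e₁ := mulU_tmul_one_one_tmul hR hB hC hS hev c 1 h (1 : B)
  have e₂ := mulU_tmul_one_one_tmul hR hB hC hS hev c h 1 b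
  rw [one_mul] at e₁
  rw [mul_one] at e₂
  simp [restrict, inclH, inclB, inclC, ← hρ.act_mul, e₁, e₂]

/-- The restriction of an action of `U` to `H`, `B` and `C` is compatible. -/
theorem isCrossed_restrict (hR : IsQuasitriangular R) (hB : IsBraidedBialgebra R β)
    (hC : IsBraidedBialgebra R γ) {S : C ≃ₗ[k] C} (hS : IsBraidedAntipode γ S.toLinearMap)
    (hev : IsDualPairing β γ ev) (hρ : IsRightAction (mulU R β γ S ev) (oneU k H B C) ρ) :
    (restrict ρ).IsCrossed R β γ ev := by
  have hext := extend_restrict hR hB hC hS hev hρ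
  have actH : ∀ v h, (restrict ρ).actH v h = ρ v (1 ⊗ₜ (h ⊗ₜ 1)) := fun v h => rfl
  have actB : ∀ v b, (restrict ρ).actB v b = ρ v (1 ⊗ₜ (1 ⊗ₜ b)) := fun v b => rfl
  have actC : ∀ c v, (restrict ρ).actC c v = ρ v (c ⊗ₜ (1 ⊗ₜ 1)) := fun c v => rfl
  have hH : IsRightAction (LinearMap.mul k H) 1 (restrict ρ).actH :=
    { act_one := fun v => hρ.act_one v
      act_mul := fun v g h => by
        rw [actH, actH, actH, ← hρ.act_mul, mulU_tmul_one_one_tmul hR hB hC hS hev]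
        rfl }
  have hC1 : ∀ v, (restrict ρ).actC 1 v = v := fun v => hρ.act_one v
  have hBe : IsEquivariant₂ (restrict ρ).actH β (restrict ρ).actH (restrict ρ).actB := by
    intro v b h
    -- Equivariance is the relation `b h = h₁ (b ◁ h₂)` of `U`, applied to `v`.
    rw [actH, actB, ← hρ.act_mul, mulU_inclB hR hB hC hS hev, rightB_one, rightH,
      LinearMap.comp_apply, LinearMap.comp_apply, LinearMap.coe_lTensorHom,
      LinearMap.lTensor_tmul, ← hext, Actions.extend_act₂_right hH, hext, hC1, hH.act_one]
  have hCe : IsEquivariant₂ γ (restrict ρ).actH (restrict ρ).actH (restrict ρ).actC := by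
    rw [Actions.equivariant_actC_iff hC]
    intro c v h
    have e := Actions.extend_act₂_left (γ := γ) hH v (Coalgebra.comul h) c 1 (1 : B)
    rw [hext, hH.act_one] at e
    -- Here the relation is `h c = (h₁ ▷ c) h₂`.
    rw [actC, actH, ← hρ.act_mul, mulU_tmul_inclC hR hB hC hS hev, leftC_one, leftH,
      LinearMap.comp_apply, e, actB]
    exact hρ.act_one _
  exact
  { isRightAction_H := hH
    isRightAction_B :=
      { act_one := fun v => hρ.act_one v
        act_mul := fun v a b => by
          rw [actB, actB, actB, ← hρ.act_mul, mulU_inclB hR hB hC hS hev, rightH_one hB,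
            rightB_tmul]
          rfl }
    equivariant_B := hBe
    isLeftAction_C :=
      { one_act := hC1
        mul_act := fun a b v => by
          rw [actC, actC, actC, ← hρ.act_mul, mulU_tmul_inclC hR hB hC hS hev, leftH_one hC,
            leftC_tmul]
          rfl }
    equivariant_C := hCe
    compatible := fun c v b => by
      -- The reordering is the action axiom for `b c`, since `cross` is by construction this product
      -- in `U`.
      refine (Actions.compatible_iff hR hB hC hS hev hH hBe hCe v).2 (fun c b => ?_) c b
      rw [actC, actB, ← hρ.act_mul, mulU_inclB_inclC hB hC, hext] }

/-- On these two sets `extend` is a two-sided inverse of `restrict`. -/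
theorem bijOn_restrict (hR : IsQuasitriangular R) (hB : IsBraidedBialgebra R β)
    (hC : IsBraidedBialgebra R γ) {S : C ≃ₗ[k] C} (hS : IsBraidedAntipode γ S.toLinearMap)
    (hev : IsDualPairing β γ ev) :
    Set.BijOn (restrict : (V →ₗ[k] C ⊗[k] (H ⊗[k] B) →ₗ[k] V) → Actions k H B C V)
      {ρ | IsRightAction (mulU R β γ S ev) (oneU k H B C) ρ} {t | t.IsCrossed R β γ ev} := by
  refine ⟨fun ρ hρ => isCrossed_restrict hR hB hC hS hev hρ, fun ρ hρ σ hσ e => ?_,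
    fun t ht => ⟨t.extend, ht.isRightAction_extend hR hB hC hS hev, ht.restrict_extend⟩⟩
  rw [← extend_restrict hR hB hC hS hev hρ, e, extend_restrict hR hB hC hS hev hσ]

/-- Both actions are extended from their restrictions, so a map that commutes with the three partial
actions commutes with their composite. -/
theorem map_action_iff {W : Type*} [AddCommGroup W] [Module k W]
    {σ : W →ₗ[k] C ⊗[k] (H ⊗[k] B) →ₗ[k] W}
    (hR : IsQuasitriangular R) (hB : IsBraidedBialgebra R β)
    (hC : IsBraidedBialgebra R γ) {S : C ≃ₗ[k] C} (hS : IsBraidedAntipode γ S.toLinearMap)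
    (hev : IsDualPairing β γ ev) (hρ : IsRightAction (mulU R β γ S ev) (oneU k H B C) ρ)
    (hσ : IsRightAction (mulU R β γ S ev) (oneU k H B C) σ) (f : V →ₗ[k] W) :
    (∀ x u, f (ρ x u) = σ (f x) u) ↔
      (∀ x h, f ((restrict ρ).actH x h) = (restrict σ).actH (f x) h) ∧
      (∀ x b, f ((restrict ρ).actB x b) = (restrict σ).actB (f x) b) ∧
      (∀ c x, f ((restrict ρ).actC c x) = (restrict σ).actC c (f x)) := by
  refine ⟨fun h => ⟨fun x _ => h x _, fun x _ => h x _, fun _ x => h x _⟩, fun h x u => ?_⟩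
  rw [← extend_restrict hR hB hC hS hev hρ, ← extend_restrict hR hB hC hS hev hσ]
  induction u with
  | zero => simp
  | add x y hx hy => simp only [map_add, hx, hy]
  | tmul c y =>
    induction y with
    | zero => simp
    | add x y hx hy => simp only [map_add, TensorProduct.tmul_add, hx, hy]
    | tmul g b => rw [Actions.extend_tmul, Actions.extend_tmul, h.2.1, h.1, h.2.2]

end Modules

/-! ### Module algebras over `U`. -/

section ModuleAlgebras

variable {k : Type*} [Field k] {H : Type*} [Ring H] [HopfAlgebra k H]
  {B : Type*} [Ring B] [Algebra k B] [Coalgebra k B]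
  {C : Type*} [Ring C] [Algebra k C] [Coalgebra k C]
  {R : (H ⊗[k] H)ˣ} {β : B →ₗ[k] H →ₗ[k] B} {γ : C →ₗ[k] H →ₗ[k] C} {ev : C →ₗ[k] B →ₗ[k] k}

/-- `((c ⊗ p) ⊗ (h ⊗ b)) ⊗ (c' ⊗ h' ⊗ q ⊗ b') ↦ (c ⊗ p h ⊗ b) ⊗ (c' ⊗ h' q ⊗ b')`. -/
def joinU (k H B C : Type*) [Field k] [Ring H] [HopfAlgebra k H] [Ring B] [Algebra k B]
    [Ring C] [Algebra k C] :
    ((C ⊗[k] H) ⊗[k] (H ⊗[k] B)) ⊗[k] (C ⊗[k] (H ⊗[k] (H ⊗[k] B))) →ₗ[k]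
      (C ⊗[k] (H ⊗[k] B)) ⊗[k] (C ⊗[k] (H ⊗[k] B)) :=
  let mulH : H ⊗[k] (H ⊗[k] B) →ₗ[k] H ⊗[k] B :=
    (LinearMap.mul' k H).rTensor B ∘ₗ (TensorProduct.assoc k H H B).symm.toLinearMap
  let join : (C ⊗[k] H) ⊗[k] (H ⊗[k] B) →ₗ[k] C ⊗[k] (H ⊗[k] B) :=
    mulH.lTensor C ∘ₗ (TensorProduct.assoc k C H (H ⊗[k] B)).toLinearMap
  TensorProduct.map join (mulH.lTensor C)

@[simp] theorem joinU_tmul (c c' : C) (p h h' q : H) (b b' : B) :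
    joinU k H B C (((c ⊗ₜ p) ⊗ₜ (h ⊗ₜ b)) ⊗ₜ (c' ⊗ₜ (h' ⊗ₜ (q ⊗ₜ b')))) =
      (c ⊗ₜ ((p * h) ⊗ₜ b)) ⊗ₜ (c' ⊗ₜ ((h' * q) ⊗ₜ b')) := by
  simp [joinU]

theorem comulU_tmul (c : C) (h : H) (b : B) : comulU R β γ (c ⊗ₜ (h ⊗ₜ b)) =
    joinU k H B C (TensorProduct.tensorTensorTensorComm k (C ⊗[k] H) C (H ⊗[k] B)
      (H ⊗[k] (H ⊗[k] B))
        ((TensorProduct.assoc k C H C).symm ((coactBar R γ).lTensor C (comulBar R γ c)) ⊗ₜ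
          TensorProduct.tensorTensorTensorComm k H H B (H ⊗[k] B) (Coalgebra.comul h ⊗ₜ
            TensorProduct.assoc k B H B ((coact R β).rTensor B (Coalgebra.comul b))))) := rfl

namespace Actions

section

variable {V : Type*} [AddCommGroup V] [Module k V] {t : Actions k H B C V}

/-- The action of `c` on `V ⊗ V`: `v ⊗ w ↦ c₁ ▷ (v ◁ R⁽¹⁾) ⊗ (c₂ ◁ R⁽²⁾) ▷ w`. -/
def tensorActC (R : (H ⊗[k] H)ˣ) (γ : C →ₗ[k] H →ₗ[k] C) (t : Actions k H B C V) (c : C) :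
    V ⊗[k] V →ₗ[k] V ⊗[k] V :=
  TensorProduct.map (TensorProduct.lift t.actC) (TensorProduct.lift t.actC) ∘ₗ
    midBraiding C V R γ t.actH ∘ₗ TensorProduct.mk k _ _ (Coalgebra.comul c)

/-- The action of `b` on `V ⊗ V`: `v ⊗ w ↦ v ◁ (b₁ ◁ R⁽¹⁾) ⊗ (w ◁ R⁽²⁾) ◁ b₂`. -/
def tensorActB (R : (H ⊗[k] H)ˣ) (β : B →ₗ[k] H →ₗ[k] B) (t : Actions k H B C V) (b : B) :
    V ⊗[k] V →ₗ[k] V ⊗[k] V :=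
  TensorProduct.map (TensorProduct.lift t.actB) (TensorProduct.lift t.actB) ∘ₗ
    midBraiding V B R t.actH β ∘ₗ (TensorProduct.mk k _ _).flip (Coalgebra.comul b)

/-- Together with `tensorActB_one` and `act₂_comul_one` this allows two of the three factors of `U`
to be set to `1`, which isolates the condition on the third. -/
theorem tensorActC_one (hR : IsQuasitriangular R) (hC : IsBraidedBialgebra R γ)
    (hH : IsRightAction (LinearMap.mul k H) 1 t.actH)
    (hl : IsLeftAction (LinearMap.mul k C) 1 t.actC) (v w : V) :
    t.tensorActC R γ 1 (v ⊗ₜ w) = v ⊗ₜ w := by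
  have e : ∀ X : H ⊗[k] H, TensorProduct.map (TensorProduct.lift t.actC)
      (TensorProduct.lift t.actC) (midAct C V γ t.actH X ((1 ⊗ₜ v) ⊗ₜ (1 ⊗ₜ w))) =
      t.actH v (counitRight k H X) ⊗ₜ w := by
    intro X
    induction X with
    | zero => simp
    | add x y hx hy => simp only [map_add, LinearMap.add_apply, TensorProduct.add_tmul, hx, hy]
    | tmul p q => simp [hl.one_act, hC.isModuleAlgebra.one_act, TensorProduct.smul_tmul']
  have := e (R : H ⊗[k] H)
  rw [hR.counitRight_eq_one, hH.act_one] at this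
  simpa [tensorActC, hC.comul_one, midBraiding_apply] using this

theorem tensorActB_one (hR : IsQuasitriangular R) (hB : IsBraidedBialgebra R β)
    (hH : IsRightAction (LinearMap.mul k H) 1 t.actH)
    (hr : IsRightAction (LinearMap.mul k B) 1 t.actB) (v w : V) :
    t.tensorActB R β 1 (v ⊗ₜ w) = v ⊗ₜ w := by
  have e : ∀ X : H ⊗[k] H, TensorProduct.map (TensorProduct.lift t.actB)
      (TensorProduct.lift t.actB) (midAct V B t.actH β X ((v ⊗ₜ 1) ⊗ₜ (w ⊗ₜ 1))) =
      v ⊗ₜ t.actH w (counitLeft k H X) := by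
    intro X
    induction X with
    | zero => simp
    | add x y hx hy => simp only [map_add, LinearMap.add_apply, TensorProduct.tmul_add, hx, hy]
    | tmul p q => simp [hr.act_one, hB.isModuleAlgebra.one_act, TensorProduct.smul_tmul']
  have := e (R : H ⊗[k] H)
  rw [hR.counitLeft_eq_one, hH.act_one] at this
  simpa [tensorActB, hB.comul_one, midBraiding_apply] using this

theorem act₂_comul_one (hH : IsRightAction (LinearMap.mul k H) 1 t.actH) (z : V ⊗[k] V) :
    act₂ t.actH.flip t.actH.flip (Coalgebra.comul 1) z = z := by
  rw [Bialgebra.comul_one, act₂_eq_tensorAct]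
  exact (hH.flip.tensorAct hH.flip).map_one z

/-- The three occurrences of elements of `H ⊗ H` (in the `C`-legs, in `Δ h`, in the `B`-legs) are
made independent, so that the identity can be checked on pure tensors. -/
theorem extend_joinU_act₂ (hH : IsRightAction (LinearMap.mul k H) 1 t.actH) (v w : V)
    (X Y W : H ⊗[k] H) (c₁ c₂ : C) (b₁ b₂ : B) :
    TensorProduct.map (t.extend v) (t.extend w)
      (joinU k H B C (TensorProduct.tensorTensorTensorComm k (C ⊗[k] H) C (H ⊗[k] B)
        (H ⊗[k] (H ⊗[k] B)) ((TensorProduct.assoc k C H C).symm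
          (c₁ ⊗ₜ act₂ (LinearMap.mul k H) γ.flip X (1 ⊗ₜ c₂)) ⊗ₜ
        TensorProduct.tensorTensorTensorComm k H H B (H ⊗[k] B) (Y ⊗ₜ
          TensorProduct.assoc k B H B
            (act₂ β.flip (LinearMap.mul k H) W (b₁ ⊗ₜ 1) ⊗ₜ b₂))))) =
    TensorProduct.map (TensorProduct.lift t.actB) (TensorProduct.lift t.actB)
      (midAct V B t.actH β W (TensorProduct.tensorTensorTensorComm k V V B B
        (act₂ t.actH.flip t.actH.flip Y ((t.actC.flip w).lTensor V
          (act₂ t.actH.flip γ.flip X (t.actC c₁ v ⊗ₜ c₂))) ⊗ₜ (b₁ ⊗ₜ b₂)))) := by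
  have tm : ∀ v a b, t.actH v (a * b) = t.actH (t.actH v a) b := hH.act_mul
  induction X with
  | zero => simp
  | add x y hx hy =>
    simp only [map_add, LinearMap.add_apply, TensorProduct.add_tmul, TensorProduct.tmul_add,
      hx, hy]
  | tmul p q =>
  induction Y with
  | zero => simp
  | add x y hx hy =>
    simp only [map_add, LinearMap.add_apply, TensorProduct.add_tmul, TensorProduct.tmul_add,
      hx, hy]
  | tmul e f =>
  induction W with
  | zero => simp
  | add x y hx hy =>
    simp only [map_add, LinearMap.add_apply, TensorProduct.add_tmul, TensorProduct.tmul_add,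
      hx, hy]
  | tmul x y => simp [tm]

theorem lTensor_actC_act₂ (v w : V) (X : H ⊗[k] H) (u : C ⊗[k] C) :
    (t.actC.flip w).lTensor V ((TensorProduct.lift t.actC).rTensor C
      ((TensorProduct.assoc k C V C).symm
        ((act₂ t.actH.flip γ.flip X ∘ₗ TensorProduct.mk k V C v).lTensor C u))) =
    TensorProduct.map (TensorProduct.lift t.actC) (TensorProduct.lift t.actC)
      (midAct C V γ t.actH X (TensorProduct.tensorTensorTensorComm k C C V V
        (u ⊗ₜ (v ⊗ₜ w)))) := by
  induction u with
  | zero => simp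
  | add x y hx hy => simp only [map_add, TensorProduct.add_tmul, hx, hy]
  | tmul c₁ c₂ =>
  induction X with
  | zero => simp
  | add x y hx hy =>
    simp only [map_add, LinearMap.add_apply, LinearMap.add_comp, LinearMap.lTensor_add, hx, hy]
  | tmul p q => simp

/-- After `coactBar_apply` the `C`-legs involve `R` instead of `R⁻¹` and an antipode, which is the
shape to which `actC_braiding` applies. -/
theorem extend_joinU (hR : IsQuasitriangular R)
    (hH : IsRightAction (LinearMap.mul k H) 1 t.actH) (v w : V) (h : H) (u : C ⊗[k] C)
    (s : B ⊗[k] B) :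
    TensorProduct.map (t.extend v) (t.extend w)
      (joinU k H B C (TensorProduct.tensorTensorTensorComm k (C ⊗[k] H) C (H ⊗[k] B)
        (H ⊗[k] (H ⊗[k] B)) ((TensorProduct.assoc k C H C).symm ((coactBar R γ).lTensor C u) ⊗ₜ
        TensorProduct.tensorTensorTensorComm k H H B (H ⊗[k] B) (Coalgebra.comul h ⊗ₜ
          TensorProduct.assoc k B H B ((coact R β).rTensor B s))))) =
    TensorProduct.map (TensorProduct.lift t.actB) (TensorProduct.lift t.actB)
      (midAct V B t.actH β (R : H ⊗[k] H) (TensorProduct.tensorTensorTensorComm k V V B B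
        (act₂ t.actH.flip t.actH.flip (Coalgebra.comul h) ((t.actC.flip w).lTensor V
          (act₂ t.actH.flip γ.flip (R : H ⊗[k] H) ((t.actC.flip v).rTensor C u))) ⊗ₜ s))) := by
  induction u with
  | zero => simp
  | add x y hx hy => simp only [map_add, TensorProduct.add_tmul, hx, hy]
  | tmul c₁ c₂ =>
  induction s with
  | zero => simp
  | add x y hx hy => simp only [map_add, TensorProduct.tmul_add, hx, hy]
  | tmul b₁ b₂ =>
    rw [LinearMap.lTensor_tmul, LinearMap.rTensor_tmul, coactBar_apply hR, coact,
      LinearMap.comp_apply, LinearMap.flip_apply, TensorProduct.mk_apply,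
      extend_joinU_act₂ hH]
    simp

/-- The action of `c ⊗ h ⊗ b` on `V ⊗ V` through the coproduct of `U`. -/
theorem extend_comulU (hR : IsQuasitriangular R) (hC : IsBraidedBialgebra R γ)
    (hH : IsRightAction (LinearMap.mul k H) 1 t.actH)
    (hCe : IsEquivariant₂ γ t.actH t.actH t.actC) (v w : V) (c : C) (h : H) (b : B) :
    TensorProduct.map (t.extend v) (t.extend w) (comulU R β γ (c ⊗ₜ (h ⊗ₜ b))) =
      t.tensorActB R β b (act₂ t.actH.flip t.actH.flip (Coalgebra.comul h)
        (t.tensorActC R γ c (v ⊗ₜ w))) := by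
  -- `actC_braiding` cancels the `R⁻¹` in the coproduct of `C̄` and leaves the braided action of `C`
  -- on `V ⊗ V`.
  rw [comulU_tmul, extend_joinU hR hH, comulBar, LinearMap.comp_apply, actC_braiding hR hC hCe,
    lTensor_actC_act₂]
  simp [tensorActB, tensorActC, midBraiding_apply]

end

section

variable {V : Type*} [Ring V] [Algebra k V] {t : Actions k H B C V}

theorem mul'_tensorActB (h : ∀ v w b, t.actB (v * w) b = LinearMap.mul' k V
    (TensorProduct.map (TensorProduct.lift t.actB) (TensorProduct.lift t.actB)
      (midBraiding V B R t.actH β ((v ⊗ₜ[k] w) ⊗ₜ[k] Coalgebra.comul b)))) (b : B)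
    (z : V ⊗[k] V) :
    LinearMap.mul' k V (t.tensorActB R β b z) = t.actB (LinearMap.mul' k V z) b := by
  induction z with
  | zero => simp
  | add x y hx hy => simp only [map_add, LinearMap.add_apply, hx, hy]
  | tmul v w => simp [h, tensorActB]

theorem mul'_act₂ (hH : IsModuleAlgebra Coalgebra.comul Coalgebra.counit t.actH) (h : H)
    (z : V ⊗[k] V) : LinearMap.mul' k V (act₂ t.actH.flip t.actH.flip (Coalgebra.comul h) z) =
      t.actH (LinearMap.mul' k V z) h := by
  induction z with
  | zero => simp
  | add x y hx hy => simp only [map_add, LinearMap.add_apply, hx, hy]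
  | tmul v w => rw [act₂_flip_tmul, ← hH.mul_act, LinearMap.mul'_apply]

/-- Actions making `V` a module algebra extend to a module algebra structure over `U`. -/
theorem IsCrossedAlgebra.isModuleAlgebra_extend (hR : IsQuasitriangular R)
    (hC : IsBraidedBialgebra R γ) (ht : t.IsCrossedAlgebra R β γ ev) :
    IsModuleAlgebra (comulU R β γ) (counitU k H B C) t.extend where
  mul_act v w x := by
    induction x with
    | zero => simp
    | add x y hx hy => simp only [map_add, hx, hy]
    | tmul c x =>
    induction x with
    | zero => simp
    | add x y hx hy => simp only [map_add, TensorProduct.tmul_add, hx, hy]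
    | tmul h b =>
      -- The product `V ⊗ V → V` intertwines the operators of `b`, `h` and `c` in turn, from the
      -- outermost inwards.
      rw [extend_comulU hR hC ht.isRightAction_H ht.equivariant_C, mul'_tensorActB ht.mul_actB,
        mul'_act₂ ht.isModuleAlgebra_H, extend_tmul, ht.mul_actC]
      rfl
  one_act x := by
    induction x with
    | zero => simp
    | add x y hx hy => simp only [map_add, add_smul, hx, hy]
    | tmul c x =>
    induction x with
    | zero => simp
    | add x y hx hy => simp only [map_add, TensorProduct.tmul_add, add_smul, hx, hy]
    | tmul h b =>
      simp [ht.one_actC, ht.isModuleAlgebra_H.one_act, ht.one_actB, counitU, smul_smul, mul_assoc]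

/-- The restriction of a module algebra structure over `U`. -/
theorem IsCrossed.isCrossedAlgebra (hR : IsQuasitriangular R) (hB : IsBraidedBialgebra R β)
    (hC : IsBraidedBialgebra R γ) (ht : t.IsCrossed R β γ ev)
    (hm : IsModuleAlgebra (comulU R β γ) (counitU k H B C) t.extend) :
    t.IsCrossedAlgebra R β γ ev := by
  -- Multiplicativity over `U`, written through the three partial actions; each condition below is
  -- the case in which the other two entries are `1`.
  have e : ∀ v w c h b, t.actB (t.actH (t.actC c (v * w)) h) b =
      LinearMap.mul' k V (t.tensorActB R β b (act₂ t.actH.flip t.actH.flip (Coalgebra.comul h)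
        (t.tensorActC R γ c (v ⊗ₜ w)))) := by
    intro v w c h b
    rw [← extend_comulU hR hC ht.isRightAction_H ht.equivariant_C, ← hm.mul_act, extend_tmul]
  have e' : ∀ c h b, t.actB (t.actH (t.actC c 1) h) b =
      counitU k H B C (c ⊗ₜ (h ⊗ₜ b)) • (1 : V) := by
    intro c h b
    rw [← hm.one_act, extend_tmul]
  have H1 := ht.isRightAction_H.act_one
  have B1 := ht.isRightAction_B.act_one
  have C1 := ht.isLeftAction_C.one_act
  have hB1 : ∀ z, t.tensorActB R β 1 z = z := by
    intro z
    induction z with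
    | zero => simp
    | add x y hx hy => simp only [map_add, hx, hy]
    | tmul v w => exact tensorActB_one hR hB ht.isRightAction_H ht.isRightAction_B v w
  have hC1 := tensorActC_one hR hC ht.isRightAction_H ht.isLeftAction_C
  have hH1 := act₂_comul_one ht.isRightAction_H
  exact
  { toIsCrossed := ht
    isModuleAlgebra_H :=
      { mul_act := fun v w h => by
          have := e v w 1 h 1
          rwa [C1, B1, hC1, hB1, act₂_flip_tmul] at this
        one_act := fun h => by
          have := e' 1 h 1
          rw [C1, B1] at this
          simpa [counitU, hB.counit_one, hC.counit_one] using this }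
    mul_actB := fun v w b => by
      have := e v w 1 1 b
      rw [C1, H1, hC1, hH1] at this
      exact this
    one_actB := fun b => by
      have := e' 1 1 b
      rw [C1, H1] at this
      simpa [counitU, hC.counit_one] using this
    mul_actC := fun c v w => by
      have := e v w c 1 1
      rw [H1, B1, hB1, hH1] at this
      exact this
    one_actC := fun c => by
      have := e' c 1 1
      rw [H1, B1] at this
      simpa [counitU, hB.counit_one] using this }

end

end Actions

/-- Injectivity is inherited from the bijection for modules; it remains that `restrict` and `extend`
preserve the module algebra conditions. -/
theorem bijOn_restrict_algebra {V : Type*} [Ring V] [Algebra k V]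
    (hR : IsQuasitriangular R) (hB : IsBraidedBialgebra R β)
    (hC : IsBraidedBialgebra R γ) {S : C ≃ₗ[k] C} (hS : IsBraidedAntipode γ S.toLinearMap)
    (hev : IsDualPairing β γ ev) :
    Set.BijOn (restrict : (V →ₗ[k] C ⊗[k] (H ⊗[k] B) →ₗ[k] V) → Actions k H B C V)
      {ρ | IsRightAction (mulU R β γ S ev) (oneU k H B C) ρ ∧
        IsModuleAlgebra (comulU R β γ) (counitU k H B C) ρ}
      {t | t.IsCrossedAlgebra R β γ ev} := by
  refine ⟨fun ρ hρ => ?_, (bijOn_restrict hR hB hC hS hev).injOn.mono fun ρ hρ => hρ.1,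
    fun t ht => ⟨t.extend, ⟨ht.toIsCrossed.isRightAction_extend hR hB hC hS hev,
      ht.isModuleAlgebra_extend hR hC⟩, ht.toIsCrossed.restrict_extend⟩⟩
  refine (isCrossed_restrict hR hB hC hS hev hρ.1).isCrossedAlgebra hR hB hC ?_
  rw [extend_restrict hR hB hC hS hev hρ.1]
  exact hρ.2

end ModuleAlgebras

end

end DoubleBosonisation

theorem lemma3p11 {k : Type*} [Field k]
    {H : Type*} [Ring H] [HopfAlgebra k H]
    {B : Type*} [Ring B] [Algebra k B] [Coalgebra k B]
    {C : Type*} [Ring C] [Algebra k C] [Coalgebra k C]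
    (R : (H ⊗[k] H)ˣ) (hR : IsQuasitriangular R)
    (β : B →ₗ[k] H →ₗ[k] B) (hB : IsBraidedBialgebra R β)
    (γ : C →ₗ[k] H →ₗ[k] C) (hC : IsBraidedBialgebra R γ)
    (S : C ≃ₗ[k] C) (hS : IsBraidedAntipode γ S.toLinearMap)
    (ev : C →ₗ[k] B →ₗ[k] k) (hev : IsDualPairing β γ ev) :
    -- right `U`-modules are compatible `H`-, `B`- and `C`-modules
    (∀ (V : Type*) [AddCommGroup V] [Module k V],
      Set.BijOn (restrict : (V →ₗ[k] C ⊗[k] (H ⊗[k] B) →ₗ[k] V) → Actions k H B C V)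
        {ρ | IsRightAction (mulU R β γ S ev) (oneU k H B C) ρ}
        {t | t.IsCrossed R β γ ev}) ∧
    -- with the same morphisms
    (∀ (V : Type*) (W : Type*) [AddCommGroup V] [Module k V] [AddCommGroup W] [Module k W]
      (ρ : V →ₗ[k] C ⊗[k] (H ⊗[k] B) →ₗ[k] V) (σ : W →ₗ[k] C ⊗[k] (H ⊗[k] B) →ₗ[k] W),
      IsRightAction (mulU R β γ S ev) (oneU k H B C) ρ →
      IsRightAction (mulU R β γ S ev) (oneU k H B C) σ →
      ∀ f : V →ₗ[k] W, (∀ x u, f (ρ x u) = σ (f x) u) ↔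
        (∀ x h, f ((restrict ρ).actH x h) = (restrict σ).actH (f x) h) ∧
        (∀ x b, f ((restrict ρ).actB x b) = (restrict σ).actB (f x) b) ∧
        (∀ c x, f ((restrict ρ).actC c x) = (restrict σ).actC c (f x))) ∧
    -- right `U`-module algebras are compatible `H`-, `B`- and `C`-module algebras
    (∀ (V : Type*) [Ring V] [Algebra k V],
      Set.BijOn (restrict : (V →ₗ[k] C ⊗[k] (H ⊗[k] B) →ₗ[k] V) → Actions k H B C V)
        {ρ | IsRightAction (mulU R β γ S ev) (oneU k H B C) ρ ∧
          IsModuleAlgebra (comulU R β γ) (counitU k H B C) ρ}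
        {t | t.IsCrossedAlgebra R β γ ev}) := by
  exact ⟨fun V _ _ => bijOn_restrict hR hB hC hS hev,
    fun V W _ _ _ _ ρ σ hρ hσ f => map_action_iff hR hB hC hS hev hρ hσ f,
    fun V _ _ => bijOn_restrict_algebra hR hB hC hS hev⟩
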